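/- **Definitions.** A *run-length straight-line program* (RLSLP) generating a string $T$ is a finite set $\mathcal D$ of productions with a start symbol $S$. Variables are positive integers, characters are natural numbers, and each variable has exactly one production, of the form $X\to a$ (a character), $X\to X_\ell X_r$, or $X\to \hat X^k$ with $k\ge1$. The productions are acyclic, no two variables have the same right-hand side, every variable occurs in the derivation tree of $S$, and $S$ derives $T$. An *SLP* is an RLSLP without run rules $X\to\hat X^k$. The *size* is the number of productions. Let $M$ be a positive integer and let $f$ map integer sequences of length $\log^*M+11$ to $\{0,1\}$. Assume that for every $p\in[1..M]^n$ with $n\ge2$ and $p[i]\ne p[i+1]$ for all $i<n$, the bits $d[i]=f(\tilde p[i-\log^*M-6],\dots,\tilde p[i+4])$, where $\tilde p$ is $p$ padded by zeros, satisfy $d[1]=1$, $d[n]=0$, $d[i]+d[i+1]\le1$ for $1\le i<n$, and $d[i]+d[i+1]+d[i+2]+d[i+3]\ge1$ for $1\le i<n-3$. Then $\mathit{Eblock}(p)$ cuts $p$ in front of each $i$ with $d[i]=1$, and $\mathit{Epow}(s)$ splits $s$ into its maximal runs $x^k$. A *signature encoding* of a nonempty string $T$ is an RLSLP $\mathcal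 G$ generating $T$, with all variables (*signatures*) in $[1..M]$, whose productions are those that occur when $T$ is replaced by the sequence of the signatures of its characters, and then $\mathit{Epow}$ and $\mathit{Eblock}$ are applied alternately, beginning with $\mathit{Epow}$. Each run $x^k$ is replaced by the variable with production $\to x^k$. Each block $x_1x_2\cdots x_m$ is replaced by one variable through pair productions from left to right, $(\cdots((x_1x_2)x_3)\cdots)x_m$. The process stops as soon as a sequence produced by $\mathit{Epow}$ consists of a single signature, which is the start symbol. The *binary expansion* $\mathcal S(\mathcal G)$ of $\mathcal G$ is the following grammar. For each rule $e\to \hat e^k$ of $\mathcal G$ it contains variables for $\hat e^{2^1},\dots,\hat e^{2^t}$, $t=\lfloor\log_2k\rfloor$, obtained by repeated doubling, and the variables that concatenate these powers according to the binary digits of $k$, from the highest digit to the lowest. The last of them, representing $\hat e^k$, takes the place of $e$ (for $k=1$ this is $\hat e$ itself). The variable for $\hat e^m$ is named by $(\hat e,m)$ and is shared by all run rules with base $\hat e$. Character and pair productions of $\mathcal G$ are kept, with every run signature replaced by the variable that takes its place. Thus each production of $\mathcal G$ has *corresponding* productions in $\mathcal S(\mathcal G)$, and $\mathcal S(\mathcal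 G)$ is the union of these. **Theorem.** Throughout, all constants are absolute, $M\ge4|T|$ (in (2) also $M\ge4|T'|$), and $f$ is any function as above. (1) Let $\mathcal G$ be a signature encoding of size $w$ of a nonempty string $T$. Then $\mathcal S(\mathcal G)$ is an SLP generating $T$, and its size is $O(w(\log|T|+1))$. There is a single program for the unit-cost word RAM that, given $M$ and $\mathcal G$ (as a list of its productions in any order, with its start symbol), computes $\mathcal S(\mathcal G)$ (each production listed once, with the start symbol) in $O(w(\log|T|+1))$ time, whenever the word length is at least $c\log_2M$ bits, for an absolute constant $c$, and the characters of $T$ fit into machine words. For $|T|\ge2$ both bounds are $O(w\log|T|)$. (2) Let $T'$ be a nonempty string that arises from the nonempty string $T$ by inserting or deleting one substring of length $y$, and let $\mathcal G$ be a signature encoding of $T$. Then $\mathcal G$ can be updated to a signature encoding $\mathcal G'$ of $T'$, with the same $M$ and $f$, by removing and creating $O(y+\log|T'|\log^*M)$ signatures with their productions in total, in such a way that $\mathcal S(\mathcal G)$ is updated to the SLP $\mathcal S(\mathcal G')$ by changing only productions that correspond to these signatures: every production removed from $\mathcal S(\mathcal G)$ corresponds to a production removed from $\mathcal G$, and every production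 added corresponds to a production created in $\mathcal G'$. The total number of productions removed from or added to the SLP is $O((y+\log|T'|\log^*M)(\log|T'|+1))$. -/

import Mathlib

namespace SigEnc

/-! ## Run-length grammars and straight-line programs -/

/-- Right-hand sides of productions: a terminal character, a pair of variables `l r`,
or a run `x ^ k` of a variable. Characters and variables are natural numbers. -/
inductive Rhs where
  | char (a : ℕ)
  | pair (l r : ℕ)
  | run (x k : ℕ)
  deriving DecidableEq

/-- The variables occurring in a right-hand side. -/
def Rhs.vars : Rhs → Finset ℕ
  | .char _ => ∅
  | .pair l r => {l, r}
  | .run x _ => {x}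

/-- A production `X → expr`. -/
abbrev Production := ℕ × Rhs

/-- A grammar: its finite set of productions and its start symbol. -/
structure Grammar where
  prods : Finset Production
  start : ℕ

/-- The variables: the left-hand sides of the productions. -/
def Grammar.variables (G : Grammar) : Finset ℕ := G.prods.image Prod.fst

/-- The size of a grammar is its number of productions. -/
def Grammar.size (G : Grammar) : ℕ := G.prods.card

/-- `Derives D X s`: the variable `X` derives the string `s` with the productions `D`. -/
inductive Derives (D : Finset Production) : ℕ → List ℕ → Prop where
  | char {X a : ℕ} : (X, Rhs.char a) ∈ D → Derives D X [a]
  | pair {X l r : ℕ} {u v : List ℕ} : (X, Rhs.pair l r) ∈ D →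
      Derives D l u → Derives D r v → Derives D X (u ++ v)
  | run {X x k : ℕ} {u : List ℕ} : (X, Rhs.run x k) ∈ D →
      Derives D x u → Derives D X (List.replicate k u).flatten

/-- `Y` occurs on the right-hand side of the production of `X`. -/
def Child (D : Finset Production) (X Y : ℕ) : Prop := ∃ e, (X, e) ∈ D ∧ Y ∈ e.vars

/-- `G` is a run-length straight-line program generating `T`: variables are positive integers,
every variable has one production, the productions are acyclic (so that the variables can be
enumerated with right-hand sides referring to earlier variables only), no two variables have the
same right-hand side, every variable occurs in the derivation tree of the start symbol, and the
start symbol derives `T`. -/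
structure IsRLSLP (G : Grammar) (T : List ℕ) : Prop where
  pos : ∀ X ∈ G.variables, 0 < X
  deterministic : ∀ X e e', (X, e) ∈ G.prods → (X, e') ∈ G.prods → e = e'
  acyclic : ∃ rank : ℕ → ℕ, ∀ X Y, Child G.prods X Y → Y ∈ G.variables ∧ rank Y < rank X
  run_pos : ∀ X x k, (X, Rhs.run x k) ∈ G.prods → 0 < k
  nonredundant : ∀ X Y e, (X, e) ∈ G.prods → (Y, e) ∈ G.prods → X = Y
  start_mem : G.start ∈ G.variables
  useful : ∀ X ∈ G.variables, Relation.ReflTransGen (Child G.prods) G.start X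
  derives : Derives G.prods G.start T

/-- `G` is a straight-line program generating `T`: a run-length straight-line program
without run rules. -/
structure IsSLP (G : Grammar) (T : List ℕ) : Prop extends IsRLSLP G T where
  no_run : ∀ X x k, (X, Rhs.run x k) ∉ G.prods

/-! ## Locally consistent parsing -/

/-- The iterated logarithm to base 2: the least `i` such that `log₂ (⋯ (log₂ n))` (`i` times)
is at most `1`. (Rounding up at each step does not change that `i`: both conditions say that
`n` is at most a tower of `i` twos.) -/
noncomputable def logStar (n : ℕ) : ℕ := sInf {i | (Nat.clog 2)^[i] n ≤ 1}

/-- Width of the left context, `Δ_L`. -/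
noncomputable def deltaL (W : ℕ) : ℕ := logStar W + 6

/-- Width of the right context, `Δ_R`. -/
def deltaR : ℕ := 4

/-- The window `p̃[i - Δ_L], …, p̃[i + Δ_R]` around position `i` (positions count from `0`);
`p̃` is `p`, padded with zeros on both sides. -/
noncomputable def window (W : ℕ) (p : List ℕ) (i : ℕ) : List ℕ :=
  (List.range (deltaL W + deltaR + 1)).map fun j =>
    if deltaL W ≤ i + j then p.getD (i + j - deltaL W) 0 else 0

/-- The bit sequence `d` of `p` (positions count from `0`). -/
noncomputable def bits (W : ℕ) (f : List ℕ → Bool) (p : List ℕ) (i : ℕ) : Bool :=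
  f (window W p i)

/-- `f` is a locally consistent parsing function for the integers `1, …, W`. -/
def IsLocallyConsistent (W : ℕ) (f : List ℕ → Bool) : Prop :=
  ∀ p : List ℕ, 2 ≤ p.length → (∀ x ∈ p, 1 ≤ x ∧ x ≤ W) → p.IsChain (· ≠ ·) →
    bits W f p 0 = true ∧
    bits W f p (p.length - 1) = false ∧
    (∀ i, i + 1 < p.length → ¬ (bits W f p i = true ∧ bits W f p (i + 1) = true)) ∧
    (∀ i, i + 4 < p.length → bits W f p i = true ∨ bits W f p (i + 1) = true ∨
      bits W f p (i + 2) = true ∨ bits W f p (i + 3) = true)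

/-- `Eblock`: cut `p` in front of every position at which the bit sequence `d` is `1`. -/
def eblock (d : ℕ → Bool) (p : List ℕ) : List (List ℕ) :=
  (p.zipIdx.splitBy fun _ y => !d y.2).map fun q => q.map Prod.fst

/-- `Epow`: the maximal runs `x ^ k` of `s`, as pairs `(x, k)`. -/
def epow (s : List ℕ) : List (ℕ × ℕ) :=
  (s.splitBy fun x y => x == y).map fun q => (q.headD 0, q.length)

/-! ## Signature encodings -/

/-- `SigFold D c xs e`: reading `xs` from left to right, and replacing the current signature `c`
and the next entry `x` by the signature of the pair `c x`, leads from `c` to `e`. -/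
inductive SigFold (D : Finset Production) : ℕ → List ℕ → ℕ → Prop where
  | nil (c : ℕ) : SigFold D c [] c
  | cons {c x c' e : ℕ} {xs : List ℕ} : (c', Rhs.pair c x) ∈ D → SigFold D c' xs e →
      SigFold D c (x :: xs) e

/-- `e` is the signature `Sig(x₁ x₂ ⋯)` of a block. -/
def SigBlock (D : Finset Production) (q : List ℕ) (e : ℕ) : Prop :=
  ∃ x₁ x₂ xs, q = x₁ :: x₂ :: xs ∧ SigFold D x₁ (x₂ :: xs) e

/-- `G` is a signature encoding of `T` with signatures in `[1..M]` and parsing function `f`: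
a run-length straight-line program for `T` whose productions are those met when `Epow` and
`Eblock` are applied in turn to `T`, until a single signature, the start symbol, is left.
There are no other productions, since `IsRLSLP` excludes useless variables. -/
structure IsSignatureEncoding (M : ℕ) (f : List ℕ → Bool) (T : List ℕ) (G : Grammar) : Prop where
  rlslp : IsRLSLP G T
  le_max : ∀ e ∈ G.variables, e ≤ M
  levels : ∃ (h : ℕ) (shrink pow : ℕ → List ℕ),
    List.Forall₂ (fun a e => (e, Rhs.char a) ∈ G.prods) T (shrink 0) ∧
    (∀ t ≤ h, List.Forall₂ (fun q e => (e, Rhs.run q.1 q.2) ∈ G.prods)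
      (epow (shrink t)) (pow t)) ∧
    (∀ t < h, List.Forall₂ (SigBlock G.prods)
      (eblock (bits M f (pow t)) (pow t)) (shrink (t + 1))) ∧
    (∀ t < h, (pow t).length ≠ 1) ∧
    pow h = [G.start]

/-- `T'` arises from `T` by inserting or deleting one substring of length `y`. -/
def IsUpdate (T T' : List ℕ) (y : ℕ) : Prop :=
  ∃ A Y B : List ℕ, Y.length = y ∧
    ((T = A ++ B ∧ T' = A ++ Y ++ B) ∨ (T = A ++ Y ++ B ∧ T' = A ++ B))

/-! ## Expanding run rules through binary powers -/

/-- The variable that stands for `x ^ m`, for `x` in `[1..M]` and `m ≥ 1`;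
the variable for `x ^ 1` is `x`. -/
def powVar (M x m : ℕ) : ℕ := (m - 1) * (M + 1) + x

open Classical in
/-- The variable of the straight-line program that represents the signature `e`: the variable for
`x ^ k` if the production of `e` is `e → x ^ k`, and `e` itself otherwise. -/
noncomputable def repr (M : ℕ) (D : Finset Production) (e : ℕ) : ℕ :=
  if h : ∃ q : ℕ × ℕ, (e, Rhs.run q.1 q.2) ∈ D then powVar M h.choose.1 h.choose.2 else e

/-- The productions for `x ^ (2 ^ j)`, `1 ≤ j ≤ ⌊log₂ k⌋`. -/
def doublings (M x k : ℕ) : Finset Production :=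
  (Finset.range (Nat.log 2 k)).image fun j =>
    (powVar M x (2 ^ (j + 1)), Rhs.pair (powVar M x (2 ^ j)) (powVar M x (2 ^ j)))

/-- The productions that concatenate the powers `x ^ (2 ^ i)`, over the binary digits `1` of `k`
from the highest to the lowest. After digit `i` the exponent is `k / 2 ^ i * 2 ^ i`. -/
def concatenations (M x k : ℕ) : Finset Production :=
  ((Finset.range (Nat.log 2 k)).filter fun i => k.testBit i = true).image fun i =>
    (powVar M x (k / 2 ^ i * 2 ^ i),
      Rhs.pair (powVar M x (k / 2 ^ i * 2 ^ i - 2 ^ i)) (powVar M x (2 ^ i)))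

/-- The productions of the straight-line program that correspond to a signature,
that is, to a production of the signature encoding. -/
noncomputable def expand (M : ℕ) (D : Finset Production) : Production → Finset Production
  | (e, .char a) => {(e, .char a)}
  | (e, .pair l r) => {(e, .pair (repr M D l) (repr M D r))}
  | (_, .run x k) => doublings M x k ∪ concatenations M x k

/-- The straight-line program obtained by expanding every run rule through binary powers. -/
noncomputable def Grammar.toSLP (M : ℕ) (G : Grammar) : Grammar where
  prods := G.prods.biUnion (expand M G.prods)
  start := repr M G.prods G.start

/-! ## The unit-cost word RAM -/

/-- Binary operations of the machine. -/
inductive BinOp where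
  | add | sub | mul | div | mod | and | or | xor | shl | shr

/-- Value of a binary operation; the machine reduces it modulo `2 ^ b`. -/
def BinOp.eval (b : ℕ) : BinOp → ℕ → ℕ → ℕ
  | .add, x, y => x + y
  | .sub, x, y => x + 2 ^ b - y
  | .mul, x, y => x * y
  | .div, x, y => x / y
  | .mod, x, y => x % y
  | .and, x, y => x &&& y
  | .or, x, y => x ||| y
  | .xor, x, y => x ^^^ y
  | .shl, x, y => x <<< y
  | .shr, x, y => x >>> y

/-- Programs. The arguments `d, x, y, …` are register numbers: a fixed program uses a fixed finite
set of registers. -/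
inductive Program where
  | skip
  | const (d c : ℕ)
  | op (o : BinOp) (d x y : ℕ)
  | load (d x : ℕ)
  | store (x y : ℕ)
  | seq (P Q : Program)
  | ifLt (x y : ℕ) (P Q : Program)
  | whileLt (x y : ℕ) (P : Program)

/-- The state of the machine: registers and memory cells. -/
structure State where
  reg : ℕ → ℕ
  mem : ℕ → ℕ

/-- Assign to a register. -/
def State.setReg (s : State) (d v : ℕ) : State := { s with reg := Function.update s.reg d v }

/-- Assign to a memory cell. -/
def State.setMem (s : State) (i v : ℕ) : State := { s with mem := Function.update s.mem i v }

/-- `Exec b P s n s'`: with words of `b` bits, the program `P` started in state `s` halts in state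
`s'` after `n` unit-cost steps (assignments, loads, stores and tests). -/
inductive Exec (b : ℕ) : Program → State → ℕ → State → Prop where
  | skip (s : State) : Exec b .skip s 0 s
  | const (d c : ℕ) (s : State) : Exec b (.const d c) s 1 (s.setReg d (c % 2 ^ b))
  | op (o : BinOp) (d x y : ℕ) (s : State) :
      Exec b (.op o d x y) s 1 (s.setReg d (o.eval b (s.reg x) (s.reg y) % 2 ^ b))
  | load (d x : ℕ) (s : State) : Exec b (.load d x) s 1 (s.setReg d (s.mem (s.reg x)))
  | store (x y : ℕ) (s : State) : Exec b (.store x y) s 1 (s.setMem (s.reg x) (s.reg y))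
  | seq {P Q : Program} {s s' s'' : State} {m n : ℕ} :
      Exec b P s m s' → Exec b Q s' n s'' → Exec b (.seq P Q) s (m + n) s''
  | ifTrue {x y : ℕ} {P Q : Program} {s s' : State} {n : ℕ} :
      s.reg x < s.reg y → Exec b P s n s' → Exec b (.ifLt x y P Q) s (n + 1) s'
  | ifFalse {x y : ℕ} {P Q : Program} {s s' : State} {n : ℕ} :
      ¬ s.reg x < s.reg y → Exec b Q s n s' → Exec b (.ifLt x y P Q) s (n + 1) s'
  | whileTrue {x y : ℕ} {P : Program} {s s' s'' : State} {m n : ℕ} :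
      s.reg x < s.reg y → Exec b P s m s' → Exec b (.whileLt x y P) s' n s'' →
      Exec b (.whileLt x y P) s (m + n + 1) s''
  | whileFalse {x y : ℕ} {P : Program} {s : State} :
      ¬ s.reg x < s.reg y → Exec b (.whileLt x y P) s 1 s

/-- A production as four words: variable, kind, and two arguments. -/
def record : Production → List ℕ
  | (e, .char a) => [e, 0, a, 0]
  | (e, .pair l r) => [e, 1, l, r]
  | (e, .run x k) => [e, 2, x, k]

/-- A list of productions with a start symbol as a sequence of words. -/
def words (start : ℕ) (L : List Production) : List ℕ :=
  L.length :: start :: L.flatMap record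

/-- `L` lists the productions of `G`, in some order, each of them once. -/
def Lists (L : List Production) (G : Grammar) : Prop := L.Nodup ∧ L.toFinset = G.prods

/-- Initial state: `M`, followed by the grammar, stands at address `0`; all else is zero. -/
def inputState (M start : ℕ) (L : List Production) : State where
  reg := fun _ => 0
  mem := fun i => (M :: words start L).getD i 0

/-- In state `s` the memory holds the grammar `G`, from the address in register `0` on. -/
def Holds (s : State) (G : Grammar) : Prop :=
  ∃ L, Lists L G ∧ ∀ i < (words G.start L).length,
    s.mem (s.reg 0 + i) = (words G.start L).getD i 0

end SigEnc

namespace SigEnc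

/-! ## Combinatorics of `Eblock` and `Epow` -/

/-! Size in (1). A run of exponent `k` derives at least `k` characters, so `k ≤ T.length`, and its
expansion along binary digits has at most `2 * Nat.log 2 k` productions.

The expansion as an SLP. The expansions of different run rules must fit together. A sum `a + b`
formed inside a power determines `a` and `b`: a power of two is doubled, any other exponent splits
off its lowest binary digit. This does not depend on the run rule (`PowStep.unique`), so rules with
a common base share productions without conflict. Right-hand sides stay distinct because of the
shape of a pair in a signature encoding: its second component is a run `x ^ k`, its first one is a
run with another base or a pair of the next level (`IsLevel`, `PairShape`), whereas a pair inside a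
power has the same base twice. Acyclicity follows from the lengths of the derived strings
(`IsSignatureEncoding.isSLP_toSLP`).

The machine. One pass over the input tabulates the representative of each signature, a second one
writes the expansions. A table of marks, indexed by left-hand sides, suppresses repetitions in
constant time. All variables are below `M ^ 3`, so a fixed number of tables of that size suffices.

Updates. A bit of `Eblock` depends on `logStar M + 6` entries to the left and `4` to the right, and
among four consecutive positions one is cut. Hence near either border of the edited part there is a
cut that any replacement leaves in place, and all blocks beyond it are common
(`exists_common_blocks`). Likewise at most one run on each side is affected (`exists_common_runs`).
A changed window of `n` entries thus becomes one of at most `(n + logStar M + 20) / 2` entries on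
the next level. Since the whole sequence halves too, there are logarithmically many levels, and the
changes add up to `changeBound`. `Parse.exists_kept` carries out this induction.

New productions are named so that none of them belongs to the old grammar. The common productions
are therefore kept ones, and the kept set is closed under the variables it mentions. So a common
production expands alike in both grammars, and the SLP changes only in expansions of changed
productions (`toSLP_sdiff_subset`). The supply `M` suffices because an encoding has at most `4 *
T.length` productions. -/

theorem splitBy_cons_cons {α : Type*} (r : α → α → Bool) (a b : α) (l : List α) :
    ∃ q qs, (b :: l).splitBy r = q :: qs ∧
      (a :: b :: l).splitBy r = if r a b then (a :: q) :: qs else [a] :: q :: qs := by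
  obtain ⟨q, qs, hq⟩ := List.exists_cons_of_ne_nil
    (List.splitBy_ne_nil.2 (List.cons_ne_nil b l) : (b :: l).splitBy r ≠ [])
  refine ⟨q, qs, hq, ?_⟩
  have hh := List.head_head_splitBy r (List.cons_ne_nil b l)
  obtain ⟨h1, h2, h3, h4⟩ := List.splitBy_eq_iff.1 hq
  have hqne : q ≠ [] := fun h => h2 (by simp [h])
  obtain ⟨c, q', rfl⟩ := List.exists_cons_of_ne_nil hqne
  have hc : c = b := by
    have := congrArg List.head? h1
    simpa using this.symm
  subst hc
  split_ifs with h
  · rw [List.splitBy_eq_iff]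
    refine ⟨by simp [h1], by simpa using h2, ?_, ?_⟩
    · intro m hm
      rcases List.mem_cons.1 hm with rfl | hm
      · exact (List.isChain_cons_cons.2 ⟨h, h3 _ (by simp)⟩)
      · exact h3 _ (by simp [hm])
    · rw [List.isChain_cons] at h4 ⊢
      refine ⟨fun y hy => ?_, h4.2⟩
      obtain ⟨ha, hb, h5⟩ := h4.1 y hy
      exact ⟨by simp, hb, by simpa using h5⟩
  · rw [← hq]
    have : [a].splitBy r = [[a]] := by
      rw [List.splitBy_eq_iff]; simp
    have e := List.splitBy_append (r := r) (l := [a]) (m := c :: l) (by simpa using h)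
    rwa [this] at e

/-- Cut `p`, whose positions are counted from `k`, in front of every position at which `d` is
true. -/
def cutFrom (d : ℕ → Bool) : ℕ → List ℕ → List (List ℕ)
  | _, [] => []
  | _, [x] => [[x]]
  | k, x :: y :: l =>
    if d (k + 1) then [x] :: cutFrom d (k + 1) (y :: l)
    else match cutFrom d (k + 1) (y :: l) with
      | [] => [[x]]
      | q :: qs => (x :: q) :: qs

/-- Trades `List.splitBy` on an indexed list for structural recursion in which the position is a
parameter, so that shifts of positions are handled by congruence. -/
theorem splitBy_zipIdx (d : ℕ → Bool) (p : List ℕ) (k : ℕ) :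
    ((p.zipIdx k).splitBy fun _ y => !d y.2).map (fun q => q.map Prod.fst) = cutFrom d k p := by
  induction p generalizing k with
  | nil => simp [cutFrom]
  | cons x l ih =>
    cases l with
    | nil =>
      have : ([(x, k)] : List (ℕ × ℕ)).splitBy (fun _ y => !d y.2) = [[(x, k)]] := by
        rw [List.splitBy_eq_iff]; simp
      simp [cutFrom, this]
    | cons y l =>
      have h := ih (k + 1)
      simp only [List.zipIdx_cons] at h ⊢
      obtain ⟨q, qs, h1, h2⟩ := splitBy_cons_cons
        (fun (_ : ℕ × ℕ) (y : ℕ × ℕ) => !d y.2) (x, k) (y, k + 1) (l.zipIdx (k + 1 + 1))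
      rw [h1] at h
      rw [h2, cutFrom, ← h]
      by_cases hd : d (k + 1) <;> simp [hd]

theorem eblock_eq_cutFrom (d : ℕ → Bool) (p : List ℕ) : eblock d p = cutFrom d 0 p :=
  splitBy_zipIdx d p 0

theorem cutFrom_flatten (d : ℕ → Bool) (k : ℕ) (p : List ℕ) : (cutFrom d k p).flatten = p := by
  induction p generalizing k with
  | nil => simp [cutFrom]
  | cons x l ih =>
    cases l with
    | nil => simp [cutFrom]
    | cons y l =>
      have h := ih (k + 1)
      rw [cutFrom]
      split_ifs
      · simp [h]
      · cases hq : cutFrom d (k + 1) (y :: l) with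
        | nil => simp [hq] at h
        | cons q qs => rw [hq] at h; simpa using h

/-- Only bits relative to the start matter; a common suffix therefore keeps its blocks although an
edit moves its absolute position. -/
theorem cutFrom_congr {d d' : ℕ → Bool} {k k' : ℕ} {p : List ℕ}
    (h : ∀ i, i < p.length → d (k + i) = d' (k' + i)) : cutFrom d k p = cutFrom d' k' p := by
  induction p generalizing k k' with
  | nil => simp [cutFrom]
  | cons x l ih =>
    cases l with
    | nil => simp [cutFrom]
    | cons y l =>
      have h1 := @ih (k + 1) (k' + 1) (fun i hi => by
        have := h (i + 1) (by simpa using hi)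
        rwa [← add_assoc, ← add_assoc, add_right_comm, add_right_comm k'] at this)
      have h2 := h 1 (by simp)
      rw [cutFrom, cutFrom, h1, h2]

/-- A true bit at the joint forces a cut, so the two sides are parsed independently. This isolates
the edited zone from the rest. -/
theorem cutFrom_append {d : ℕ → Bool} {k : ℕ} {a b : List ℕ}
    (h : a = [] ∨ b = [] ∨ d (k + a.length) = true) :
    cutFrom d k (a ++ b) = cutFrom d k a ++ cutFrom d (k + a.length) b := by
  rw [← splitBy_zipIdx, ← splitBy_zipIdx, ← splitBy_zipIdx, List.zipIdx_append,
    List.splitBy_append, List.map_append]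
  intro x hx y hy
  rcases h with rfl | rfl | h
  · simp at hx
  · simp at hy
  · cases b with
    | nil => simp at hy
    | cons c b => simp at hy; subst hy; simpa using h

theorem two_le_length_of_mem_cutFrom {d : ℕ → Bool} {k : ℕ} {p : List ℕ}
    (h1 : d k = true) (h2 : d (k + (p.length - 1)) = false)
    (h3 : ∀ i, i + 1 < p.length → ¬ (d (k + i) = true ∧ d (k + (i + 1)) = true)) :
    ∀ q ∈ cutFrom d k p, 2 ≤ q.length := by
  -- The induction peels off leading entries, so the head block may be a mere tail of a block;
  -- length two is required of it only when there is a cut in front of it.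
  have main : ∀ (p : List ℕ) (k : ℕ), p ≠ [] → d (k + (p.length - 1)) = false →
      (∀ i, i + 1 < p.length → ¬ (d (k + i) = true ∧ d (k + (i + 1)) = true)) →
      ∃ q qs, cutFrom d k p = q :: qs ∧ 1 ≤ q.length ∧ (d k = true → 2 ≤ q.length) ∧
        ∀ q ∈ qs, 2 ≤ q.length := by
    intro p
    induction p with
    | nil => simp
    | cons x l ih =>
      intro k _ h2 h3
      cases l with
      | nil => exact ⟨[x], [], by simp [cutFrom], by simp, by simp_all, by simp⟩
      | cons y l =>
        obtain ⟨q, qs, e, e1, e2, e3⟩ := ih (k + 1) (by simp)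
          (by rw [← h2]; congr 1; simp; omega)
          (fun i hi => by
            have := h3 (i + 1) (by simpa using hi)
            rwa [show k + (i + 1) = k + 1 + i by ring,
              show k + (i + 1 + 1) = k + 1 + (i + 1) by ring] at this)
        rw [cutFrom, e]
        split_ifs with hd
        · refine ⟨[x], q :: qs, rfl, by simp, fun hk => ?_, ?_⟩
          · exact absurd ⟨hk, hd⟩ (h3 0 (by simp))
          · intro r hr
            rcases List.mem_cons.1 hr with rfl | hr
            · exact e2 hd
            · exact e3 r hr
        · exact ⟨x :: q, qs, rfl, by simp, by simp; omega, e3⟩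
  rcases eq_or_ne p [] with rfl | hp
  · simp [cutFrom]
  obtain ⟨q, qs, e, -, e2, e3⟩ := main p k hp h2 h3
  rw [e]
  intro r hr
  rcases List.mem_cons.1 hr with rfl | hr
  · exact e2 h1
  · exact e3 r hr

/-- The sequences to which the hypothesis of local consistency applies. -/
structure IsParsable (M : ℕ) (p : List ℕ) : Prop where
  two_le : 2 ≤ p.length
  mem : ∀ x ∈ p, 1 ≤ x ∧ x ≤ M
  chain : p.IsChain (· ≠ ·)

theorem two_le_length_of_mem_eblock {M : ℕ} {f : List ℕ → Bool} (hf : IsLocallyConsistent M f)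
    {p : List ℕ} (hp : IsParsable M p) : ∀ q ∈ eblock (bits M f p) p, 2 ≤ q.length := by
  obtain ⟨h1, h2, h3, -⟩ := hf p hp.two_le hp.mem hp.chain
  rw [eblock_eq_cutFrom]
  exact two_le_length_of_mem_cutFrom h1 (by simpa using h2) (by simpa using h3)

theorem two_mul_length_le_flatten {B : List (List ℕ)} (h : ∀ q ∈ B, 2 ≤ q.length) :
    2 * B.length ≤ B.flatten.length := by
  induction B with
  | nil => simp
  | cons q B ih =>
    have := h q (by simp)
    have := ih fun r hr => h r (by simp [hr])
    rw [List.flatten_cons, List.length_append, List.length_cons]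
    omega

/-- The `4` is `deltaR`: the window of a position that far from the end of `a` does not reach beyond
the common prefix. -/
theorem window_append_left (W : ℕ) {a x y : List ℕ} {i : ℕ} (h : i + 4 < a.length) :
    window W (a ++ x) i = window W (a ++ y) i := by
  unfold window
  refine List.map_congr_left fun j hj => ?_
  rw [List.mem_range, deltaR] at hj
  split_ifs
  · rw [List.getD_append _ _ _ _ (by omega), List.getD_append _ _ _ _ (by omega)]
  · rfl

theorem window_append_right (W : ℕ) {x y b : List ℕ} {i : ℕ} (h : deltaL W ≤ i) :
    window W (x ++ b) (x.length + i) = window W (y ++ b) (y.length + i) := by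
  unfold window
  refine List.map_congr_left fun j _ => ?_
  rw [if_pos (by omega), if_pos (by omega), List.getD_append_right _ _ _ _ (by omega),
    List.getD_append_right _ _ _ _ (by omega)]
  congr 1
  omega

/-- Local consistency: outside a neighbourhood of the changed part, the blocks stay the same. -/
theorem exists_common_blocks {M : ℕ} {f : List ℕ → Bool} (hf : IsLocallyConsistent M f)
    {a o b : List ℕ} (ho : o ≠ []) (hp : IsParsable M (a ++ o ++ b)) :
    ∃ (BL BR : List (List ℕ)) (a' b' : List ℕ), a = BL.flatten ++ a' ∧ b = b' ++ BR.flatten ∧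
      a'.length ≤ 8 ∧ b'.length ≤ logStar M + 10 ∧
      ∀ m ≠ [], IsParsable M (a ++ m ++ b) →
        ∃ B, eblock (bits M f (a ++ m ++ b)) (a ++ m ++ b) = BL ++ B ++ BR ∧
          B.flatten = a' ++ m ++ b' := by
  obtain ⟨-, -, -, hd⟩ := hf _ hp.two_le hp.mem hp.chain
  have ho1 : 1 ≤ o.length := List.length_pos_iff.2 ho
  set d := bits M f (a ++ o ++ b) with hdef
  have hl : (a ++ o ++ b).length = a.length + o.length + b.length := by simp; ring
  rw [hl] at hd
  -- A cut at `i` is independent of the middle if `i + 4 < a.length`. The four positions from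
  -- `a.length - 8` to `a.length - 5` satisfy this and contain a cut, which is where `8` comes from.
  have hA : ∃ a₁ a', a = a₁ ++ a' ∧ a'.length ≤ 8 ∧
      (a₁ = [] ∨ (4 < a'.length ∧ d a₁.length = true)) := by
    by_cases h : a.length ≤ 8
    · exact ⟨[], a, rfl, h, Or.inl rfl⟩
    · have : ∃ i, i + 4 < a.length ∧ a.length ≤ i + 8 ∧ d i = true := by
        rcases hd (a.length - 8) (by omega) with h | h | h | h <;>
          exact ⟨_, by omega, by omega, h⟩
      obtain ⟨i, h1, h2, h3⟩ := this
      refine ⟨a.take i, a.drop i, (List.take_append_drop _ _).symm, by simp; omega, Or.inr ?_⟩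
      rw [List.length_take, min_eq_left (by omega)]
      exact ⟨by simp; omega, h3⟩
  -- Here a bit is independent of the middle once its offset in `b` is at least `deltaL M = logStar
  -- M + 6`, and the four offsets from there on contain a cut. Density is only assumed for `i + 4 <
  -- p.length`, hence the threshold `logStar M + 10`.
  have hB : ∃ b' b₁, b = b' ++ b₁ ∧ b'.length ≤ logStar M + 10 ∧
      (b₁ = [] ∨ (deltaL M ≤ b'.length ∧ d ((a ++ o).length + b'.length) = true)) := by
    by_cases h : b.length ≤ logStar M + 10
    · exact ⟨b, [], by simp, h, Or.inl rfl⟩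
    · have : ∃ j, j < b.length ∧ j ≤ logStar M + 10 ∧ deltaL M ≤ j ∧
          d ((a ++ o).length + j) = true := by
        unfold deltaL
        rw [List.length_append]
        rcases hd (a.length + o.length + (logStar M + 6)) (by omega) with h | h | h | h
        · exact ⟨logStar M + 6, by omega, by omega, by omega, h⟩
        · exact ⟨logStar M + 7, by omega, by omega, by omega, h⟩
        · exact ⟨logStar M + 8, by omega, by omega, by omega, h⟩
        · exact ⟨logStar M + 9, by omega, by omega, by omega, h⟩
      obtain ⟨j, h1, h2, h3, h4⟩ := this
      refine ⟨b.take j, b.drop j, (List.take_append_drop _ _).symm, by simp; omega, Or.inr ?_⟩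
      rw [List.length_take, min_eq_left (by omega)]
      exact ⟨h3, h4⟩
  obtain ⟨a₁, a', ha, ha1, ha2⟩ := hA
  obtain ⟨b', b₁, hb, hb1, hb2⟩ := hB
  refine ⟨cutFrom d 0 a₁, cutFrom d ((a ++ o).length + b'.length) b₁, a', b', ?_, ?_, ha1, hb1, ?_⟩
  · rw [cutFrom_flatten, ha]
  · rw [cutFrom_flatten, hb]
  intro m hm _
  set d' := bits M f (a ++ m ++ b) with hd'def
  have left : ∀ i, i + 4 < a.length → d' i = d i := fun i hi => by
    rw [hdef, hd'def]
    unfold bits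
    rw [List.append_assoc, List.append_assoc, window_append_left M hi]
  have right : ∀ i, deltaL M ≤ i → d' ((a ++ m).length + i) = d ((a ++ o).length + i) :=
    fun i hi => by
      rw [hdef, hd'def]
      unfold bits
      rw [window_append_right M hi]
  have hla : a.length = a₁.length + a'.length := by rw [ha]; simp
  refine ⟨cutFrom d' a₁.length (a' ++ m ++ b'), ?_, cutFrom_flatten _ _ _⟩
  have e : a ++ m ++ b = a₁ ++ ((a' ++ m ++ b') ++ b₁) := by rw [ha, hb]; simp
  rw [eblock_eq_cutFrom, e, cutFrom_append, cutFrom_append, ← List.append_assoc]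
  · congr 1
    · congr 1
      · rcases ha2 with rfl | ⟨h1, h2⟩
        · simp [cutFrom]
        · refine cutFrom_congr fun i hi => ?_
          rw [zero_add]
          exact left i (by omega)
      · simp
    · rcases hb2 with rfl | ⟨h1, h2⟩
      · simp [cutFrom]
      · refine cutFrom_congr fun i hi => ?_
        rw [add_assoc ((a ++ o).length), ← right _ (by omega)]
        congr 1
        rw [ha]; simp; ring
  · rcases hb2 with rfl | ⟨h1, h2⟩
    · simp
    · refine Or.inr (Or.inr ?_)
      rw [← h2, ← right _ h1]
      congr 1
      rw [ha]; simp; ring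
  · rcases ha2 with rfl | ⟨h1, h2⟩
    · simp
    · refine Or.inr (Or.inr ?_)
      rw [zero_add, left _ (by omega), h2]

/-! ### Maximal runs and concatenation -/

theorem epow_append {s t : List ℕ} (h : ∀ x ∈ s.getLast?, ∀ y ∈ t.head?, x ≠ y) :
    epow (s ++ t) = epow s ++ epow t := by
  unfold epow
  rw [List.splitBy_append, List.map_append]
  intro x hx y hy
  simpa using h x hx y hy

theorem epow_replicate {x k : ℕ} (hk : 0 < k) : epow (List.replicate k x) = [(x, k)] := by
  unfold epow
  rw [List.splitBy_of_isChain (by simp; omega)]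
  · cases k with
    | zero => omega
    | succ k => simp [List.replicate_succ]
  · exact List.isChain_replicate_of_rel _ (by simp)

/-- Induction on the number of maximal runs. -/
theorem exists_run_append (s : List ℕ) (hs : s ≠ []) :
    ∃ x k t, 0 < k ∧ s = List.replicate k x ++ t ∧ t.head? ≠ some x := by
  induction s with
  | nil => contradiction
  | cons a s ih =>
    rcases eq_or_ne s [] with rfl | h
    · exact ⟨a, 1, [], by simp, by simp, by simp⟩
    obtain ⟨x, k, t, hk, rfl, ht⟩ := ih h
    by_cases hx : a = x
    · subst hx
      exact ⟨a, k + 1, t, by omega, by simp [List.replicate_succ], ht⟩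
    · refine ⟨a, 1, List.replicate k x ++ t, by simp, by simp, ?_⟩
      cases k with
      | zero => omega
      | succ k => simpa [List.replicate_succ] using Ne.symm hx

theorem epow_run_append {x k : ℕ} {t : List ℕ} (hk : 0 < k) (ht : t.head? ≠ some x) :
    epow (List.replicate k x ++ t) = (x, k) :: epow t := by
  rw [epow_append, epow_replicate hk]
  · rfl
  · intro y hy z hz
    have : y = x := List.eq_of_mem_replicate (List.mem_of_getLast? hy)
    rintro rfl
    subst this
    exact ht hz

theorem run_induction {P : List ℕ → Prop} (nil : P [])
    (run : ∀ x k t, 0 < k → t.head? ≠ some x → P t → P (List.replicate k x ++ t)) :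
    ∀ s, P s := by
  intro s
  induction hn : s.length using Nat.strong_induction_on generalizing s with
  | _ n ih =>
    rcases eq_or_ne s [] with rfl | hs
    · exact nil
    obtain ⟨x, k, t, hk, rfl, ht⟩ := exists_run_append s hs
    exact run x k t hk ht (ih t.length (by simp at hn; omega) t rfl)

theorem epow_nil : epow [] = [] := by simp [epow]

theorem epow_eq_nil {s : List ℕ} : epow s = [] ↔ s = [] := by
  simp [epow]

/-- The string that a list of runs stands for. -/
def runsFlatten (qs : List (ℕ × ℕ)) : List ℕ := qs.flatMap fun q => List.replicate q.2 q.1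

theorem runsFlatten_epow (s : List ℕ) : runsFlatten (epow s) = s := by
  induction s using run_induction with
  | nil => simp [runsFlatten, epow_nil]
  | run x k t hk ht ih =>
    rw [epow_run_append hk ht, runsFlatten, List.flatMap_cons]
    change _ ++ runsFlatten (epow t) = _
    rw [ih]

theorem pos_of_mem_epow {s : List ℕ} {q : ℕ × ℕ} (h : q ∈ epow s) : 0 < q.2 := by
  induction s using run_induction with
  | nil => simp [epow_nil] at h
  | run x k t hk ht ih =>
    rw [epow_run_append hk ht, List.mem_cons] at h
    rcases h with rfl | h
    · exact hk
    · exact ih h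

theorem fst_mem_of_mem_epow {s : List ℕ} {q : ℕ × ℕ} (h : q ∈ epow s) : q.1 ∈ s := by
  rw [← runsFlatten_epow s]
  exact List.mem_flatMap.2 ⟨q, h, by simp [(pos_of_mem_epow h).ne']⟩

theorem exists_mem_epow {s : List ℕ} {x : ℕ} (h : x ∈ s) : ∃ q ∈ epow s, q.1 = x := by
  rw [← runsFlatten_epow s] at h
  obtain ⟨q, hq, hx⟩ := List.mem_flatMap.1 h
  exact ⟨q, hq, (List.eq_of_mem_replicate hx).symm⟩

theorem epow_length_le (s : List ℕ) : (epow s).length ≤ s.length := by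
  induction s using run_induction with
  | nil => simp [epow_nil]
  | run x k t hk ht ih => rw [epow_run_append hk ht]; simp; omega

theorem epow_isChain (s : List ℕ) : (epow s).IsChain fun p q => p.1 ≠ q.1 := by
  induction s using run_induction with
  | nil => simp [epow_nil]
  | run x k t hk ht ih =>
    rw [epow_run_append hk ht, List.isChain_cons]
    refine ⟨fun q hq => ?_, ih⟩
    rcases eq_or_ne t [] with rfl | hne
    · simp [epow_nil] at hq
    obtain ⟨y, l, u, hl, rfl, hu⟩ := exists_run_append t hne
    rw [epow_run_append hl hu] at hq
    simp at hq
    subst hq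
    rintro rfl
    apply ht
    cases l with
    | zero => omega
    | succ l => simp [List.replicate_succ]

/-- Separate the first run. -/
theorem exists_first_run (b : List ℕ) : ∃ k x b', b = List.replicate k x ++ b' ∧
    ∀ t, epow (t ++ b) = epow (t ++ List.replicate k x) ++ epow b' := by
  rcases eq_or_ne b [] with rfl | hb
  · exact ⟨0, 0, [], by simp, fun t => by simp [epow_nil]⟩
  obtain ⟨x, k, t, hk, rfl, ht⟩ := exists_run_append b hb
  refine ⟨k, x, t, rfl, fun u => ?_⟩
  rw [← List.append_assoc, epow_append]
  rintro y hy z hz rfl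
  rw [List.getLast?_append_of_ne_nil _ (by simp; omega)] at hy
  have : y = x := List.eq_of_mem_replicate (List.mem_of_getLast? hy)
  subst this
  exact ht hz

/-- Separate the last run. -/
theorem exists_last_run (a : List ℕ) : ∃ a' k x, a = a' ++ List.replicate k x ∧
    ∀ t, epow (a ++ t) = epow a' ++ epow (List.replicate k x ++ t) := by
  induction a using run_induction with
  | nil => exact ⟨[], 0, 0, by simp, fun t => by simp [epow_nil]⟩
  | run x k t hk ht ih =>
    rcases eq_or_ne t [] with rfl | hne
    · exact ⟨[], k, x, by simp, fun t => by simp [epow_nil]⟩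
    obtain ⟨a', l, y, rfl, h⟩ := ih
    refine ⟨List.replicate k x ++ a', l, y, by simp, fun u => ?_⟩
    rw [List.append_assoc, epow_run_append hk, h, epow_run_append hk]
    · rfl
    · cases a' with
      | nil => simp
      | cons c a' => simpa using ht
    · rwa [List.head?_append_of_ne_nil _ hne]

/-- Only the last run of `s` and the first run of `t` can interact at the joint, where they stay
separate or merge. -/
theorem epow_length_append_le (s t : List ℕ) :
    (epow (s ++ t)).length ≤ (epow s).length + (epow t).length := by
  obtain ⟨a, k, x, rfl, h1⟩ := exists_last_run s
  obtain ⟨l, y, b, rfl, h2⟩ := exists_first_run t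
  have h3 := h1 []
  have h4 := h2 []
  rw [List.append_nil, List.append_nil] at h3
  rw [List.nil_append, List.nil_append] at h4
  rw [h1, h2, h3, h4]
  have : (epow (List.replicate k x ++ List.replicate l y)).length ≤
      (epow (List.replicate k x)).length + (epow (List.replicate l y)).length := by
    rcases Nat.eq_zero_or_pos k with rfl | hk
    · simp
    rcases Nat.eq_zero_or_pos l with rfl | hl
    · simp
    by_cases hxy : x = y
    · subst hxy
      rw [List.replicate_append_replicate, epow_replicate (by omega), epow_replicate hk]
      simp
    · rw [epow_run_append hk (by simpa [List.head?_replicate, hl.ne'] using Ne.symm hxy),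
        epow_replicate hk]
      simp
  simp only [List.length_append]
  omega

/-- Outside the changed part, all runs but the two adjacent ones stay the same. -/
theorem exists_common_runs (L R : List ℕ) : ∃ a z z' b, L = a ++ z ∧ R = z' ++ b ∧
    ∀ m ≠ [], epow (L ++ m ++ R) = epow a ++ epow (z ++ m ++ z') ++ epow b ∧
      1 ≤ (epow (z ++ m ++ z')).length ∧ (epow (z ++ m ++ z')).length ≤ m.length + 2 := by
  obtain ⟨a, k, x, hL, h1⟩ := exists_last_run L
  obtain ⟨l, y, b, hR, h2⟩ := exists_first_run R
  refine ⟨a, _, _, b, hL, hR, fun m hm => ⟨?_, ?_, ?_⟩⟩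
  · rw [h2, List.append_assoc, h1, List.append_assoc (List.replicate k x)]
  · rw [Nat.one_le_iff_ne_zero]
    intro h
    rw [List.length_eq_zero_iff, epow_eq_nil] at h
    simp_all
  · have h3 : ∀ k x, (epow (List.replicate k x)).length ≤ 1 := by
      intro k x
      rcases Nat.eq_zero_or_pos k with rfl | hk
      · simp [epow_nil]
      · simp [epow_replicate hk]
    have := epow_length_append_le (List.replicate k x ++ m) (List.replicate l y)
    have := epow_length_append_le (List.replicate k x) m
    have := epow_length_le m
    have := h3 k x
    have := h3 l y
    omega

/-! ## Parses together with the productions that they use -/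

/-- `Collect R qs es U`: the entries of `qs` are named by the entries of `es`, and `U` is the list
of all productions used for that; `R` tells which productions are used for a single entry. -/
inductive Collect {α : Type*} (R : α → ℕ → List Production → Prop) :
    List α → List ℕ → List Production → Prop where
  | nil : Collect R [] [] []
  | cons {q : α} {e : ℕ} {U : List Production} {qs : List α} {es : List ℕ} {V : List Production} :
      R q e U → Collect R qs es V → Collect R (q :: qs) (e :: es) (U ++ V)

/-- The production of a character. -/
def CharRule (a e : ℕ) (U : List Production) : Prop := U = [(e, .char a)]

/-- The production of a run. -/
def RunRule (q : ℕ × ℕ) (e : ℕ) (U : List Production) : Prop := U = [(e, .run q.1 q.2)]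

/-- `SigFold` with the list of productions that it uses. -/
inductive Fold : ℕ → List ℕ → ℕ → List Production → Prop where
  | nil (c : ℕ) : Fold c [] c []
  | cons {c x c' e : ℕ} {xs : List ℕ} {U : List Production} :
      Fold c' xs e U → Fold c (x :: xs) e ((c', .pair c x) :: U)

/-- The productions of a block. -/
def BlockRule (q : List ℕ) (e : ℕ) (U : List Production) : Prop :=
  ∃ x₁ x₂ xs, q = x₁ :: x₂ :: xs ∧ Fold x₁ (x₂ :: xs) e U

/-- The left-hand sides of productions. -/
def lhs (D : Finset Production) : Finset ℕ := D.image Prod.fst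

theorem mem_lhs {D : Finset Production} {X : ℕ} : X ∈ lhs D ↔ ∃ e, (X, e) ∈ D := by
  simp [lhs]

theorem lhs_mono {D D' : Finset Production} (h : D ⊆ D') : lhs D ⊆ lhs D' :=
  Finset.image_subset_image h

section Collect

variable {α : Type*} {R : α → ℕ → List Production → Prop} {qs qs' : List α} {es es' : List ℕ}
  {U V : List Production}

theorem Collect.append (h : Collect R qs es U) (h' : Collect R qs' es' V) :
    Collect R (qs ++ qs') (es ++ es') (U ++ V) := by
  induction h with
  | nil => exact h'
  | cons h1 _ ih =>
    rw [List.append_assoc]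
    exact Collect.cons h1 ih

theorem Collect.split (h : Collect R (qs ++ qs') es U) : ∃ es₁ es₂ U₁ U₂,
    es = es₁ ++ es₂ ∧ U = U₁ ++ U₂ ∧ Collect R qs es₁ U₁ ∧ Collect R qs' es₂ U₂ := by
  induction qs generalizing es U with
  | nil => exact ⟨[], es, [], U, rfl, rfl, .nil, h⟩
  | cons q qs ih =>
    cases h with
    | cons h1 h2 =>
      obtain ⟨es₁, es₂, U₁, U₂, rfl, rfl, h3, h4⟩ := ih h2
      exact ⟨_ :: es₁, es₂, _ ++ U₁, U₂, rfl, by simp, .cons h1 h3, h4⟩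

theorem Collect.length_eq (h : Collect R qs es U) : es.length = qs.length := by
  induction h with
  | nil => rfl
  | cons _ _ ih => simp [ih]

theorem Collect.length_prods {w : α → ℕ} (hw : ∀ q e U, R q e U → U.length = w q)
    (h : Collect R qs es U) : U.length = (qs.map w).sum := by
  induction h with
  | nil => rfl
  | cons h1 _ ih => simp [ih, hw _ _ _ h1]

theorem Collect.forall₂ {S : α → ℕ → Prop} (h : Collect R qs es U)
    (hS : ∀ q ∈ qs, ∀ e V, R q e V → V ⊆ U → S q e) : List.Forall₂ S qs es := by
  -- The induction shrinks `U` while `hS` speaks of the whole list; a fixed superset `W` decouples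
  -- the two.
  have : ∀ W, U ⊆ W → (∀ q ∈ qs, ∀ e V, R q e V → V ⊆ W → S q e) → List.Forall₂ S qs es := by
    clear hS
    intro W
    induction h with
    | nil => exact fun _ _ => .nil
    | cons h1 _ ih =>
      intro hW hS
      rw [List.append_subset] at hW
      exact .cons (hS _ (by simp) _ _ h1 hW.1) (ih hW.2 fun q hq => hS q (by simp [hq]))
  exact this U (List.Subset.refl _) hS

theorem Collect.of_forall₂ {S : α → ℕ → Prop} {D : Finset Production} (h : List.Forall₂ S qs es)
    (hS : ∀ q e, S q e → ∃ U, R q e U ∧ ∀ p ∈ U, p ∈ D) :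
    ∃ U, Collect R qs es U ∧ ∀ p ∈ U, p ∈ D := by
  induction h with
  | nil => exact ⟨[], .nil, by simp⟩
  | cons h1 _ ih =>
    obtain ⟨U, h2, h3⟩ := hS _ _ h1
    obtain ⟨V, h4, h5⟩ := ih
    refine ⟨U ++ V, .cons h2 h4, fun p hp => ?_⟩
    rcases List.mem_append.1 hp with hp | hp
    · exact h3 p hp
    · exact h5 p hp

theorem Collect.exists_of_mem_prods (h : Collect R qs es U) {p : Production} (hp : p ∈ U) :
    ∃ q e V, q ∈ qs ∧ e ∈ es ∧ R q e V ∧ p ∈ V ∧ V ⊆ U := by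
  induction h with
  | nil => simp at hp
  | @cons q e V _ _ _ h1 _ ih =>
    rcases List.mem_append.1 hp with hp | hp
    · exact ⟨q, e, V, by simp, by simp, h1, hp, by simp⟩
    · obtain ⟨q', e', V', h2, h3, h4, h5, h6⟩ := ih hp
      exact ⟨q', e', V', by simp [h2], by simp [h3], h4, h5,
        List.subset_append_of_subset_right _ h6⟩

theorem Collect.exists_of_mem_right (h : Collect R qs es U) {e : ℕ} (he : e ∈ es) :
    ∃ q V, q ∈ qs ∧ R q e V ∧ V ⊆ U := by
  induction h with
  | nil => simp at he
  | @cons q e' V _ _ _ h1 _ ih =>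
    rcases List.mem_cons.1 he with rfl | he
    · exact ⟨q, V, by simp, h1, by simp⟩
    · obtain ⟨q', V', h2, h4, h6⟩ := ih he
      exact ⟨q', V', by simp [h2], h4, List.subset_append_of_subset_right _ h6⟩

theorem Collect.exists_of_mem_left (h : Collect R qs es U) {q : α} (hq : q ∈ qs) :
    ∃ e V, e ∈ es ∧ R q e V ∧ V ⊆ U := by
  induction h with
  | nil => simp at hq
  | @cons q' e' V _ _ _ h1 _ ih =>
    rcases List.mem_cons.1 hq with rfl | hq
    · exact ⟨e', V, by simp, h1, by simp⟩
    · obtain ⟨e, V', h2, h4, h6⟩ := ih hq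
      exact ⟨e, V', by simp [h2], h4, List.subset_append_of_subset_right _ h6⟩

end Collect

theorem Fold.length_prods {c e : ℕ} {xs : List ℕ} {U : List Production} (h : Fold c xs e U) :
    U.length = xs.length := by
  induction h with
  | nil => rfl
  | cons _ ih => simp [ih]

theorem Fold.mem_of_ne_nil {c e : ℕ} {xs : List ℕ} {U : List Production} (h : Fold c xs e U)
    (hxs : xs ≠ []) : ∃ ρ, (e, ρ) ∈ U := by
  induction h with
  | nil => contradiction
  | @cons c x c' e xs U h ih =>
    rcases eq_or_ne xs [] with rfl | hne
    · cases h
      exact ⟨_, List.mem_cons_self⟩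
    · obtain ⟨ρ, hρ⟩ := ih hne
      exact ⟨ρ, List.mem_cons_of_mem _ hρ⟩

theorem Fold.vars_of_mem {c e : ℕ} {xs : List ℕ} {U : List Production} (h : Fold c xs e U)
    {p : Production} (hp : p ∈ U) :
    ∀ y ∈ p.2.vars, y = c ∨ y ∈ xs ∨ ∃ ρ, (y, ρ) ∈ U := by
  induction h with
  | nil => simp at hp
  | @cons c x c' e xs U h ih =>
    intro y hy
    rcases List.mem_cons.1 hp with rfl | hp
    · simp [Rhs.vars] at hy
      rcases hy with rfl | rfl <;> simp
    · rcases ih hp y hy with rfl | h1 | ⟨ρ, h1⟩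
      · exact Or.inr (Or.inr ⟨_, List.mem_cons_self⟩)
      · exact Or.inr (Or.inl (List.mem_cons_of_mem _ h1))
      · exact Or.inr (Or.inr ⟨ρ, List.mem_cons_of_mem _ h1⟩)

theorem Fold.sigFold {c e : ℕ} {xs : List ℕ} {U : List Production} {D : Finset Production}
    (h : Fold c xs e U) (hU : ∀ p ∈ U, p ∈ D) : SigFold D c xs e := by
  induction h with
  | nil c => exact .nil c
  | cons h ih =>
    exact .cons (hU _ List.mem_cons_self) (ih fun p hp => hU p (List.mem_cons_of_mem _ hp))

theorem SigFold.fold {c e : ℕ} {xs : List ℕ} {D : Finset Production} (h : SigFold D c xs e) :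
    ∃ U, Fold c xs e U ∧ ∀ p ∈ U, p ∈ D := by
  induction h with
  | nil c => exact ⟨[], .nil c, by simp⟩
  | cons h1 _ ih =>
    obtain ⟨U, h2, h3⟩ := ih
    refine ⟨_ :: U, .cons h2, fun p hp => ?_⟩
    rcases List.mem_cons.1 hp with rfl | hp
    · exact h1
    · exact h3 p hp

theorem BlockRule.sigBlock {q : List ℕ} {e : ℕ} {U : List Production} {D : Finset Production}
    (h : BlockRule q e U) (hU : ∀ p ∈ U, p ∈ D) : SigBlock D q e := by
  obtain ⟨x₁, x₂, xs, rfl, h⟩ := h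
  exact ⟨x₁, x₂, xs, rfl, h.sigFold hU⟩

theorem SigBlock.blockRule {q : List ℕ} {e : ℕ} {D : Finset Production} (h : SigBlock D q e) :
    ∃ U, BlockRule q e U ∧ ∀ p ∈ U, p ∈ D := by
  obtain ⟨x₁, x₂, xs, rfl, h⟩ := h
  obtain ⟨U, h1, h2⟩ := h.fold
  exact ⟨U, ⟨x₁, x₂, xs, rfl, h1⟩, h2⟩

theorem BlockRule.length_prods {q : List ℕ} {e : ℕ} {U : List Production} (h : BlockRule q e U) :
    U.length = q.length - 1 := by
  obtain ⟨x₁, x₂, xs, rfl, h⟩ := h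
  simpa using h.length_prods

theorem BlockRule.mem {q : List ℕ} {e : ℕ} {U : List Production} (h : BlockRule q e U) :
    ∃ ρ, (e, ρ) ∈ U := by
  obtain ⟨x₁, x₂, xs, rfl, h⟩ := h
  exact h.mem_of_ne_nil (by simp)

theorem BlockRule.vars_of_mem {q : List ℕ} {e : ℕ} {U : List Production} (h : BlockRule q e U)
    {p : Production} (hp : p ∈ U) : ∀ y ∈ p.2.vars, y ∈ q ∨ ∃ ρ, (y, ρ) ∈ U := by
  obtain ⟨x₁, x₂, xs, rfl, h⟩ := h
  intro y hy
  rcases h.vars_of_mem hp y hy with rfl | h | h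
  · simp
  · exact Or.inl (List.mem_cons_of_mem _ h)
  · exact Or.inr h

/-- Decomposition of the sequence `s` by `Epow` and `Eblock` into the single signature `e`; `U`
lists the productions used for that. -/
inductive Parse (M : ℕ) (f : List ℕ → Bool) : List ℕ → ℕ → List Production → Prop where
  | done {s : List ℕ} {e : ℕ} {U : List Production} :
      Collect RunRule (epow s) [e] U → Parse M f s e U
  | step {s p s' : List ℕ} {e : ℕ} {U V W : List Production} :
      Collect RunRule (epow s) p U → p.length ≠ 1 →
      Collect BlockRule (eblock (bits M f p) p) s' V → Parse M f s' e W →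
      Parse M f s e (U ++ V ++ W)

theorem collect_run_length {qs : List (ℕ × ℕ)} {es : List ℕ} {U : List Production}
    (h : Collect RunRule qs es U) : U.length = qs.length := by
  rw [h.length_prods (w := fun _ => 1) (by rintro q e U rfl; rfl)]
  simp

theorem collect_char_length {qs : List ℕ} {es : List ℕ} {U : List Production}
    (h : Collect CharRule qs es U) : U.length = qs.length := by
  rw [h.length_prods (w := fun _ => 1) (by rintro q e U rfl; rfl)]
  simp

/-- A block of length `m` takes `m - 1` pairs; the additive form avoids truncated subtraction. -/
theorem collect_block_length {qs : List (List ℕ)} {es : List ℕ} {U : List Production}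
    (h : Collect BlockRule qs es U) : U.length + qs.length = qs.flatten.length := by
  induction h with
  | nil => rfl
  | cons h1 _ ih =>
    have h2 := h1.length_prods
    obtain ⟨x₁, x₂, xs, rfl, -⟩ := h1
    simp only [List.length_append, List.length_cons, List.flatten_cons] at *
    omega

theorem collect_run_mem {qs : List (ℕ × ℕ)} {es : List ℕ} {U : List Production}
    (h : Collect RunRule qs es U) {e : ℕ} (he : e ∈ es) : ∃ ρ, (e, ρ) ∈ U := by
  obtain ⟨q, V, -, rfl, h⟩ := h.exists_of_mem_right he
  exact ⟨_, h (List.mem_singleton_self _)⟩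

theorem collect_char_mem {qs : List ℕ} {es : List ℕ} {U : List Production}
    (h : Collect CharRule qs es U) {e : ℕ} (he : e ∈ es) : ∃ ρ, (e, ρ) ∈ U := by
  obtain ⟨q, V, -, rfl, h⟩ := h.exists_of_mem_right he
  exact ⟨_, h (List.mem_singleton_self _)⟩

theorem collect_block_mem {qs : List (List ℕ)} {es : List ℕ} {U : List Production}
    (h : Collect BlockRule qs es U) {e : ℕ} (he : e ∈ es) : ∃ ρ, (e, ρ) ∈ U := by
  obtain ⟨q, V, -, h1, h⟩ := h.exists_of_mem_right he
  obtain ⟨ρ, hρ⟩ := h1.mem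
  exact ⟨ρ, h hρ⟩

theorem collect_run_vars {s : List ℕ} {es : List ℕ} {U : List Production}
    (h : Collect RunRule (epow s) es U) {p : Production} (hp : p ∈ U) :
    ∀ y ∈ p.2.vars, y ∈ s := by
  obtain ⟨q, e, V, hq, -, rfl, hp, -⟩ := h.exists_of_mem_prods hp
  rw [List.mem_singleton.1 hp]
  intro y hy
  simp only [Rhs.vars, Finset.mem_singleton] at hy
  exact hy ▸ fst_mem_of_mem_epow hq

theorem collect_block_vars {qs : List (List ℕ)} {es : List ℕ} {U : List Production}
    (h : Collect BlockRule qs es U) {p : Production} (hp : p ∈ U) :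
    ∀ y ∈ p.2.vars, y ∈ qs.flatten ∨ ∃ ρ, (y, ρ) ∈ U := by
  obtain ⟨q, e, V, hq, -, h1, hp, h2⟩ := h.exists_of_mem_prods hp
  intro y hy
  rcases h1.vars_of_mem hp y hy with h | ⟨ρ, h⟩
  · exact Or.inl (List.mem_flatten.2 ⟨q, hq, h⟩)
  · exact Or.inr ⟨ρ, h2 h⟩

theorem Parse.mem {M : ℕ} {f : List ℕ → Bool} {s : List ℕ} {e : ℕ} {U : List Production}
    (h : Parse M f s e U) : ∃ ρ, (e, ρ) ∈ U := by
  induction h with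
  | done h => exact collect_run_mem h (by simp)
  | step _ _ _ _ ih =>
    obtain ⟨ρ, h⟩ := ih
    exact ⟨ρ, by simp [h]⟩

theorem eblock_flatten (d : ℕ → Bool) (p : List ℕ) : (eblock d p).flatten = p := by
  rw [eblock_eq_cutFrom, cutFrom_flatten]

/-- Every level names its own entries, so only the entries of the initial sequence are borrowed.
Together with the character productions this closes the set of productions. -/
theorem Parse.vars {M : ℕ} {f : List ℕ → Bool} {s : List ℕ} {e : ℕ} {U : List Production}
    (h : Parse M f s e U) {p : Production} (hp : p ∈ U) :
    ∀ y ∈ p.2.vars, y ∈ s ∨ ∃ ρ, (y, ρ) ∈ U := by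
  induction h with
  | done h => exact fun y hy => Or.inl (collect_run_vars h hp y hy)
  | @step s p' s' e U V W h1 _ h3 h4 ih =>
    intro y hy
    simp only [List.mem_append] at hp ⊢
    rcases hp with (hp | hp) | hp
    · exact Or.inl (collect_run_vars h1 hp y hy)
    · rcases collect_block_vars h3 hp y hy with h | ⟨ρ, h⟩
      · rw [eblock_flatten] at h
        obtain ⟨ρ, h⟩ := collect_run_mem h1 h
        exact Or.inr ⟨ρ, Or.inl (Or.inl h)⟩
      · exact Or.inr ⟨ρ, Or.inl (Or.inr h)⟩
    · rcases ih hp y hy with h | ⟨ρ, h⟩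
      · obtain ⟨ρ, h⟩ := collect_block_mem h3 h
        exact Or.inr ⟨ρ, Or.inl (Or.inr h)⟩
      · exact Or.inr ⟨ρ, Or.inr h⟩

theorem Fold.reach {D : Finset Production} {c e : ℕ} {xs : List ℕ} {U : List Production}
    (h : Fold c xs e U) (hU : ∀ p ∈ U, p ∈ D) :
    Relation.ReflTransGen (Child D) e c ∧ (∀ x ∈ xs, Relation.ReflTransGen (Child D) e x) ∧
      ∀ p ∈ U, Relation.ReflTransGen (Child D) e p.1 := by
  induction h with
  | nil c => exact ⟨.refl, by simp, by simp⟩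
  | @cons c x c' e xs U h ih =>
    obtain ⟨h1, h2, h3⟩ := ih fun p hp => hU p (List.mem_cons_of_mem _ hp)
    have h4 := hU _ List.mem_cons_self
    refine ⟨h1.tail ⟨_, h4, by simp [Rhs.vars]⟩, fun y hy => ?_, fun p hp => ?_⟩
    · rcases List.mem_cons.1 hy with rfl | hy
      · exact h1.tail ⟨_, h4, by simp [Rhs.vars]⟩
      · exact h2 y hy
    · rcases List.mem_cons.1 hp with rfl | hp
      · exact h1
      · exact h3 p hp

/-- Each entry of a level is a descendant of an entry of the next level, and the last level is `e`
alone; so descending from `e` meets everything. This supplies the clause `useful`. -/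
theorem Parse.reach {M : ℕ} {f : List ℕ → Bool} {D : Finset Production} {s : List ℕ} {e : ℕ}
    {U : List Production} (h : Parse M f s e U) (hU : ∀ p ∈ U, p ∈ D) :
    (∀ x ∈ s, Relation.ReflTransGen (Child D) e x) ∧
      ∀ p ∈ U, Relation.ReflTransGen (Child D) e p.1 := by
  have run : ∀ {s p : List ℕ} {U : List Production} {e : ℕ}, Collect RunRule (epow s) p U →
      (∀ q ∈ U, q ∈ D) → (∀ x ∈ p, Relation.ReflTransGen (Child D) e x) →
      (∀ x ∈ s, Relation.ReflTransGen (Child D) e x) ∧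
      ∀ q ∈ U, Relation.ReflTransGen (Child D) e q.1 := by
    intro s p U e h hU hp
    refine ⟨fun x hx => ?_, fun q hq => ?_⟩
    · obtain ⟨q, hq, rfl⟩ := exists_mem_epow hx
      obtain ⟨y, V, hy, rfl, hV⟩ := h.exists_of_mem_left hq
      exact (hp y hy).tail ⟨_, hU _ (hV (List.mem_singleton_self _)), by simp [Rhs.vars]⟩
    · obtain ⟨q', y, V, -, hy, rfl, hq, -⟩ := h.exists_of_mem_prods hq
      rw [List.mem_singleton.1 hq]
      exact hp y hy
  induction h with
  | done h => exact run h hU (by simpa using Relation.ReflTransGen.refl)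
  | @step s p s' e U V W h1 _ h3 h4 ih =>
    simp only [List.mem_append] at hU
    obtain ⟨h5, h6⟩ := ih fun p hp => hU p (Or.inr hp)
    have h7 : ∀ x ∈ p, Relation.ReflTransGen (Child D) e x := fun x hx => by
      rw [← eblock_flatten (bits M f p) p] at hx
      obtain ⟨q, hq, hx⟩ := List.mem_flatten.1 hx
      obtain ⟨y, V', hy, ⟨x₁, x₂, xs, rfl, h8⟩, hV⟩ := h3.exists_of_mem_left hq
      obtain ⟨h9, h10, -⟩ := h8.reach fun r hr => hU r (Or.inl (Or.inr (hV hr)))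
      refine (h5 y hy).trans ?_
      rcases List.mem_cons.1 hx with rfl | hx
      · exact h9
      · exact h10 x hx
    obtain ⟨h8, h9⟩ := run h1 (fun q hq => hU q (Or.inl (Or.inl hq))) h7
    refine ⟨h8, fun r hr => ?_⟩
    simp only [List.mem_append] at hr
    rcases hr with (hr | hr) | hr
    · exact h9 r hr
    · obtain ⟨q, y, V', hq, hy, ⟨x₁, x₂, xs, rfl, h10⟩, hr, hV⟩ := h3.exists_of_mem_prods hr
      exact (h5 y hy).trans
        ((h10.reach fun r hr => hU r (Or.inl (Or.inr (hV hr)))).2.2 r hr)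
    · exact h6 r hr

/-! ## Sets of productions and their extension by new signatures -/

/-- A set of productions with signatures in `[1..M]`, without a start symbol. -/
structure IsValid (M : ℕ) (D : Finset Production) : Prop where
  bounds : ∀ p ∈ D, 1 ≤ p.1 ∧ p.1 ≤ M
  deterministic : ∀ X e e', (X, e) ∈ D → (X, e') ∈ D → e = e'
  nonredundant : ∀ X Y e, (X, e) ∈ D → (Y, e) ∈ D → X = Y
  run_pos : ∀ X x k, (X, Rhs.run x k) ∈ D → 0 < k
  acyclic : ∃ rank : ℕ → ℕ, ∀ X Y, Child D X Y → Y ∈ lhs D ∧ rank Y < rank X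

theorem IsValid.subset {M : ℕ} {D K : Finset Production} (hD : IsValid M D) (hK : K ⊆ D)
    (hc : ∀ p ∈ K, ∀ y ∈ p.2.vars, y ∈ lhs K) : IsValid M K where
  bounds p hp := hD.bounds p (hK hp)
  deterministic X e e' h h' := hD.deterministic X e e' (hK h) (hK h')
  nonredundant X Y e h h' := hD.nonredundant X Y e (hK h) (hK h')
  run_pos X x k h := hD.run_pos X x k (hK h)
  acyclic := by
    obtain ⟨rank, h⟩ := hD.acyclic
    refine ⟨rank, fun X Y ⟨e, he, hY⟩ => ⟨hc _ he Y hY, (h X Y ⟨e, hK he, hY⟩).2⟩⟩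

theorem IsValid.mem_bounds {M : ℕ} {D : Finset Production} (hD : IsValid M D) {X : ℕ}
    (h : X ∈ lhs D) : 1 ≤ X ∧ X ≤ M := by
  obtain ⟨e, h⟩ := mem_lhs.1 h
  exact hD.bounds _ h

theorem IsValid.insert {M : ℕ} {D : Finset Production} (hD : IsValid M D) {e : ℕ} {ρ : Rhs}
    (he : 1 ≤ e ∧ e ≤ M) (he' : e ∉ lhs D) (hρ : ∀ X, (X, ρ) ∉ D) (hv : ∀ y ∈ ρ.vars, y ∈ lhs D)
    (hk : ∀ x k, ρ = .run x k → 0 < k) : IsValid M (insert (e, ρ) D) where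
  bounds p hp := by
    rcases Finset.mem_insert.1 hp with rfl | hp
    · exact he
    · exact hD.bounds p hp
  deterministic X a a' h h' := by
    simp only [Finset.mem_insert, Prod.mk.injEq] at h h'
    rcases h with ⟨rfl, rfl⟩ | h <;> rcases h' with ⟨h1, rfl⟩ | h'
    · rfl
    · exact absurd (mem_lhs.2 ⟨_, h'⟩) he'
    · exact absurd (mem_lhs.2 ⟨_, h1 ▸ h⟩) he'
    · exact hD.deterministic X a a' h h'
  nonredundant X Y a h h' := by
    simp only [Finset.mem_insert, Prod.mk.injEq] at h h'
    rcases h with ⟨rfl, rfl⟩ | h <;> rcases h' with ⟨rfl, h1⟩ | h'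
    · rfl
    · exact absurd h' (hρ _)
    · exact absurd (h1 ▸ h) (hρ _)
    · exact hD.nonredundant X Y a h h'
  run_pos X x k h := by
    simp only [Finset.mem_insert, Prod.mk.injEq] at h
    rcases h with ⟨-, h⟩ | h
    · exact hk x k h.symm
    · exact hD.run_pos X x k h
  acyclic := by
    obtain ⟨rank, h⟩ := hD.acyclic
    -- The new signature is ranked above all its variables. Old ranks survive because `e` occurs in
    -- no old production, on neither side.
    refine ⟨Function.update rank e (1 + ∑ y ∈ ρ.vars, rank y), fun X Y ⟨a, ha, hY⟩ => ?_⟩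
    simp only [Finset.mem_insert, Prod.mk.injEq] at ha
    rcases ha with ⟨rfl, rfl⟩ | ha
    · have h1 := hv Y hY
      refine ⟨lhs_mono (Finset.subset_insert _ _) h1, ?_⟩
      rw [Function.update_self, Function.update_of_ne (by rintro rfl; exact he' h1)]
      have := Finset.single_le_sum (f := rank) (fun _ _ => Nat.zero_le _) hY
      omega
    · obtain ⟨h1, h2⟩ := h X Y ⟨a, ha, hY⟩
      refine ⟨lhs_mono (Finset.subset_insert _ _) h1, ?_⟩
      rw [Function.update_of_ne (by rintro rfl; exact he' h1),
        Function.update_of_ne (by rintro rfl; exact he' (mem_lhs.2 ⟨_, ha⟩))]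
      exact h2

/-- `D'` arises from `D` by adding at most `n` productions, which are entries of `U` and
not in `G`; all entries of `U` are in `D'`. -/
structure Extends (M : ℕ) (G D D' : Finset Production) (U : List Production) (n : ℕ) : Prop where
  subset : D ⊆ D'
  valid : IsValid M D'
  mem : ∀ p ∈ U, p ∈ D'
  new : ∀ p ∈ D', p ∈ D ∨ p ∈ U ∧ p ∉ G
  card : D'.card ≤ D.card + n

section Extends

variable {M : ℕ} {G D D₁ D₂ : Finset Production} {U V : List Production} {n m : ℕ}

theorem Extends.refl (hD : IsValid M D) (hU : ∀ p ∈ U, p ∈ D) : Extends M G D D U 0 :=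
  ⟨Finset.Subset.refl _, hD, hU, fun _ h => Or.inl h, le_rfl⟩

theorem Extends.trans (h₁ : Extends M G D D₁ U n) (h₂ : Extends M G D₁ D₂ V m) :
    Extends M G D D₂ (U ++ V) (n + m) where
  subset := h₁.subset.trans h₂.subset
  valid := h₂.valid
  mem p hp := by
    rcases List.mem_append.1 hp with hp | hp
    · exact h₂.subset (h₁.mem p hp)
    · exact h₂.mem p hp
  new p hp := by
    rcases h₂.new p hp with h | ⟨h, h'⟩
    · rcases h₁.new p h with h | ⟨h, h'⟩
      · exact Or.inl h
      · exact Or.inr ⟨List.mem_append_left _ h, h'⟩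
    · exact Or.inr ⟨List.mem_append_right _ h, h'⟩
  card := by
    have := h₁.card
    have := h₂.card
    omega

theorem Extends.mono (h : Extends M G D D₁ U n) (hnm : n ≤ m) (hUV : ∀ p ∈ U, p ∈ V)
    (hV : ∀ p ∈ V, p ∈ U ∨ p ∈ D) : Extends M G D D₁ V m where
  subset := h.subset
  valid := h.valid
  mem p hp := by
    rcases hV p hp with h1 | h1
    · exact h.mem p h1
    · exact h.subset h1
  new p hp := by
    rcases h.new p hp with h1 | ⟨h1, h2⟩
    · exact Or.inl h1
    · exact Or.inr ⟨hUV p h1, h2⟩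
  card := by
    have := h.card
    omega

/-- Signatures are available as long as `D` has at most `M - 2` productions. -/
theorem exists_extends_rhs (hG : IsValid M G) (hD : IsValid M D) {ρ : Rhs}
    (hv : ∀ y ∈ ρ.vars, y ∈ lhs D) (hk : ∀ x k, ρ = .run x k → 0 < k) (hM : D.card + 2 ≤ M) :
    ∃ e D', Extends M G D D' [(e, ρ)] 1 := by
  by_cases h : ∃ e, (e, ρ) ∈ D
  · obtain ⟨e, h⟩ := h
    refine ⟨e, D, (Extends.refl hD (U := [(e, ρ)]) (by simpa using h)).mono (by simp) ?_ ?_⟩ <;>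
      simp
  push Not at h
  -- Besides the names in use, at most one name is excluded: the one that `G` itself gives to `ρ`.
  -- Avoiding it prevents a discarded production of `G` from being created again.
  have hc : (lhs D).card < ((Finset.Icc 1 M).filter fun e => (e, ρ) ∉ G).card := by
    have h1 : ((Finset.Icc 1 M).filter fun e => (e, ρ) ∈ G).card ≤ 1 := by
      rw [Finset.card_le_one]
      intro a ha b hb
      exact hG.nonredundant _ _ _ (Finset.mem_filter.1 ha).2 (Finset.mem_filter.1 hb).2
    have h2 := Finset.card_filter_add_card_filter_not (s := Finset.Icc 1 M)
      (fun e => (e, ρ) ∈ G)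
    have h3 : (lhs D).card ≤ D.card := Finset.card_image_le
    rw [Nat.card_Icc] at h2
    omega
  obtain ⟨e, he, he'⟩ := Finset.exists_mem_notMem_of_card_lt_card hc
  rw [Finset.mem_filter, Finset.mem_Icc] at he
  refine ⟨e, insert (e, ρ) D, Finset.subset_insert _ _, hD.insert he.1 he' h hv hk, by simp,
    fun p hp => ?_, Finset.card_insert_le _ _⟩
  rcases Finset.mem_insert.1 hp with rfl | hp
  · exact Or.inr ⟨by simp, he.2⟩
  · exact Or.inl hp

/-- `ok q D` says what an entry needs of the available productions. As it survives enlarging `D`,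
entries can be named one after another, and the costs `w` add up. -/
theorem exists_extends_collect {α : Type*} {R : α → ℕ → List Production → Prop} {w : α → ℕ}
    {ok : α → Finset Production → Prop} (hok : ∀ q D D', D ⊆ D' → ok q D → ok q D')
    (hR : ∀ q D, IsValid M D → ok q D → D.card + w q + 1 ≤ M →
      ∃ e U D', R q e U ∧ Extends M G D D' U (w q))
    (qs : List α) (hD : IsValid M D) (hq : ∀ q ∈ qs, ok q D)
    (hM : D.card + (qs.map w).sum + 1 ≤ M) :
    ∃ es U D', Collect R qs es U ∧ Extends M G D D' U (qs.map w).sum := by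
  induction qs generalizing D with
  | nil => exact ⟨[], [], D, .nil, Extends.refl hD (by simp)⟩
  | cons q qs ih =>
    simp only [List.map_cons, List.sum_cons] at hM
    obtain ⟨e, U, D₁, h1, h2⟩ := hR q D hD (hq q (by simp)) (by omega)
    have := h2.card
    obtain ⟨es, V, D₂, h3, h4⟩ := ih h2.valid
      (fun r hr => hok _ _ _ h2.subset (hq r (by simp [hr]))) (by omega)
    exact ⟨e :: es, U ++ V, D₂, .cons h1 h3, h2.trans h4⟩

theorem exists_extends_runs (hG : IsValid M G) (hD : IsValid M D) {qs : List (ℕ × ℕ)}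
    (hq : ∀ q ∈ qs, q.1 ∈ lhs D ∧ 0 < q.2) (hM : D.card + qs.length + 1 ≤ M) :
    ∃ es U D', Collect RunRule qs es U ∧ Extends M G D D' U qs.length := by
  have := exists_extends_collect (M := M) (G := G) (D := D) (R := RunRule) (w := fun _ => 1)
    (ok := fun q D => q.1 ∈ lhs D ∧ 0 < q.2)
    (fun q D D' h h' => ⟨lhs_mono h h'.1, h'.2⟩)
    (fun q D hD h hM => by
      obtain ⟨e, D', h'⟩ := exists_extends_rhs hG hD (ρ := .run q.1 q.2)
        (by simpa [Rhs.vars] using h.1) (by simpa using h.2) (by omega)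
      exact ⟨e, _, D', rfl, h'⟩) qs hD hq (by simpa using hM)
  simpa using this

theorem exists_extends_chars (hG : IsValid M G) (hD : IsValid M D) {T : List ℕ}
    (hM : D.card + T.length + 1 ≤ M) :
    ∃ es U D', Collect CharRule T es U ∧ Extends M G D D' U T.length := by
  have := exists_extends_collect (M := M) (G := G) (D := D) (R := CharRule) (w := fun _ => 1)
    (ok := fun _ _ => True) (by simp)
    (fun a D hD h hM => by
      obtain ⟨e, D', h'⟩ := exists_extends_rhs hG hD (ρ := .char a)
        (by simp [Rhs.vars]) (by simp) (by omega)
      exact ⟨e, _, D', rfl, h'⟩) T hD (by simp) (by simpa using hM)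
  simpa using this

theorem exists_extends_fold (hG : IsValid M G) (hD : IsValid M D) {c : ℕ} {xs : List ℕ}
    (hc : c ∈ lhs D) (hx : ∀ x ∈ xs, x ∈ lhs D) (hM : D.card + xs.length + 1 ≤ M) :
    ∃ e U D', Fold c xs e U ∧ Extends M G D D' U xs.length := by
  induction xs generalizing D c with
  | nil => exact ⟨c, [], D, .nil c, Extends.refl hD (by simp)⟩
  | cons x xs ih =>
    simp only [List.length_cons] at hM
    obtain ⟨c', D₁, h1⟩ := exists_extends_rhs hG hD (ρ := .pair c x)
      (by simp [Rhs.vars, hc, hx x]) (by simp) (by omega)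
    have := h1.card
    obtain ⟨e, U, D₂, h2, h3⟩ := ih h1.valid (mem_lhs.2 ⟨_, h1.mem _ List.mem_cons_self⟩)
      (fun y hy => lhs_mono h1.subset (hx y (by simp [hy]))) (by omega)
    refine ⟨e, _, D₂, .cons h2, (h1.trans h3).mono (by simp; omega) ?_ ?_⟩
    · simp
    · exact fun p hp => Or.inl (by simpa using hp)

theorem exists_extends_blocks (hG : IsValid M G) (hD : IsValid M D) {B : List (List ℕ)}
    (hB : ∀ q ∈ B, 2 ≤ q.length) (hq : ∀ x ∈ B.flatten, x ∈ lhs D)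
    (hM : D.card + (B.flatten.length - B.length) + 1 ≤ M) :
    ∃ es U D', Collect BlockRule B es U ∧
      Extends M G D D' U (B.flatten.length - B.length) := by
  have hs : ∀ B : List (List ℕ), (∀ q ∈ B, 2 ≤ q.length) →
      (B.map fun q => q.length - 1).sum + B.length = B.flatten.length := by
    intro B hB
    induction B with
    | nil => rfl
    | cons q B ih =>
      have h1 := hB q (by simp)
      have h2 := ih fun r hr => hB r (by simp [hr])
      rw [List.flatten_cons, List.length_append, List.length_cons, List.map_cons, List.sum_cons]
      omega
  have hs := hs B hB
  have := exists_extends_collect (M := M) (G := G) (D := D) (R := BlockRule)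
    (w := fun q => q.length - 1) (ok := fun q D => 2 ≤ q.length ∧ ∀ x ∈ q, x ∈ lhs D)
    (fun q D D' h h' => ⟨h'.1, fun x hx => lhs_mono h (h'.2 x hx)⟩)
    (fun q D hD h hM => by
      obtain ⟨h1, h2⟩ := h
      match q, h1 with
      | x₁ :: x₂ :: xs, _ =>
        obtain ⟨e, U, D', h3, h4⟩ := exists_extends_fold hG hD (h2 x₁ (by simp))
          (fun x hx => h2 x (List.mem_cons_of_mem _ hx)) (by simpa using hM)
        exact ⟨e, U, D', ⟨x₁, x₂, xs, rfl, h3⟩, h4⟩) B hD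
    (fun q hq' => ⟨hB q hq', fun x hx => hq x (List.mem_flatten.2 ⟨q, hq', hx⟩)⟩) (by omega)
  rwa [show (B.map fun q => q.length - 1).sum = B.flatten.length - B.length by omega] at this

end Extends

/-- Adjacent maximal runs have different bases and a signature has a single production, so their
signatures differ. This restores the hypothesis of local consistency on every level. -/
theorem collect_run_isChain {M : ℕ} {D : Finset Production} (hD : IsValid M D)
    {qs : List (ℕ × ℕ)} {es : List ℕ} {U : List Production} (h : Collect RunRule qs es U)
    (hU : ∀ p ∈ U, p ∈ D) (hq : qs.IsChain fun p q => p.1 ≠ q.1) : es.IsChain (· ≠ ·) := by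
  induction h with
  | nil => simp
  | @cons q e U qs es V h1 h2 ih =>
    cases h1
    rw [List.isChain_cons] at hq ⊢
    refine ⟨?_, ih (fun p hp => hU p (by simp [hp])) hq.2⟩
    rintro y hy rfl
    cases h2 with
    | nil => simp at hy
    | @cons q' e' U' qs' es' V' h3 h4 =>
      cases h3
      simp only [List.head?_cons, Option.mem_def, Option.some.injEq] at hy
      subst hy
      have := hD.deterministic _ _ _ (hU (e', .run q.1 q.2) (by simp))
        (hU (e', .run q'.1 q'.2) (by simp))
      simp only [Rhs.run.injEq] at this
      exact hq.1 q' (by simp) this.1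

theorem isParsable_of_collect {M : ℕ} {D : Finset Production} (hD : IsValid M D) {s : List ℕ}
    (hs : s ≠ []) {es : List ℕ} {U : List Production} (h : Collect RunRule (epow s) es U)
    (hU : ∀ p ∈ U, p ∈ D) (he : es.length ≠ 1) : IsParsable M es where
  two_le := by
    have h1 := h.length_eq
    have h2 : (epow s).length ≠ 0 := by
      rw [Ne, List.length_eq_zero_iff, epow_eq_nil]; exact hs
    omega
  mem x hx := by
    obtain ⟨ρ, hρ⟩ := collect_run_mem h hx
    exact hD.bounds _ (hU _ hρ)
  chain := collect_run_isChain hD h hU (epow_isChain s)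

/-- Every sequence of signatures can be parsed if enough signatures are available. -/
theorem exists_parse {M : ℕ} {f : List ℕ → Bool} (hf : IsLocallyConsistent M f)
    {G D : Finset Production} (hG : IsValid M G) (hD : IsValid M D) {s : List ℕ} (hs : s ≠ [])
    (hsD : ∀ x ∈ s, x ∈ lhs D) (hM : D.card + 3 * s.length ≤ M) :
    ∃ e U D', Parse M f s e U ∧ Extends M G D D' U (3 * (epow s).length - 2) := by
  induction hn : s.length using Nat.strong_induction_on generalizing s D with
  | _ n ih =>
    have h0 := epow_length_le s
    have h1 : 1 ≤ (epow s).length := by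
      rw [Nat.one_le_iff_ne_zero, Ne, List.length_eq_zero_iff, epow_eq_nil]; exact hs
    obtain ⟨p, U, D₁, h2, h3⟩ := exists_extends_runs hG hD (qs := epow s)
      (fun q hq => ⟨hsD _ (fst_mem_of_mem_epow hq), pos_of_mem_epow hq⟩) (by omega)
    have h4 := h2.length_eq
    by_cases hp : p.length = 1
    · obtain ⟨e, rfl⟩ := List.length_eq_one_iff.1 hp
      exact ⟨e, U, D₁, .done h2, h3.mono (by omega) (fun _ h => h) fun _ h => Or.inl h⟩
    have h5 := isParsable_of_collect h3.valid hs h2 h3.mem hp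
    have h6 := two_le_length_of_mem_eblock hf h5
    have h7 := two_mul_length_le_flatten h6
    have h8 := h3.card
    rw [eblock_flatten] at h7
    obtain ⟨s', V, D₂, h9, h10⟩ := exists_extends_blocks hG h3.valid h6 (fun x hx => by
      rw [eblock_flatten] at hx
      obtain ⟨ρ, hρ⟩ := collect_run_mem h2 hx
      exact mem_lhs.2 ⟨_, h3.mem _ hρ⟩) (by rw [eblock_flatten]; omega)
    rw [eblock_flatten] at h10
    have h11 := h9.length_eq
    have h12 := h10.card
    have h13 : (eblock (bits M f p) p).length ≠ 0 := by
      rw [Ne, List.length_eq_zero_iff]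
      intro h
      have := eblock_flatten (bits M f p) p
      rw [h, List.flatten_nil] at this
      subst this
      simp at h4
      omega
    obtain ⟨e, W, D₃, h14, h15⟩ := ih s'.length (by omega) h10.valid (s := s')
      (by rintro rfl; simp at h11; omega)
      (fun x hx => by
        obtain ⟨ρ, hρ⟩ := collect_block_mem h9 hx
        exact mem_lhs.2 ⟨_, h10.mem _ hρ⟩) (by omega) rfl
    have h16 := epow_length_le s'
    -- With `n` runs and `b` blocks, this level costs `n + (n - b)` and the remaining ones at most
    -- `3 * b - 2`. Since `2 * b ≤ n`, the sum is at most `3 * n - 2`.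
    exact ⟨e, _, D₃, .step h2 hp h9 h14, ((h3.trans h10).trans h15).mono (by omega)
      (fun _ h => h) fun _ h => Or.inl h⟩

/-! ## Sharing signatures between a parse and the parse of a changed sequence -/

theorem card_toFinset_sdiff_le {α : Type*} [DecidableEq α] {U V : List α} {K : Finset α} {n : ℕ}
    (h : ∀ p ∈ U, p ∉ K → p ∈ V) (hV : V.length ≤ n) : (U.toFinset \ K).card ≤ n := by
  refine (Finset.card_le_card (t := V.toFinset) fun p hp => ?_).trans
    ((List.toFinset_card_le V).trans hV)
  rw [Finset.mem_sdiff, List.mem_toFinset] at hp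
  exact List.mem_toFinset.2 (h p hp.1 hp.2)

theorem log_two_succ_le {a b : ℕ} (h : 2 * a ≤ b) (ha : a ≠ 0) :
    Nat.log 2 a + 1 ≤ Nat.log 2 b := by
  have h1 : a ≤ b / 2 := by omega
  have h2 := Nat.log_mono_right (b := 2) h1
  rw [Nat.log_div_base] at h2
  have h3 : 0 < Nat.log 2 b := Nat.log_pos (by norm_num) (by omega)
  omega

/-- The number of productions that are changed when a part of length `n` of a sequence of
length `l` is changed. -/
noncomputable def changeBound (M n l : ℕ) : ℕ :=
  4 * n + 4 * (logStar M + 20) * (Nat.log 2 l + 1)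

/-- One level of the update: at most `n + 2` runs change; with `8` and `logStar M + 10` border
entries they fill the `n'` blocks that change, whence the first hypothesis. The cost is `n + 2` runs
and `n + logStar M + 20 - n'` pairs. The slope `4` absorbs the part linear in `n` because the window
halves up to an additive term; the additive term is paid for by the logarithm of the length, which
drops by one. -/
theorem changeBound_step {M n l n' l' : ℕ} (h : 2 * n' ≤ n + (logStar M + 20)) (hl : 2 * l' ≤ l)
    (hn' : n' ≠ 0) (hnl : n' ≤ l') :
    2 * n + (logStar M + 22) - n' + changeBound M n' l' ≤ changeBound M n l := by
  have h1 := log_two_succ_le hl (by omega)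
  unfold changeBound
  have h2 := Nat.mul_le_mul_left (4 * (logStar M + 20)) h1
  have h3 : 4 * (logStar M + 20) * (Nat.log 2 l + 1) =
    4 * (logStar M + 20) * Nat.log 2 l + 4 * (logStar M + 20) := by ring
  omega

theorem le_changeBound (M n l : ℕ) : 4 * n + 80 ≤ changeBound M n l := by
  unfold changeBound
  nlinarith [Nat.zero_le (logStar M), Nat.zero_le (Nat.log 2 l),
    Nat.zero_le (logStar M * Nat.log 2 l)]

set_option maxHeartbeats 400000 in
/-- The parse of `L ++ o ++ R` has a set `K` of productions that can be kept when `o` is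
replaced. -/
theorem Parse.exists_kept {M : ℕ} {f : List ℕ → Bool} (hf : IsLocallyConsistent M f)
    {G : Finset Production} (hG : IsValid M G) {s : List ℕ} {e : ℕ} {U : List Production}
    (h : Parse M f s e U) (hU : ∀ p ∈ U, p ∈ G) {L o R : List ℕ} (hs : s = L ++ o ++ R)
    (ho : o ≠ []) :
    ∃ (K : Finset Production) (κ : ℕ), K ⊆ U.toFinset ∧ K.card ≤ κ ∧
      κ ≤ 3 * (L.length + R.length) ∧
      (∀ p ∈ K, ∀ y ∈ p.2.vars, y ∈ lhs K ∨ y ∈ L ∨ y ∈ R) ∧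
      (U.toFinset \ K).card ≤ changeBound M o.length s.length ∧
      ∀ m ≠ [], ∀ D, IsValid M D → K ⊆ D → (∀ x ∈ L ++ m ++ R, x ∈ lhs D) →
        D.card + 3 * (L ++ m ++ R).length ≤ M + κ →
        ∃ e' U' D', Parse M f (L ++ m ++ R) e' U' ∧
          Extends M G D D' U' (changeBound M m.length (L ++ m ++ R).length) ∧
          K ⊆ U'.toFinset := by
  -- `K` is chosen from the old parse alone, before `m` is known. `κ` counts the kept entries of the
  -- production list with repetitions. A parse needs at most three entries per element of the
  -- sequence, and `κ` of them are already in `D`; hence `M + κ` in the condition on the supply.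
  induction h generalizing L o R with
  | @done s e U h =>
    -- If the old sequence is a single run, nothing is kept. There are then no runs beyond those
    -- next to the middle, so the new sequence has at most `m.length + 2` runs and can be parsed
    -- from scratch within the bound.
    refine ⟨∅, 0, by simp, by simp, by simp, by simp, ?_, ?_⟩
    · rw [Finset.sdiff_empty]
      have h1 := collect_run_length h
      have h2 := h.length_eq
      have h3 := List.toFinset_card_le U
      have h4 := le_changeBound M o.length s.length
      simp only [List.length_singleton] at h2
      omega
    · intro m hm D hD _ hv hM
      obtain ⟨e', U', D', h1, h2⟩ := exists_parse hf hG hD (by simp [hm]) hv (by simpa using hM)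
      refine ⟨e', U', D', h1, h2.mono ?_ (fun _ h => h) (fun _ h => Or.inl h), by simp⟩
      obtain ⟨a, z, z', b, -, -, h3⟩ := exists_common_runs L R
      have h4 := h.length_eq
      rw [hs, (h3 o ho).1] at h4
      rw [(h3 m hm).1]
      simp only [List.length_append, List.length_singleton] at h4 ⊢
      have h5 := (h3 o ho).2.1
      have h6 := (h3 m hm).2.2
      have h7 := le_changeBound M m.length (L.length + m.length + R.length)
      omega
  | @step s p s' e U V W h1 hp h3 h4 ih =>
    subst hs
    simp only [List.mem_append] at hU
    have hUG : ∀ q ∈ U, q ∈ G := fun q hq => hU q (Or.inl (Or.inl hq))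
    have hpp := isParsable_of_collect hG (by simp [ho]) h1 hUG hp
    obtain ⟨a, z, z', b, hL, hR, hruns⟩ := exists_common_runs L R
    obtain ⟨hruns_o, hmid1, hmid2⟩ := hruns o ho
    have hlen := epow_length_le (L ++ o ++ R)
    have hlen1 := h1.length_eq
    rw [hruns_o] at h1
    obtain ⟨pao, pb, Uao, Ub, rfl, rfl, h1ao, h1b⟩ := h1.split
    obtain ⟨pa, po, Ua, Uo, rfl, rfl, h1a, h1o⟩ := h1ao.split
    have la := h1a.length_eq
    have lo := h1o.length_eq
    have lb := h1b.length_eq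
    have lUa := collect_run_length h1a
    have lUo := collect_run_length h1o
    have lUb := collect_run_length h1b
    have hpo : po ≠ [] := by
      rintro rfl
      simp only [List.length_nil] at lo
      omega
    obtain ⟨BL, BR, a', b', hpa, hpb, ha', hb', hblocks⟩ := exists_common_blocks hf hpo hpp
    obtain ⟨Bo, hBo, hBof⟩ := hblocks po hpo hpp
    have h2 := two_le_length_of_mem_eblock hf hpp
    have h3len := h3.length_eq
    have h3two := two_mul_length_le_flatten h2
    rw [eblock_flatten] at h3two
    rw [hBo] at h3 h2
    obtain ⟨s2lo, s2r, Vlo, Vr, rfl, rfl, h3lo, h3r⟩ := h3.split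
    obtain ⟨s2l, s2o, Vl, Vo, rfl, rfl, h3l, h3o⟩ := h3lo.split
    have l3l := h3l.length_eq
    have l3o := h3o.length_eq
    have l3r := h3r.length_eq
    have lVl := collect_block_length h3l
    have lVo := collect_block_length h3o
    have lVr := collect_block_length h3r
    have hBL := two_mul_length_le_flatten (B := BL) fun q hq => h2 q (by simp [hq])
    have hBR := two_mul_length_le_flatten (B := BR) fun q hq => h2 q (by simp [hq])
    have hBo2 := two_mul_length_le_flatten (B := Bo) fun q hq => h2 q (by simp [hq])
    have hpo1 := List.length_pos_iff.2 hpo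
    rw [hBof] at hBo2 lVo
    have hlpa := congrArg List.length hpa
    have hlpb := congrArg List.length hpb
    simp only [List.length_append] at hBo2 lVo hlpa hlpb hlen hlen1 h3len h3two
    have hBo0 : Bo ≠ [] := by
      rintro rfl
      simp [hpo] at hBof
    have hBo1 := List.length_pos_iff.2 hBo0
    have hs2o : s2o ≠ [] := by
      rintro rfl
      simp only [List.length_nil] at l3o
      omega
    have hs2o' := List.length_pos_iff.2 hs2o
    -- On the next level the part to be replaced is `s2o`, the signatures of the blocks that meet
    -- the changed runs or the border entries.
    obtain ⟨K, κ, hKW, hKκ, hκ, hKv, hcard, hnew⟩ := ih (fun q hq => hU q (Or.inr hq)) rfl hs2o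
    have hUa : ∀ x ∈ pa, ∃ ρ, (x, ρ) ∈ Ua := fun x hx => collect_run_mem h1a hx
    have hUb : ∀ x ∈ pb, ∃ ρ, (x, ρ) ∈ Ub := fun x hx => collect_run_mem h1b hx
    -- Kept on this level: the runs outside the middle and the pairs of the common blocks `BL` and
    -- `BR`.
    refine ⟨(Ua ++ Ub ++ Vl ++ Vr).toFinset ∪ K, Ua.length + Ub.length + Vl.length + Vr.length + κ,
      ?_, ?_, ?_, ?_, ?_, ?_⟩
    · intro q hq
      simp only [Finset.mem_union, List.mem_toFinset, List.mem_append] at hq ⊢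
      rcases hq with hq | hq
      · clear * - hq
        tauto
      · exact Or.inr (List.mem_toFinset.1 (hKW hq))
    · refine (Finset.card_union_le _ _).trans ?_
      have := List.toFinset_card_le (Ua ++ Ub ++ Vl ++ Vr)
      simp only [List.length_append] at this
      omega
    · have h5 := epow_length_le a
      have h6 := epow_length_le b
      have h7 := congrArg List.length hL
      have h8 := congrArg List.length hR
      simp only [List.length_append] at h7 h8
      omega
    · intro q hq y hy
      have lhsK : ∀ ρ, ((y, ρ) ∈ Ua ∨ (y, ρ) ∈ Ub ∨ (y, ρ) ∈ Vl ∨ (y, ρ) ∈ Vr ∨ (y, ρ) ∈ K) →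
          y ∈ lhs ((Ua ++ Ub ++ Vl ++ Vr).toFinset ∪ K) := fun ρ h => mem_lhs.2 ⟨ρ, by
        simp only [Finset.mem_union, List.mem_toFinset, List.mem_append]; clear * - h; tauto⟩
      simp only [Finset.mem_union, List.mem_toFinset, List.mem_append] at hq
      rcases hq with (((hq | hq) | hq) | hq) | hq
      · exact Or.inr (Or.inl (by rw [hL]; exact List.mem_append_left _ (collect_run_vars h1a hq y hy)))
      · exact Or.inr (Or.inr (by
          rw [hR]; exact List.mem_append_right _ (collect_run_vars h1b hq y hy)))
      · left
        rcases collect_block_vars h3l hq y hy with h | ⟨ρ, h⟩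
        · obtain ⟨ρ, hρ⟩ := hUa y (by rw [hpa]; exact List.mem_append_left _ h)
          exact lhsK ρ (by clear * - hρ; tauto)
        · exact lhsK ρ (by clear * - h; tauto)
      · left
        rcases collect_block_vars h3r hq y hy with h | ⟨ρ, h⟩
        · obtain ⟨ρ, hρ⟩ := hUb y (by rw [hpb]; exact List.mem_append_right _ h)
          exact lhsK ρ (by clear * - hρ; tauto)
        · exact lhsK ρ (by clear * - h; tauto)
      · left
        rcases hKv q hq y hy with h | h | h
        · obtain ⟨ρ, hρ⟩ := mem_lhs.1 h
          exact lhsK ρ (by clear * - hρ; tauto)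
        · obtain ⟨ρ, hρ⟩ := collect_block_mem h3l h
          exact lhsK ρ (by clear * - hρ; tauto)
        · obtain ⟨ρ, hρ⟩ := collect_block_mem h3r h
          exact lhsK ρ (by clear * - hρ; tauto)
    · have h5 : (Uo ++ Vo ++ (W.toFinset \ K).toList).length ≤
          changeBound M o.length (L ++ o ++ R).length := by
        have h6 := changeBound_step (M := M) (n := o.length) (n' := s2o.length)
          (l := (L ++ o ++ R).length) (l' := (s2l ++ s2o ++ s2r).length) (by omega)
          (by simp only [List.length_append]; omega) (by omega)
          (by simp only [List.length_append]; omega)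
        simp only [List.length_append, Finset.length_toList] at h6 hcard ⊢
        omega
      refine card_toFinset_sdiff_le (fun q hq hq' => ?_) h5
      simp only [Finset.mem_union, List.mem_toFinset, List.mem_append, Finset.mem_toList,
        Finset.mem_sdiff] at hq hq' ⊢
      clear * - hq hq'
      tauto
    · intro m hm D hD hKD hv hM
      obtain ⟨hruns_m, hm1, hm2⟩ := hruns m hm
      have hKD' : ∀ q, (q ∈ Ua ∨ q ∈ Ub ∨ q ∈ Vl ∨ q ∈ Vr ∨ q ∈ K) → q ∈ D := fun q hq =>
        hKD (by
          simp only [Finset.mem_union, List.mem_toFinset, List.mem_append]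
          clear * - hq; tauto)
      have hlen' := epow_length_le (L ++ m ++ R)
      rw [hruns_m] at hlen'
      simp only [List.length_append] at hM hlen'
      obtain ⟨pm, Um, D₁, h1m, h5⟩ := exists_extends_runs hG hD (qs := epow (z ++ m ++ z'))
        (fun q hq => ⟨hv _ (by
          have := fst_mem_of_mem_epow hq
          rw [hL, hR]
          simp only [List.mem_append] at this ⊢
          clear * - this
          tauto), pos_of_mem_epow hq⟩) (by omega)
      have lm := h1m.length_eq
      have h6 : Collect RunRule (epow (L ++ m ++ R)) (pa ++ pm ++ pb) (Ua ++ Um ++ Ub) := by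
        rw [hruns_m]
        exact (h1a.append h1m).append h1b
      -- The new parse may end here although the old one goes on. The middle contributes at least
      -- one run, so in that case nothing stands beside it, and the kept set turns out to be empty.
      by_cases hp' : (pa ++ pm ++ pb).length = 1
      · obtain ⟨e', he'⟩ := List.length_eq_one_iff.1 hp'
        rw [he'] at h6
        simp only [List.length_append] at hp'
        have hUa0 : Ua = [] := List.length_eq_zero_iff.1 (by omega)
        have hUb0 : Ub = [] := List.length_eq_zero_iff.1 (by omega)
        have hVl0 : Vl = [] := List.length_eq_zero_iff.1 (by omega)
        have hVr0 : Vr = [] := List.length_eq_zero_iff.1 (by omega)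
        have hK0 : K = ∅ := Finset.card_eq_zero.1 (by omega)
        subst hUa0 hUb0 hVl0 hVr0 hK0
        have h7 := le_changeBound M m.length (L ++ m ++ R).length
        exact ⟨e', _, D₁, .done h6, h5.mono (by omega) (by simp)
          (fun q hq => Or.inl (by simpa using hq)), by simp⟩
      have h5m : ∀ q ∈ Ua ++ Um ++ Ub, q ∈ D₁ := fun q hq => by
        simp only [List.mem_append] at hq
        rcases hq with (hq | hq) | hq
        · exact h5.subset (hKD' q (by clear * - hq; tauto))
        · exact h5.mem q hq
        · exact h5.subset (hKD' q (by clear * - hq; tauto))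
      have hpar := isParsable_of_collect h5.valid (by simp [hm]) h6 h5m hp'
      have hpm : pm ≠ [] := by
        rintro rfl
        simp only [List.length_nil] at lm
        omega
      obtain ⟨Bm, hBm, hBmf⟩ := hblocks pm hpm hpar
      have h2m := two_le_length_of_mem_eblock hf hpar
      rw [hBm] at h2m
      have h2m' : ∀ q ∈ Bm, 2 ≤ q.length := fun q hq => h2m q (by simp [hq])
      have hBm2 := two_mul_length_le_flatten h2m'
      have hlBm := congrArg List.length hBmf
      simp only [List.length_append] at hlBm
      have hpm1 := List.length_pos_iff.2 hpm
      have h5c := h5.card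
      obtain ⟨s2m, Vm, D₂, h3m, h7⟩ := exists_extends_blocks hG h5.valid h2m' (fun x hx => by
        rw [hBmf] at hx
        have : x ∈ pa ++ pm ++ pb := by
          rw [hpa, hpb]
          simp only [List.mem_append] at hx ⊢
          clear * - hx
          tauto
        obtain ⟨ρ, hρ⟩ := collect_run_mem h6 this
        exact mem_lhs.2 ⟨ρ, h5m _ hρ⟩) (by omega)
      have l3m := h3m.length_eq
      have hBm0 : Bm ≠ [] := by
        rintro rfl
        simp only [List.flatten_nil, List.length_nil] at hlBm
        omega
      have hBm1 := List.length_pos_iff.2 hBm0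
      have hs2m : s2m ≠ [] := by
        rintro rfl
        simp only [List.length_nil] at l3m
        omega
      have h7c := h7.card
      have h8 : Collect BlockRule (eblock (bits M f (pa ++ pm ++ pb)) (pa ++ pm ++ pb))
          (s2l ++ s2m ++ s2r) (Vl ++ Vm ++ Vr) := by
        rw [hBm]
        exact (h3l.append h3m).append h3r
      have h8m : ∀ q ∈ Vl ++ Vm ++ Vr, q ∈ D₂ := fun q hq => by
        simp only [List.mem_append] at hq
        rcases hq with (hq | hq) | hq
        · exact h7.subset (h5.subset (hKD' q (by clear * - hq; tauto)))
        · exact h7.mem q hq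
        · exact h7.subset (h5.subset (hKD' q (by clear * - hq; tauto)))
      obtain ⟨e', W', D₃, h9, h10, h11⟩ := hnew s2m hs2m D₂ h7.valid
        (fun q hq => h7.subset (h5.subset (hKD' q (by clear * - hq; tauto))))
        (fun x hx => by
          obtain ⟨ρ, hρ⟩ := collect_block_mem h8 hx
          exact mem_lhs.2 ⟨ρ, h8m _ hρ⟩)
        (by simp only [List.length_append]; omega)
      refine ⟨e', _, D₃, .step h6 hp' h8 h9, ((h5.trans h7).trans h10).mono ?_ ?_ ?_, ?_⟩
      · have h12 := changeBound_step (M := M) (n := m.length) (n' := s2m.length)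
          (l := (L ++ m ++ R).length) (l' := (s2l ++ s2m ++ s2r).length) (by omega)
          (by simp only [List.length_append]; omega) (by omega)
          (by simp only [List.length_append]; omega)
        omega
      · intro q hq
        simp only [List.mem_append] at hq ⊢
        clear * - hq
        tauto
      · intro q hq
        have := hKD' q
        simp only [List.mem_append] at hq ⊢
        clear * - hq this
        tauto
      · intro q hq
        simp only [Finset.mem_union, List.mem_toFinset, List.mem_append] at hq ⊢
        rcases hq with hq | hq
        · clear * - hq
          tauto
        · exact Or.inr (List.mem_toFinset.1 (h11 hq))

/-! ## Signature encodings as parses -/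

theorem Derives.unique {D : Finset Production}
    (hD : ∀ X e e', (X, e) ∈ D → (X, e') ∈ D → e = e') {X : ℕ} {u v : List ℕ}
    (hu : Derives D X u) (hv : Derives D X v) : u = v := by
  induction hu generalizing v with
  | char h =>
    cases hv with
    | char h' => cases hD _ _ _ h h'; rfl
    | pair h' _ _ => cases hD _ _ _ h h'
    | run h' _ => cases hD _ _ _ h h'
  | pair h _ _ ih₁ ih₂ =>
    cases hv with
    | char h' => cases hD _ _ _ h h'
    | pair h' h₁ h₂ =>
      cases hD _ _ _ h h'
      rw [ih₁ h₁, ih₂ h₂]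
    | run h' _ => cases hD _ _ _ h h'
  | run h _ ih =>
    cases hv with
    | char h' => cases hD _ _ _ h h'
    | pair h' _ _ => cases hD _ _ _ h h'
    | run h' h₁ =>
      cases hD _ _ _ h h'
      rw [ih h₁]

/-- A sequence of variables derives the concatenation of what its entries derive. -/
inductive DerivesSeq (D : Finset Production) : List ℕ → List ℕ → Prop where
  | nil : DerivesSeq D [] []
  | cons {x : ℕ} {u : List ℕ} {s v : List ℕ} :
      Derives D x u → DerivesSeq D s v → DerivesSeq D (x :: s) (u ++ v)

section DerivesSeq

variable {D : Finset Production}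

theorem DerivesSeq.split {s t w : List ℕ} (h : DerivesSeq D (s ++ t) w) :
    ∃ u v, w = u ++ v ∧ DerivesSeq D s u ∧ DerivesSeq D t v := by
  induction s generalizing w with
  | nil => exact ⟨[], w, rfl, .nil, h⟩
  | cons x s ih =>
    cases h with
    | cons h1 h2 =>
      obtain ⟨u, v, rfl, h3, h4⟩ := ih h2
      exact ⟨_, v, by rw [← List.append_assoc], .cons h1 h3, h4⟩

/-- The copies of `x` come with independent derivations; determinism makes their strings equal. -/
theorem DerivesSeq.replicate (hD : ∀ X e e', (X, e) ∈ D → (X, e') ∈ D → e = e') {x k : ℕ}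
    (hk : 0 < k) {w : List ℕ} (h : DerivesSeq D (List.replicate k x) w) :
    ∃ u, Derives D x u ∧ w = (List.replicate k u).flatten := by
  obtain ⟨k, rfl⟩ := Nat.exists_eq_add_of_lt hk
  rw [zero_add] at h ⊢
  induction k generalizing w with
  | zero =>
    cases h with
    | cons h1 h2 =>
      cases h2
      exact ⟨_, h1, by simp⟩
  | succ k ih =>
    cases h with
    | cons h1 h2 =>
      obtain ⟨u, h3, rfl⟩ := ih (by omega) h2
      refine ⟨u, h3, ?_⟩
      rw [h1.unique hD h3, List.replicate_succ (n := k + 1), List.flatten_cons]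

theorem DerivesSeq.singleton {x : ℕ} {w : List ℕ} (h : DerivesSeq D [x] w) : Derives D x w := by
  cases h with
  | cons h1 h2 =>
    cases h2
    simpa using h1

theorem DerivesSeq.chars {T s : List ℕ} {C : List Production} (h : Collect CharRule T s C)
    (hC : ∀ p ∈ C, p ∈ D) : DerivesSeq D s T := by
  induction h with
  | nil => exact .nil
  | cons h1 _ ih =>
    cases h1
    exact .cons (.char (hC _ (by simp))) (ih fun p hp => hC p (by simp [hp]))

theorem DerivesSeq.runs (hD : ∀ X e e', (X, e) ∈ D → (X, e') ∈ D → e = e')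
    {qs : List (ℕ × ℕ)} {p : List ℕ} {U : List Production} (h : Collect RunRule qs p U)
    (hU : ∀ p ∈ U, p ∈ D) (hq : ∀ q ∈ qs, 0 < q.2) {w : List ℕ}
    (hw : DerivesSeq D (runsFlatten qs) w) : DerivesSeq D p w := by
  induction h generalizing w with
  | nil => exact hw
  | cons h1 _ ih =>
    cases h1
    obtain ⟨u, v, rfl, h2, h3⟩ := hw.split
    obtain ⟨u, h4, rfl⟩ := h2.replicate hD (hq _ (by simp))
    exact .cons (.run (hU _ (by simp)) h4) (ih (fun p hp => hU p (by simp [hp]))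
      (fun q hq' => hq q (by simp [hq'])) h3)

theorem DerivesSeq.fold {c e : ℕ} {xs : List ℕ} {U : List Production} (h : Fold c xs e U)
    (hU : ∀ p ∈ U, p ∈ D) {u w : List ℕ} (hc : Derives D c u) (hw : DerivesSeq D xs w) :
    Derives D e (u ++ w) := by
  induction h generalizing u w with
  | nil c =>
    cases hw
    simpa using hc
  | cons _ ih =>
    cases hw with
    | cons h1 h2 =>
      rw [← List.append_assoc]
      exact ih (fun p hp => hU p (by simp [hp])) (.pair (hU _ (by simp)) hc h1) h2

theorem DerivesSeq.blocks {B : List (List ℕ)} {s : List ℕ} {V : List Production}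
    (h : Collect BlockRule B s V) (hV : ∀ p ∈ V, p ∈ D) {w : List ℕ}
    (hw : DerivesSeq D B.flatten w) : DerivesSeq D s w := by
  induction h generalizing w with
  | nil => exact hw
  | cons h1 _ ih =>
    obtain ⟨u, v, rfl, h2, h3⟩ := hw.split
    obtain ⟨x₁, x₂, xs, rfl, h1⟩ := h1
    refine .cons ?_ (ih (fun p hp => hV p (by simp [hp])) h3)
    cases h2 with
    | cons h4 h5 => exact DerivesSeq.fold h1 (fun p hp => hV p (by simp [hp])) h4 h5

theorem Parse.derives (hD : ∀ X e e', (X, e) ∈ D → (X, e') ∈ D → e = e') {M : ℕ}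
    {f : List ℕ → Bool} {s : List ℕ} {e : ℕ} {U : List Production} (h : Parse M f s e U)
    (hU : ∀ p ∈ U, p ∈ D) {w : List ℕ} (hw : DerivesSeq D s w) : Derives D e w := by
  induction h with
  | @done s e U h =>
    rw [← runsFlatten_epow s] at hw
    exact (DerivesSeq.runs hD h hU (fun q hq => pos_of_mem_epow hq) hw).singleton
  | @step s p s' e U V W h1 _ h3 h4 ih =>
    simp only [List.mem_append] at hU
    rw [← runsFlatten_epow s] at hw
    have h5 := DerivesSeq.runs hD h1 (fun q hq => hU q (by tauto))
      (fun q hq => pos_of_mem_epow hq) hw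
    rw [← eblock_flatten (bits M f p) p] at h5
    exact ih (fun q hq => hU q (by tauto)) (DerivesSeq.blocks h3 (fun q hq => hU q (by tauto)) h5)

end DerivesSeq

theorem forall₂_char_iff {D : Finset Production} {T s : List ℕ} :
    List.Forall₂ (fun a e => (e, Rhs.char a) ∈ D) T s ↔
      ∃ C, Collect CharRule T s C ∧ ∀ p ∈ C, p ∈ D :=
  ⟨fun h => Collect.of_forall₂ h fun a e h => ⟨_, rfl, by simpa using h⟩,
    fun ⟨C, h, hC⟩ => h.forall₂ fun a _ e V hV hVC => by
      subst hV; exact hC _ (hVC (by simp))⟩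

theorem forall₂_run_iff {D : Finset Production} {qs : List (ℕ × ℕ)} {p : List ℕ} :
    List.Forall₂ (fun q e => (e, Rhs.run q.1 q.2) ∈ D) qs p ↔
      ∃ U, Collect RunRule qs p U ∧ ∀ r ∈ U, r ∈ D :=
  ⟨fun h => Collect.of_forall₂ h fun a e h => ⟨_, rfl, by simpa using h⟩,
    fun ⟨C, h, hC⟩ => h.forall₂ fun a _ e V hV hVC => by
      subst hV; exact hC _ (hVC (by simp))⟩

theorem forall₂_block_iff {D : Finset Production} {B : List (List ℕ)} {s : List ℕ} :
    List.Forall₂ (SigBlock D) B s ↔ ∃ V, Collect BlockRule B s V ∧ ∀ r ∈ V, r ∈ D :=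
  ⟨fun h => Collect.of_forall₂ h fun _ _ h => h.blockRule,
    fun ⟨_, h, hC⟩ => h.forall₂ fun _ _ _ _ hV hVC => hV.sigBlock fun r hr => hC r (hVC hr)⟩

theorem parse_iff_levels {M : ℕ} {f : List ℕ → Bool} {D : Finset Production} {s : List ℕ}
    {e : ℕ} : (∃ U, Parse M f s e U ∧ ∀ p ∈ U, p ∈ D) ↔
      ∃ (h : ℕ) (shrink pow : ℕ → List ℕ), shrink 0 = s ∧
        (∀ t ≤ h, List.Forall₂ (fun q e => (e, Rhs.run q.1 q.2) ∈ D)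
          (epow (shrink t)) (pow t)) ∧
        (∀ t < h, List.Forall₂ (SigBlock D) (eblock (bits M f (pow t)) (pow t))
          (shrink (t + 1))) ∧
        (∀ t < h, (pow t).length ≠ 1) ∧ pow h = [e] := by
  constructor
  · rintro ⟨U, hp, hU⟩
    induction hp with
    | @done s e U h1 =>
      refine ⟨0, fun _ => s, fun _ => [e], rfl, fun t _ => ?_, by simp, by simp, rfl⟩
      exact forall₂_run_iff.2 ⟨U, h1, hU⟩
    | @step s p s' e U V W h1 h2 h3 h4 ih =>
      simp only [List.mem_append] at hU
      obtain ⟨h, shrink, pow, h5, h6, h7, h8, h9⟩ := ih fun q hq => hU q (by tauto)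
      refine ⟨h + 1, fun t => t.casesOn s shrink, fun t => t.casesOn p pow, rfl, ?_, ?_, ?_, h9⟩
      · rintro (_ | t) ht
        · exact forall₂_run_iff.2 ⟨U, h1, fun q hq => hU q (by tauto)⟩
        · exact h6 t (by omega)
      · rintro (_ | t) ht
        · subst h5
          exact forall₂_block_iff.2 ⟨V, h3, fun q hq => hU q (by tauto)⟩
        · exact h7 t (by omega)
      · rintro (_ | t) ht
        · exact h2
        · exact h8 t (by omega)
  · rintro ⟨h, shrink, pow, rfl, h6, h7, h8, h9⟩
    induction h generalizing shrink pow with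
    | zero =>
      obtain ⟨U, h1, hU⟩ := forall₂_run_iff.1 (h6 0 le_rfl)
      rw [h9] at h1
      exact ⟨U, .done h1, hU⟩
    | succ h ih =>
      obtain ⟨U, h1, hU⟩ := forall₂_run_iff.1 (h6 0 (by omega))
      obtain ⟨V, h2, hV⟩ := forall₂_block_iff.1 (h7 0 (by omega))
      obtain ⟨W, h3, hW⟩ := ih (fun t => shrink (t + 1)) (fun t => pow (t + 1))
        (fun t ht => h6 (t + 1) (by omega)) (fun t ht => h7 (t + 1) (by omega))
        (fun t ht => h8 (t + 1) (by omega)) h9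
      refine ⟨_, .step h1 (h8 0 (by omega)) h2 h3, fun q hq => ?_⟩
      simp only [List.mem_append] at hq
      rcases hq with (hq | hq) | hq
      · exact hU q hq
      · exact hV q hq
      · exact hW q hq

theorem parse_vars_closed {M : ℕ} {f : List ℕ → Bool} {T s : List ℕ} {e : ℕ}
    {C U : List Production} (hC : Collect CharRule T s C) (hU : Parse M f s e U) :
    ∀ p ∈ (C ++ U).toFinset, ∀ y ∈ p.2.vars, y ∈ lhs (C ++ U).toFinset := by
  have key : ∀ {y ρ}, (y, ρ) ∈ C ∨ (y, ρ) ∈ U → y ∈ lhs (C ++ U).toFinset := fun {y ρ} h =>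
    mem_lhs.2 ⟨ρ, by simpa using h⟩
  intro p hp y hy
  rw [List.mem_toFinset, List.mem_append] at hp
  rcases hp with hp | hp
  · obtain ⟨a, e, V, -, -, rfl, hp, -⟩ := hC.exists_of_mem_prods hp
    rw [List.mem_singleton.1 hp] at hy
    simp [Rhs.vars] at hy
  · rcases hU.vars hp y hy with h | ⟨ρ, h⟩
    · obtain ⟨ρ, hρ⟩ := collect_char_mem hC h
      exact key (Or.inl hρ)
    · exact key (Or.inr h)

theorem isSignatureEncoding_of_parse {M : ℕ} {f : List ℕ → Bool} {T s : List ℕ} {e : ℕ}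
    {C U : List Production} (hC : Collect CharRule T s C) (hU : Parse M f s e U)
    (hv : IsValid M (C ++ U).toFinset) : IsSignatureEncoding M f T ⟨(C ++ U).toFinset, e⟩ := by
  have hC' : ∀ p ∈ C, p ∈ (C ++ U).toFinset := by simp +contextual
  have hU' : ∀ p ∈ U, p ∈ (C ++ U).toFinset := by simp +contextual
  refine ⟨⟨fun X hX => (hv.mem_bounds hX).1, hv.deterministic, hv.acyclic, hv.run_pos,
    hv.nonredundant, ?_, ?_, ?_⟩, fun X hX => (hv.mem_bounds hX).2, ?_⟩
  · obtain ⟨ρ, h⟩ := hU.mem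
    exact mem_lhs.2 ⟨ρ, hU' _ h⟩
  · intro X hX
    obtain ⟨ρ, h⟩ := mem_lhs.1 hX
    obtain ⟨h1, h2⟩ := hU.reach hU'
    rw [List.mem_toFinset, List.mem_append] at h
    rcases h with h | h
    · obtain ⟨a, x, V, -, hx, rfl, h, -⟩ := hC.exists_of_mem_prods h
      simp only [List.mem_singleton, Prod.mk.injEq] at h
      rw [h.1]
      exact h1 x hx
    · exact h2 _ h
  · exact hU.derives hv.deterministic hU' (DerivesSeq.chars hC hC')
  · obtain ⟨h, shrink, pow, rfl, h1⟩ := parse_iff_levels.1 ⟨U, hU, hU'⟩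
    exact ⟨h, shrink, pow, forall₂_char_iff.2 ⟨C, hC, hC'⟩, h1⟩

theorem IsSignatureEncoding.isValid {M : ℕ} {f : List ℕ → Bool} {T : List ℕ} {G : Grammar}
    (hG : IsSignatureEncoding M f T G) : IsValid M G.prods where
  bounds p hp := by
    have : p.1 ∈ G.variables := Finset.mem_image_of_mem _ hp
    exact ⟨hG.rlslp.pos _ this, hG.le_max _ this⟩
  deterministic := hG.rlslp.deterministic
  nonredundant := hG.rlslp.nonredundant
  run_pos := hG.rlslp.run_pos
  acyclic := hG.rlslp.acyclic

theorem IsSignatureEncoding.exists_parse {M : ℕ} {f : List ℕ → Bool} {T : List ℕ} {G : Grammar}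
    (hG : IsSignatureEncoding M f T G) : ∃ s C U, Collect CharRule T s C ∧
      Parse M f s G.start U ∧ G.prods = (C ++ U).toFinset := by
  obtain ⟨h, shrink, pow, h0, h1⟩ := hG.levels
  obtain ⟨C, hC, hC'⟩ := forall₂_char_iff.1 h0
  obtain ⟨U, hU, hU'⟩ := parse_iff_levels.2 ⟨h, shrink, pow, rfl, h1⟩
  have hsub : (C ++ U).toFinset ⊆ G.prods := by
    intro p hp
    rw [List.mem_toFinset, List.mem_append] at hp
    exact hp.elim (hC' p) (hU' p)
  refine ⟨shrink 0, C, U, hC, hU, Finset.Subset.antisymm ?_ hsub⟩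
  -- The productions of the parse are closed under `Child`, and determinism leaves no other
  -- production for their variables. So everything reachable from the start stays among them, and
  -- usefulness says that `G` has nothing else.
  have hcl := parse_vars_closed hC hU
  have hall : ∀ X, Relation.ReflTransGen (Child G.prods) G.start X →
      X ∈ lhs (C ++ U).toFinset := by
    intro X hX
    induction hX with
    | refl =>
      obtain ⟨ρ, h⟩ := hU.mem
      exact mem_lhs.2 ⟨ρ, by simp [h]⟩
    | tail _ h ih =>
      obtain ⟨ρ, hρ, hy⟩ := h
      obtain ⟨ρ', hρ'⟩ := mem_lhs.1 ih
      rw [hG.rlslp.deterministic _ _ _ hρ (hsub hρ')] at hy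
      exact hcl _ hρ' _ hy
  rintro ⟨X, ρ⟩ hp
  obtain ⟨ρ', hρ'⟩ := mem_lhs.1 (hall X (hG.rlslp.useful X (Finset.mem_image_of_mem _ hp)))
  rwa [hG.rlslp.deterministic _ _ _ hp (hsub hρ')]

/-- Update of a signature encoding when a part of the string is replaced. -/
theorem IsSignatureEncoding.exists_update {M : ℕ} {f : List ℕ → Bool}
    (hf : IsLocallyConsistent M f) {L o m R : List ℕ} (ho : o ≠ []) (hm : m ≠ []) {G : Grammar}
    (hG : IsSignatureEncoding M f (L ++ o ++ R) G) (hM : 4 * (L ++ m ++ R).length ≤ M) :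
    ∃ G' : Grammar, IsSignatureEncoding M f (L ++ m ++ R) G' ∧
      (G.prods \ G'.prods).card ≤ o.length + changeBound M o.length (L ++ o ++ R).length ∧
      (G'.prods \ G.prods).card ≤ m.length + changeBound M m.length (L ++ m ++ R).length ∧
      ∀ p ∈ G.prods, p ∈ G'.prods → ∀ y ∈ p.2.vars, y ∈ lhs (G.prods ∩ G'.prods) := by
  have hv := hG.isValid
  obtain ⟨s, C, U, hC, hU, hGp⟩ := hG.exists_parse
  obtain ⟨slo, sr, Clo, Cr, rfl, rfl, hClo, hCr⟩ := hC.split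
  obtain ⟨sl, so, Cl, Co, rfl, rfl, hCl, hCo⟩ := hClo.split
  have hmemG : ∀ p, p ∈ G.prods ↔ (((p ∈ Cl ∨ p ∈ Co) ∨ p ∈ Cr) ∨ p ∈ U) := by
    intro p
    rw [hGp, List.mem_toFinset]
    simp only [List.mem_append]
  have lCl := collect_char_length hCl
  have lCo := collect_char_length hCo
  have lCr := collect_char_length hCr
  have lsl := hCl.length_eq
  have lso := hCo.length_eq
  have lsr := hCr.length_eq
  have hlen : (sl ++ so ++ sr).length = (L ++ o ++ R).length := by simp; omega
  obtain ⟨K, κ, hKU, hKκ, hκ, hKv, hcard, hnew⟩ := hU.exists_kept hf hv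
    (fun p hp => (hmemG p).2 (Or.inr hp)) rfl
    (by rintro rfl; exact ho (List.length_eq_zero_iff.1 (by simpa using lso.symm)))
  rw [hlen, lso] at hcard
  -- All that survives the edit: the characters of `L` and `R` and the kept part of the parse.
  set K₀ := (Cl ++ Cr).toFinset ∪ K with hK₀
  have hmemK : ∀ p, p ∈ K₀ ↔ ((p ∈ Cl ∨ p ∈ Cr) ∨ p ∈ K) := by
    intro p
    rw [hK₀, Finset.mem_union, List.mem_toFinset, List.mem_append]
  have hK₀G : K₀ ⊆ G.prods := by
    intro p hp
    rw [hmemG]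
    rcases (hmemK p).1 hp with h | h
    · tauto
    · exact Or.inr (List.mem_toFinset.1 (hKU h))
  have hK₀c : ∀ p ∈ K₀, ∀ y ∈ p.2.vars, y ∈ lhs K₀ := by
    have noVars : ∀ {T s C p}, Collect CharRule T s C → p ∈ C → p.2.vars = ∅ := by
      intro T s C p h hp
      obtain ⟨a, e, V, -, -, rfl, hp, -⟩ := h.exists_of_mem_prods hp
      rw [List.mem_singleton.1 hp]
      rfl
    intro p hp y hy
    rcases (hmemK p).1 hp with (h | h) | h
    · simp [noVars hCl h] at hy
    · simp [noVars hCr h] at hy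
    · rcases hKv p h y hy with h | h | h
      · obtain ⟨ρ, h⟩ := mem_lhs.1 h
        exact mem_lhs.2 ⟨ρ, (hmemK _).2 (Or.inr h)⟩
      · obtain ⟨ρ, h⟩ := collect_char_mem hCl h
        exact mem_lhs.2 ⟨ρ, (hmemK _).2 (Or.inl (Or.inl h))⟩
      · obtain ⟨ρ, h⟩ := collect_char_mem hCr h
        exact mem_lhs.2 ⟨ρ, (hmemK _).2 (Or.inl (Or.inr h))⟩
  have hK₀v := hv.subset hK₀G hK₀c
  have hK₀n : K₀.card ≤ L.length + R.length + κ := by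
    refine (Finset.card_union_le _ _).trans ?_
    have := List.toFinset_card_le (Cl ++ Cr)
    rw [List.length_append] at this
    omega
  have hm1 := List.length_pos_iff.2 hm
  simp only [List.length_append] at hM
  obtain ⟨sm, Cm, D₀, hCm, hD₀⟩ := exists_extends_chars hv hK₀v (T := m) (by omega)
  have lsm := hCm.length_eq
  have hD₀c := hD₀.card
  have hC' := (hCl.append hCm).append hCr
  have hC'D : ∀ p ∈ Cl ++ Cm ++ Cr, p ∈ D₀ := by
    intro p hp
    simp only [List.mem_append] at hp
    rcases hp with (h | h) | h
    · exact hD₀.subset ((hmemK p).2 (by tauto))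
    · exact hD₀.mem p h
    · exact hD₀.subset ((hmemK p).2 (by tauto))
  obtain ⟨e', U', D', hU', hD', hKU'⟩ := hnew sm (by
      rintro rfl; exact hm (List.length_eq_zero_iff.1 (by simpa using lsm.symm))) D₀ hD₀.valid
    (fun p hp => hD₀.subset ((hmemK p).2 (by tauto)))
    (fun x hx => by
      obtain ⟨ρ, hρ⟩ := collect_char_mem hC' hx
      exact mem_lhs.2 ⟨ρ, hC'D _ hρ⟩)
    (by simp only [List.length_append]; omega)
  have hlen' : (sl ++ sm ++ sr).length = (L ++ m ++ R).length := by simp; omega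
  rw [hlen', lsm] at hD'
  have hsub : ((Cl ++ Cm ++ Cr) ++ U').toFinset ⊆ D' := by
    intro p hp
    rw [List.mem_toFinset, List.mem_append] at hp
    rcases hp with hp | hp
    · exact hD'.subset (hC'D p hp)
    · exact hD'.mem p hp
  have hK₀G' : K₀ ⊆ ((Cl ++ Cm ++ Cr) ++ U').toFinset := by
    intro p hp
    rw [List.mem_toFinset]
    simp only [List.mem_append]
    rcases (hmemK p).1 hp with h | h
    · tauto
    · exact Or.inr (List.mem_toFinset.1 (hKU' h))
  -- New productions avoid `G`, so whatever `D'` shares with `G` was kept. With the closure of `K₀`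
  -- this gives the last clause, on which the agreement of representatives in both grammars rests.
  have hinter : ∀ p ∈ G.prods, p ∈ D' → p ∈ K₀ := by
    intro p hp hp'
    rcases hD'.new p hp' with h | h
    · rcases hD₀.new p h with h | h
      · exact h
      · exact absurd hp h.2
    · exact absurd hp h.2
  refine ⟨⟨_, e'⟩, isSignatureEncoding_of_parse hC' hU'
    (hD'.valid.subset hsub (parse_vars_closed hC' hU')), ?_, ?_, ?_⟩
  · have : (Co ++ (U.toFinset \ K).toList).length ≤
        o.length + changeBound M o.length (L ++ o ++ R).length := by
      rw [List.length_append, Finset.length_toList]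
      omega
    rw [hGp]
    refine card_toFinset_sdiff_le (fun p hp hp' => ?_) this
    have h1 : p ∉ K₀ := fun h => hp' (hK₀G' h)
    rw [hmemK] at h1
    simp only [List.mem_append, Finset.mem_toList, Finset.mem_sdiff, List.mem_toFinset] at hp ⊢
    tauto
  · have h1 : ((Cl ++ Cm ++ Cr) ++ U').toFinset \ G.prods ⊆ D' \ K₀ :=
      Finset.sdiff_subset_sdiff hsub hK₀G
    have h2 := Finset.card_le_card h1
    rw [Finset.card_sdiff_of_subset (hK₀G'.trans hsub)] at h2
    have h3 := hD'.card
    dsimp only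
    omega
  · intro p hp hp' y hy
    exact lhs_mono (Finset.subset_inter hK₀G hK₀G') (hK₀c p (hinter p hp (hsub hp')) y hy)

/-! ## The structure of a signature encoding -/

/-- Value of a right-hand side, given the values of the variables. -/
def Rhs.value {β : Type*} (c : ℕ → β) (p : β → β → β) (r : β → ℕ → β) (φ : ℕ → β) : Rhs → β
  | .char a => c a
  | .pair x y => p (φ x) (φ y)
  | .run x k => r (φ x) k

/-- Definition by recursion along an acyclic set of productions. -/
theorem IsValid.exists_value {M : ℕ} {D : Finset Production} (hD : IsValid M D) {β : Type*}
    [Nonempty β] (c : ℕ → β) (p : β → β → β) (r : β → ℕ → β) :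
    ∃ φ : ℕ → β, ∀ X ρ, (X, ρ) ∈ D → φ X = ρ.value c p r φ := by
  classical
  obtain ⟨rank, hr⟩ := hD.acyclic
  have congr : ∀ (φ ψ : ℕ → β) (ρ : Rhs), (∀ y ∈ ρ.vars, φ y = ψ y) →
      ρ.value c p r φ = ρ.value c p r ψ := by
    intro φ ψ ρ h
    cases ρ with
    | char a => rfl
    | pair x y => simp [Rhs.value, h x (by simp [Rhs.vars]), h y (by simp [Rhs.vars])]
    | run x k => simp [Rhs.value, h x (by simp [Rhs.vars])]
  -- The values are determined rank by rank; each stage leaves those of smaller rank untouched.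
  have main : ∀ n, ∃ φ : ℕ → β, ∀ X ρ, (X, ρ) ∈ D → rank X < n → φ X = ρ.value c p r φ := by
    intro n
    induction n with
    | zero => exact ⟨fun _ => Classical.arbitrary β, by simp⟩
    | succ n ih =>
      obtain ⟨φ, hφ⟩ := ih
      let ψ : ℕ → β := fun X => if rank X < n then φ X else
        if h : ∃ ρ, (X, ρ) ∈ D then h.choose.value c p r φ else φ X
      refine ⟨ψ, fun X ρ hX hn => ?_⟩
      have h1 : ρ.value c p r ψ = ρ.value c p r φ := by
        refine congr _ _ _ fun y hy => ?_
        have := (hr X y ⟨ρ, hX, hy⟩).2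
        exact if_pos (by omega)
      rw [h1]
      by_cases h : rank X < n
      · rw [← hφ X ρ hX h]
        exact if_pos h
      · have h2 : ∃ ρ, (X, ρ) ∈ D := ⟨ρ, hX⟩
        have h3 : ψ X = h2.choose.value c p r φ := by
          simp only [ψ, if_neg h, dif_pos h2]
        rw [h3, hD.deterministic _ _ _ h2.choose_spec hX]
  obtain ⟨φ, hφ⟩ := main (∑ q ∈ D, rank q.1 + 1)
  refine ⟨φ, fun X ρ hX => hφ X ρ hX ?_⟩
  have := Finset.single_le_sum (f := fun q : Production => rank q.1) (fun _ _ => Nat.zero_le _) hX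
  dsimp only at this
  omega

/-- Induction along an acyclic set of productions. -/
theorem IsValid.induction {M : ℕ} {D : Finset Production} (hD : IsValid M D) {P : ℕ → Prop}
    (h : ∀ X ρ, (X, ρ) ∈ D → (∀ y ∈ ρ.vars, P y) → P X) {X : ℕ} (hX : X ∈ lhs D) : P X := by
  obtain ⟨rank, hr⟩ := hD.acyclic
  induction hn : rank X using Nat.strong_induction_on generalizing X with
  | _ n ih =>
    obtain ⟨ρ, hρ⟩ := mem_lhs.1 hX
    refine h X ρ hρ fun y hy => ?_
    obtain ⟨h1, h2⟩ := hr X y ⟨ρ, hρ, hy⟩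
    exact ih _ (hn ▸ h2) h1 rfl

theorem IsValid.vars_mem {M : ℕ} {D : Finset Production} (hD : IsValid M D) {X : ℕ} {ρ : Rhs}
    (h : (X, ρ) ∈ D) : ∀ y ∈ ρ.vars, y ∈ lhs D := by
  obtain ⟨rank, hr⟩ := hD.acyclic
  exact fun y hy => (hr X y ⟨ρ, h, hy⟩).1

/-- The shape of the pair productions: the second signature is a run; the first one is a run
with another base, or a pair of the next level. -/
def PairShape (D : Finset Production) (lev : ℕ → ℕ) (l r : ℕ) : Prop :=
  ∃ x k, (r, Rhs.run x k) ∈ D ∧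
    ((∃ y j, (l, Rhs.run y j) ∈ D ∧ y ≠ x ∧ lev l = lev r) ∨
      (∃ l' r', (l, Rhs.pair l' r') ∈ D) ∧ lev l = lev r + 1)

/-- The level of a signature, together with the shape of the productions. -/
structure IsLevel (D : Finset Production) (lev : ℕ → ℕ) : Prop where
  run : ∀ X x k, (X, Rhs.run x k) ∈ D → lev X = lev x ∧ ∀ y j, (x, Rhs.run y j) ∉ D
  pair : ∀ X l r, (X, Rhs.pair l r) ∈ D → PairShape D lev l r

theorem Fold.eq_pair_of_mem {c e : ℕ} {xs : List ℕ} {U : List Production} (h : Fold c xs e U)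
    {X : ℕ} {ρ : Rhs} (hX : (X, ρ) ∈ U) : ∃ l r, ρ = .pair l r := by
  induction h with
  | nil => simp at hX
  | cons _ ih =>
    rcases List.mem_cons.1 hX with h | h
    · exact ⟨_, _, (Prod.mk.injEq _ _ _ _ ▸ h).2⟩
    · exact ih h

theorem collect_run_isChain_base {M : ℕ} {D : Finset Production} (hD : IsValid M D)
    {qs : List (ℕ × ℕ)} {es : List ℕ} {U : List Production} (h : Collect RunRule qs es U)
    (hU : ∀ p ∈ U, p ∈ D) (hq : qs.IsChain fun p q => p.1 ≠ q.1) :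
    es.IsChain fun a b => ∀ x k y j, (a, Rhs.run x k) ∈ D → (b, Rhs.run y j) ∈ D → x ≠ y := by
  induction h with
  | nil => simp
  | @cons q e U qs es V h1 h2 ih =>
    cases h1
    rw [List.isChain_cons] at hq ⊢
    refine ⟨?_, ih (fun p hp => hU p (by simp [hp])) hq.2⟩
    intro e' he' x k y j hx hy
    cases h2 with
    | nil => simp at he'
    | @cons q' e'' U' qs' es' V' h3 h4 =>
      cases h3
      simp only [List.head?_cons, Option.mem_def, Option.some.injEq] at he'
      subst he'
      have e1 := hD.deterministic _ _ _ hx (hU (e, .run q.1 q.2) (by simp))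
      have e2 := hD.deterministic _ _ _ hy (hU (e'', .run q'.1 q'.2) (by simp))
      simp only [Rhs.run.injEq] at e1 e2
      rw [e1.1, e2.1]
      exact hq.1 q' (by simp)

/-- Only the first pair of a block can join two runs; afterwards the accumulated signature is itself
a pair, one level above the run that is appended. -/
theorem Fold.pairShape {D : Finset Production} {lev : ℕ → ℕ}
    (hlev : ∀ X l r, (X, Rhs.pair l r) ∈ D → lev X = lev r + 1) {t c e : ℕ} {xs : List ℕ}
    {U : List Production} (h : Fold c xs e U) (hU : ∀ p ∈ U, p ∈ D)
    (hx : ∀ x ∈ xs, lev x = t ∧ ∃ y k, (x, Rhs.run y k) ∈ D)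
    (hc : ∀ x ∈ xs.head?, PairShape D lev c x) :
    (∀ X l r, (X, Rhs.pair l r) ∈ U → PairShape D lev l r) ∧
      (xs ≠ [] → lev e = t + 1 ∧ ∃ l r, (e, Rhs.pair l r) ∈ D) := by
  induction h with
  | nil => simp
  | @cons c x c' e xs U h ih =>
    have h1 : (c', Rhs.pair c x) ∈ D := hU _ (by simp)
    have h2 := hlev _ _ _ h1
    have h3 := (hx x (by simp)).1
    have h4 := ih (fun p hp => hU p (by simp [hp])) (fun y hy => hx y (by simp [hy]))
      (fun y hy => by
        have := List.mem_of_mem_head? hy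
        obtain ⟨h5, z, k, h6⟩ := hx y (by simp [this])
        exact ⟨z, k, h6, Or.inr ⟨⟨c, x, h1⟩, by omega⟩⟩)
    refine ⟨fun X l r hp => ?_, fun _ => ?_⟩
    · rcases List.mem_cons.1 hp with hp | hp
      · cases hp
        exact hc x (by simp)
      · exact h4.1 X l r hp
    · rcases eq_or_ne xs [] with rfl | hne
      · cases h
        exact ⟨by omega, c, x, h1⟩
      · exact h4.2 hne

/-- Along the levels, entries before `Epow` are never runs, their runs keep the level `t`, and
blocks lead to pairs of level `t + 1`. Neighbouring runs inside a block have different bases because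
runs are maximal. -/
theorem Parse.pairShape {M : ℕ} {D : Finset Production} (hD : IsValid M D) {lev : ℕ → ℕ}
    (hrun : ∀ X x k, (X, Rhs.run x k) ∈ D → lev X = lev x)
    (hlev : ∀ X l r, (X, Rhs.pair l r) ∈ D → lev X = lev r + 1) {f : List ℕ → Bool}
    {s : List ℕ} {e : ℕ} {U : List Production} (h : Parse M f s e U) (hU : ∀ p ∈ U, p ∈ D) {t : ℕ}
    (hs : ∀ x ∈ s, lev x = t ∧ ∀ y j, (x, Rhs.run y j) ∉ D) :
    (∀ X x k, (X, Rhs.run x k) ∈ U → ∀ y j, (x, Rhs.run y j) ∉ D) ∧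
      ∀ X l r, (X, Rhs.pair l r) ∈ U → PairShape D lev l r := by
  have runs : ∀ {s p U t}, Collect RunRule (epow s) p U → (∀ p ∈ U, p ∈ D) →
      (∀ x ∈ s, lev x = t ∧ ∀ y j, (x, Rhs.run y j) ∉ D) →
      (∀ X x k, (X, Rhs.run x k) ∈ U → ∀ y j, (x, Rhs.run y j) ∉ D) ∧
      (∀ X l r, (X, Rhs.pair l r) ∈ U → False) ∧
      ∀ x ∈ p, lev x = t ∧ ∃ y k, (x, Rhs.run y k) ∈ D := by
    intro s p U t h hU hs
    refine ⟨fun X x k hX => ?_, fun X l r hX => ?_, fun x hx => ?_⟩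
    · obtain ⟨q, e, V, hq, -, rfl, hp, -⟩ := h.exists_of_mem_prods hX
      simp only [List.mem_singleton, Prod.mk.injEq, Rhs.run.injEq] at hp
      rw [hp.2.1]
      exact (hs _ (fst_mem_of_mem_epow hq)).2
    · obtain ⟨q, e, V, hq, -, rfl, hp, -⟩ := h.exists_of_mem_prods hX
      simp at hp
    · obtain ⟨q, V, hq, rfl, hV⟩ := h.exists_of_mem_right hx
      have h1 := hU _ (hV (List.mem_singleton_self _))
      exact ⟨by rw [hrun _ _ _ h1]; exact (hs _ (fst_mem_of_mem_epow hq)).1, _, _, h1⟩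
  induction h generalizing t with
  | done h =>
    obtain ⟨h1, h2, -⟩ := runs h hU hs
    exact ⟨h1, fun X l r hp => (h2 X l r hp).elim⟩
  | @step s p s' e U V W h1 _ h3 h4 ih =>
    simp only [List.mem_append] at hU
    have hUU : ∀ q ∈ U, q ∈ D := fun q hq => hU q (Or.inl (Or.inl hq))
    obtain ⟨r1, r2, r3⟩ := runs h1 hUU hs
    have hch := collect_run_isChain_base hD h1 hUU (epow_isChain s)
    rw [← eblock_flatten (bits M f p) p] at hch r3
    have blk : ∀ q ∈ eblock (bits M f p) p, ∀ y V', BlockRule q y V' → V' ⊆ V →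
        (∀ X l r, (X, Rhs.pair l r) ∈ V' → PairShape D lev l r) ∧
          lev y = t + 1 ∧ ∃ l r, (y, Rhs.pair l r) ∈ D := by
      rintro q hq y V' ⟨x₁, x₂, xs, rfl, hF⟩ hV
      have hch' := hch.infix (List.infix_of_mem_flatten hq)
      rw [List.isChain_cons_cons] at hch'
      have hx : ∀ x ∈ x₁ :: x₂ :: xs, lev x = t ∧ ∃ y k, (x, Rhs.run y k) ∈ D := fun x hx =>
        r3 x (List.mem_flatten.2 ⟨_, hq, hx⟩)
      obtain ⟨l1, y1, k1, m1⟩ := hx x₁ (by simp)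
      obtain ⟨l2, y2, k2, m2⟩ := hx x₂ (by simp)
      have h5 := hF.pairShape hlev (t := t) (fun r hr => hU r (Or.inl (Or.inr (hV hr))))
        (fun x hx' => hx x (List.mem_cons_of_mem _ hx')) (fun x hx' => by
          simp only [List.head?_cons, Option.mem_def, Option.some.injEq] at hx'
          subst hx'
          exact ⟨y2, k2, m2, Or.inl ⟨y1, k1, m1, hch'.1 _ _ _ _ m1 m2, by omega⟩⟩)
      exact ⟨h5.1, h5.2 (by simp)⟩
    have ih' := ih (fun q hq => hU q (Or.inr hq)) (t := t + 1) (fun x hx => by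
      obtain ⟨q, V', hq, hB, hV⟩ := h3.exists_of_mem_right hx
      obtain ⟨-, h6, l, r, h7⟩ := blk q hq x V' hB hV
      exact ⟨h6, fun y j h8 => by cases hD.deterministic _ _ _ h7 h8⟩)
    refine ⟨fun X x k hX => ?_, fun X l r hX => ?_⟩
    · simp only [List.mem_append] at hX
      rcases hX with (hX | hX) | hX
      · exact r1 X x k hX
      · obtain ⟨q, y, V', hq, -, ⟨x₁, x₂, xs, rfl, hF⟩, hX, -⟩ := h3.exists_of_mem_prods hX
        obtain ⟨l, r, h⟩ := hF.eq_pair_of_mem hX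
        cases h
      · exact ih'.1 X x k hX
    · simp only [List.mem_append] at hX
      rcases hX with (hX | hX) | hX
      · exact (r2 X l r hX).elim
      · obtain ⟨q, y, V', hq, -, hB, hX, hV⟩ := h3.exists_of_mem_prods hX
        exact (blk q hq y V' hB hV).1 X l r hX
      · exact ih'.2 X l r hX

theorem IsSignatureEncoding.exists_isLevel {M : ℕ} {f : List ℕ → Bool} {T : List ℕ} {G : Grammar}
    (hG : IsSignatureEncoding M f T G) : ∃ lev, IsLevel G.prods lev := by
  have hv := hG.isValid
  obtain ⟨s, C, U, hC, hU, hp⟩ := hG.exists_parse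
  -- The level of a pair is read off from its second component, always a run of the level below; the
  -- first component may already be one level higher.
  obtain ⟨lev, hlev⟩ := hv.exists_value (fun _ => 0) (fun _ b => b + 1) (fun a _ => a)
  have hrun : ∀ X x k, (X, Rhs.run x k) ∈ G.prods → lev X = lev x := fun X x k h => hlev _ _ h
  have hpair : ∀ X l r, (X, Rhs.pair l r) ∈ G.prods → lev X = lev r + 1 :=
    fun X l r h => hlev _ _ h
  have hCG : ∀ p ∈ C, p ∈ G.prods := by simp +contextual [hp]
  have hUG : ∀ p ∈ U, p ∈ G.prods := by simp +contextual [hp]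
  obtain ⟨h1, h2⟩ := hU.pairShape hv hrun hpair hUG (t := 0) (fun x hx => by
    obtain ⟨a, V, -, rfl, hV⟩ := hC.exists_of_mem_right hx
    have h1 := hCG _ (hV (List.mem_singleton_self _))
    exact ⟨hlev _ _ h1, fun y j h2 => by cases hv.deterministic _ _ _ h1 h2⟩)
  have noChar : ∀ X ρ, (X, ρ) ∈ C → ∃ a, ρ = .char a := by
    intro X ρ h
    obtain ⟨a, e, V, -, -, rfl, h, -⟩ := hC.exists_of_mem_prods h
    simp only [List.mem_singleton, Prod.mk.injEq] at h
    exact ⟨a, h.2⟩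
  refine ⟨lev, fun X x k h => ⟨hrun X x k h, ?_⟩, fun X l r h => ?_⟩
  · rw [hp, List.mem_toFinset, List.mem_append] at h
    rcases h with h | h
    · obtain ⟨a, h⟩ := noChar _ _ h
      cases h
    · exact h1 X x k h
  · rw [hp, List.mem_toFinset, List.mem_append] at h
    rcases h with h | h
    · obtain ⟨a, h⟩ := noChar _ _ h
      cases h
    · exact h2 X l r h

/-! ### Derived strings and the bound on exponents -/

/-- The string derived by each variable. -/
structure IsYield (D : Finset Production) (str : ℕ → List ℕ) : Prop where
  char : ∀ X a, (X, Rhs.char a) ∈ D → str X = [a]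
  pair : ∀ X l r, (X, Rhs.pair l r) ∈ D → str X = str l ++ str r
  run : ∀ X x k, (X, Rhs.run x k) ∈ D → str X = (List.replicate k (str x)).flatten

theorem IsValid.exists_isYield {M : ℕ} {D : Finset Production} (hD : IsValid M D) :
    ∃ str, IsYield D str := by
  obtain ⟨str, h⟩ := hD.exists_value (fun a => [a]) (fun u v => u ++ v)
    (fun u k => (List.replicate k u).flatten)
  exact ⟨str, fun X a hX => h _ _ hX, fun X l r hX => h _ _ hX, fun X x k hX => h _ _ hX⟩

section IsYield

variable {M : ℕ} {D : Finset Production} {str : ℕ → List ℕ}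

theorem IsYield.derives (h : IsYield D str) (hD : IsValid M D) {X : ℕ} (hX : X ∈ lhs D) :
    Derives D X (str X) := by
  refine hD.induction (P := fun X => Derives D X (str X)) (fun X ρ hX ih => ?_) hX
  cases ρ with
  | char a => rw [h.char X a hX]; exact .char hX
  | pair l r =>
    rw [h.pair X l r hX]
    exact .pair hX (ih l (by simp [Rhs.vars])) (ih r (by simp [Rhs.vars]))
  | run x k => rw [h.run X x k hX]; exact .run hX (ih x (by simp [Rhs.vars]))

theorem IsYield.length_run (h : IsYield D str) {X x k : ℕ} (hX : (X, Rhs.run x k) ∈ D) :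
    (str X).length = k * (str x).length := by
  rw [h.run X x k hX, List.length_flatten, List.map_replicate, List.sum_replicate, smul_eq_mul]

theorem IsYield.length_pos (h : IsYield D str) (hD : IsValid M D) {X : ℕ} (hX : X ∈ lhs D) :
    0 < (str X).length := by
  refine hD.induction (P := fun X => 0 < (str X).length) (fun X ρ hX ih => ?_) hX
  cases ρ with
  | char a => simp [h.char X a hX]
  | pair l r =>
    have := ih l (by simp [Rhs.vars])
    rw [h.pair X l r hX, List.length_append]
    omega
  | run x k =>
    rw [h.length_run hX]
    exact Nat.mul_pos (hD.run_pos _ _ _ hX) (ih x (by simp [Rhs.vars]))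

theorem IsYield.length_le_of_child (h : IsYield D str) (hD : IsValid M D) {X Y : ℕ}
    (hXY : Child D X Y) : (str Y).length ≤ (str X).length := by
  obtain ⟨ρ, hX, hY⟩ := hXY
  cases ρ with
  | char a => simp [Rhs.vars] at hY
  | pair l r =>
    rw [h.pair X l r hX, List.length_append]
    simp only [Rhs.vars, Finset.mem_insert, Finset.mem_singleton] at hY
    rcases hY with rfl | rfl <;> omega
  | run x k =>
    simp only [Rhs.vars, Finset.mem_singleton] at hY
    subst hY
    rw [h.length_run hX]
    exact Nat.le_mul_of_pos_left _ (hD.run_pos _ _ _ hX)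

theorem IsYield.length_le {f : List ℕ → Bool} {T : List ℕ} {G : Grammar}
    (hG : IsSignatureEncoding M f T G) (h : IsYield G.prods str) {X : ℕ}
    (hX : X ∈ lhs G.prods) : (str X).length ≤ T.length := by
  have hv := hG.isValid
  have h1 := hG.rlslp.useful X hX
  have h2 := hG.rlslp.derives.unique hv.deterministic (h.derives hv hG.rlslp.start_mem)
  rw [h2]
  clear hX
  induction h1 with
  | refl => exact le_rfl
  | tail _ h3 ih => exact (h.length_le_of_child hv h3).trans ih

end IsYield

theorem IsSignatureEncoding.exponent_le {M : ℕ} {f : List ℕ → Bool} {T : List ℕ} {G : Grammar}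
    (hG : IsSignatureEncoding M f T G) {X x k : ℕ} (hX : (X, Rhs.run x k) ∈ G.prods) :
    k ≤ T.length := by
  have hv := hG.isValid
  obtain ⟨str, h⟩ := hv.exists_isYield
  have h1 := h.length_le hG (mem_lhs.2 ⟨_, hX⟩)
  rw [h.length_run hX] at h1
  have h2 := h.length_pos hv (hv.vars_mem hX x (by simp [Rhs.vars]))
  exact (Nat.le_mul_of_pos_right k h2).trans h1

/-! ## Binary powers -/

/-- `x ^ (a + b)` is formed from `x ^ a` and `x ^ b` in the binary expansion of `x ^ k`. -/
def PowStep (k a b : ℕ) : Prop :=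
  (∃ j < Nat.log 2 k, a = 2 ^ j ∧ b = 2 ^ j) ∨
    ∃ i < Nat.log 2 k, k.testBit i = true ∧ a = k / 2 ^ (i + 1) * 2 ^ (i + 1) ∧ b = 2 ^ i

/-- Cutting off the digits below `i` instead of those below `i + 1` adds just the digit `i`.
Iterating this assembles `k` from its highest digit. -/
theorem div_pow_mul_pow (k i : ℕ) :
    k / 2 ^ i * 2 ^ i = k / 2 ^ (i + 1) * 2 ^ (i + 1) + if k.testBit i then 2 ^ i else 0 := by
  have h1 : k / 2 ^ (i + 1) = k / 2 ^ i / 2 := by rw [pow_succ, Nat.div_div_eq_div_mul]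
  have h2 : k.testBit i = decide (k / 2 ^ i % 2 = 1) := by
    rw [Nat.testBit_eq_decide_div_mod_eq]
  rw [h1, h2, pow_succ]
  generalize k / 2 ^ i = c
  generalize 2 ^ i = d
  have h3 := Nat.div_add_mod c 2
  rcases Nat.mod_two_eq_zero_or_one c with h | h
  · simp only [h, zero_ne_one, decide_false, Bool.false_eq_true, if_false, add_zero]
    rw [h, add_zero] at h3
    nth_rewrite 1 [← h3]
    ring
  · simp only [h, decide_true, if_true]
    rw [h] at h3
    nth_rewrite 1 [← h3]
    ring

theorem one_le_div_pow {k i : ℕ} (hi : i ≤ Nat.log 2 k) (hk : k ≠ 0) : 1 ≤ k / 2 ^ i :=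
  (Nat.one_le_div_iff (by positivity)).2
    ((Nat.pow_le_pow_right (by norm_num) hi).trans (Nat.pow_log_le_self 2 hk))

theorem div_pow_log {k : ℕ} (hk : k ≠ 0) : k / 2 ^ Nat.log 2 k = 1 := by
  apply le_antisymm _ (one_le_div_pow le_rfl hk)
  have := Nat.lt_pow_succ_log_self (b := 2) (by norm_num) k
  rw [pow_succ] at this
  exact Nat.le_of_lt_succ (Nat.div_lt_of_lt_mul this)

theorem PowStep.normalForm {k a b : ℕ} (h : PowStep k a b) :
    ∃ i, (b = 2 ^ i ∧ a = 2 ^ i) ∨ (b = 2 ^ i ∧ ∃ c, 1 ≤ c ∧ a = c * 2 ^ (i + 1)) := by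
  rcases h with ⟨j, -, ha, hb⟩ | ⟨i, hi, -, ha, hb⟩
  · exact ⟨j, Or.inl ⟨hb, ha⟩⟩
  · exact ⟨i, Or.inr ⟨hb, _, one_le_div_pow hi (by rintro rfl; simp at hi), ha⟩⟩

theorem PowStep.pos {k a b : ℕ} (h : PowStep k a b) : 0 < a ∧ 0 < b := by
  obtain ⟨i, ⟨rfl, rfl⟩ | ⟨rfl, c, hc, rfl⟩⟩ := h.normalForm
  · constructor <;> positivity
  · constructor <;> positivity

theorem PowStep.le {k a b : ℕ} (h : PowStep k a b) : a + b ≤ k := by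
  rcases h with ⟨j, hj, rfl, rfl⟩ | ⟨i, hi, ht, rfl, rfl⟩
  · have h1 : 2 ^ (j + 1) ≤ 2 ^ Nat.log 2 k := Nat.pow_le_pow_right (by norm_num) hj
    have h2 := Nat.pow_log_le_self 2 (x := k) (by rintro rfl; simp at hj)
    rw [pow_succ] at h1
    omega
  · have h1 := div_pow_mul_pow k i
    rw [if_pos ht] at h1
    rw [← h1]
    exact Nat.div_mul_le_self k _

theorem pow_mul_odd_unique {i j c d : ℕ} (h : 2 ^ i * (2 * c + 1) = 2 ^ j * (2 * d + 1)) :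
    i = j ∧ c = d := by
  have key : ∀ {i j c d : ℕ}, 2 ^ i * (2 * c + 1) = 2 ^ j * (2 * d + 1) → i ≤ j → i = j := by
    intro i j c d h hij
    by_contra hne
    obtain ⟨m, rfl⟩ := Nat.exists_eq_add_of_lt (lt_of_le_of_ne hij hne)
    rw [show i + m + 1 = i + (m + 1) by ring, pow_add, mul_assoc] at h
    have h1 := Nat.eq_of_mul_eq_mul_left (by positivity) h
    rw [pow_succ, mul_comm (2 ^ m), mul_assoc] at h1
    omega
  have hij : i = j := by
    rcases le_total i j with h1 | h1
    · exact key h h1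
    · exact (key h.symm h1).symm
  subst hij
  have h1 := Nat.eq_of_mul_eq_mul_left (by positivity) h
  exact ⟨rfl, by omega⟩

/-- The decomposition of an exponent does not depend on the run rule. -/
theorem PowStep.unique {k a b k' a' b' : ℕ} (h : PowStep k a b) (h' : PowStep k' a' b')
    (e : a + b = a' + b') : a = a' ∧ b = b' := by
  -- A doubling sums to a power of two, any other step to `2 ^ i` times an odd number that is at
  -- least `3`. So the sum reveals the kind of step and both summands.
  have e1 : ∀ i, 2 ^ i + 2 ^ i = 2 ^ (i + 1) * (2 * 0 + 1) := fun i => by ring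
  have e2 : ∀ i c, c * 2 ^ (i + 1) + 2 ^ i = 2 ^ i * (2 * c + 1) := fun i c => by ring
  obtain ⟨i, ⟨rfl, rfl⟩ | ⟨rfl, c, hc, rfl⟩⟩ := h.normalForm <;>
    obtain ⟨j, ⟨rfl, rfl⟩ | ⟨rfl, d, hd, rfl⟩⟩ := h'.normalForm
  · rw [e1, e1] at e
    obtain ⟨h1, -⟩ := pow_mul_odd_unique e
    rw [Nat.succ_injective h1]
    exact ⟨rfl, rfl⟩
  · rw [e1, e2] at e
    obtain ⟨-, h1⟩ := pow_mul_odd_unique e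
    omega
  · rw [e1, e2] at e
    obtain ⟨-, h1⟩ := pow_mul_odd_unique e
    omega
  · rw [e2, e2] at e
    obtain ⟨rfl, rfl⟩ := pow_mul_odd_unique e
    exact ⟨rfl, rfl⟩

/-- Build up the exponents of the binary expansion of `k` from `1`. -/
theorem PowStep.induction {k : ℕ} (hk : k ≠ 0) {P : ℕ → Prop} (one : P 1)
    (step : ∀ a b, PowStep k a b → P a → P b → P (a + b)) :
    (∀ a b, PowStep k a b → P a ∧ P b) ∧ P k := by
  have h1 : ∀ j ≤ Nat.log 2 k, P (2 ^ j) := by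
    intro j
    induction j with
    | zero => exact fun _ => one
    | succ j ih =>
      intro hj
      rw [pow_succ, mul_two]
      exact step _ _ (Or.inl ⟨j, hj, rfl, rfl⟩) (ih (by omega)) (ih (by omega))
  have h2 : ∀ i ≤ Nat.log 2 k, P (k / 2 ^ i * 2 ^ i) := by
    intro i hi
    induction hi using Nat.decreasingInduction with
    | self =>
      rw [div_pow_log hk, one_mul]
      exact h1 _ le_rfl
    | of_succ i hi ih =>
      rw [div_pow_mul_pow]
      split_ifs with h
      · exact step _ _ (Or.inr ⟨i, hi, h, rfl, rfl⟩) ih (h1 i hi.le)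
      · simpa using ih
  refine ⟨?_, by simpa using h2 0 (by omega)⟩
  rintro a b (⟨j, hj, rfl, rfl⟩ | ⟨i, hi, -, rfl, rfl⟩)
  · exact ⟨h1 j hj.le, h1 j hj.le⟩
  · exact ⟨h2 _ hi, h1 i hi.le⟩

/-- Break up `k` into the exponents of its binary expansion. -/
theorem PowStep.induction_down {k : ℕ} (hk : k ≠ 0) {P : ℕ → Prop} (top : P k)
    (step : ∀ a b, PowStep k a b → P (a + b) → P a ∧ P b) :
    (∀ a b, PowStep k a b → P (a + b)) ∧ P 1 := by
  have h2 : ∀ i ≤ Nat.log 2 k, P (k / 2 ^ i * 2 ^ i) := by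
    intro i
    induction i with
    | zero => simpa using top
    | succ i ih =>
      intro hi
      have h1 := ih (by omega)
      rw [div_pow_mul_pow] at h1
      split_ifs at h1 with h
      · exact (step _ _ (Or.inr ⟨i, hi, h, rfl, rfl⟩) h1).1
      · simpa using h1
  have h1 : ∀ j ≤ Nat.log 2 k, P (2 ^ j) := by
    intro j hj
    induction hj using Nat.decreasingInduction with
    | self => simpa [div_pow_log hk] using h2 _ le_rfl
    | of_succ j hj ih =>
      rw [pow_succ, mul_two] at ih
      exact (step _ _ (Or.inl ⟨j, hj, rfl, rfl⟩) ih).1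
  refine ⟨?_, by simpa using h1 0 (by omega)⟩
  rintro a b (⟨j, hj, rfl, rfl⟩ | ⟨i, hi, h, rfl, rfl⟩)
  · rw [← mul_two, ← pow_succ]
    exact h1 _ hj
  · have h3 := h2 i hi.le
    rwa [div_pow_mul_pow, if_pos h] at h3

theorem powVar_one (M x : ℕ) : powVar M x 1 = x := by simp [powVar]

/-- Division by `M + 1` decodes a name into base and exponent. It yields injectivity, and it later
allows a rank to be defined on names alone. -/
theorem powVar_mod_div {M x m : ℕ} (hx : x ≤ M) :
    powVar M x m % (M + 1) = x ∧ powVar M x m / (M + 1) = m - 1 := by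
  unfold powVar
  constructor
  · rw [Nat.mul_comm, Nat.mul_add_mod, Nat.mod_eq_of_lt (by omega)]
  · rw [Nat.mul_comm, Nat.mul_add_div (by omega), Nat.div_eq_of_lt (by omega), add_zero]

theorem powVar_inj {M x m x' m' : ℕ} (hx : x ≤ M) (hx' : x' ≤ M) (hm : 0 < m) (hm' : 0 < m')
    (h : powVar M x m = powVar M x' m') : x = x' ∧ m = m' := by
  have h1 := powVar_mod_div (m := m) hx
  have h2 := powVar_mod_div (m := m') hx'
  rw [h] at h1
  exact ⟨h1.1.symm.trans h2.1, by omega⟩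

theorem lt_powVar {M x m : ℕ} (hm : 2 ≤ m) : M < powVar M x m := by
  unfold powVar
  have : 1 * (M + 1) ≤ (m - 1) * (M + 1) := Nat.mul_le_mul_right _ (by omega)
  omega

/-! ## The straight-line program of a signature encoding -/

theorem repr_of_run {M : ℕ} {D : Finset Production} (hD : IsValid M D) {e x k : ℕ}
    (h : (e, Rhs.run x k) ∈ D) : repr M D e = powVar M x k := by
  have h1 : ∃ q : ℕ × ℕ, (e, Rhs.run q.1 q.2) ∈ D := ⟨(x, k), h⟩
  have h2 := hD.deterministic _ _ _ h1.choose_spec h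
  simp only [Rhs.run.injEq] at h2
  rw [repr, dif_pos h1, h2.1, h2.2]

theorem repr_of_forall {M : ℕ} {D : Finset Production} {e : ℕ}
    (h : ∀ x k, (e, Rhs.run x k) ∉ D) : repr M D e = e := by
  rw [repr, dif_neg]
  rintro ⟨q, hq⟩
  exact h _ _ hq

/-- Removing a digit `1` at `i` from the truncation at `i` gives the truncation at `i + 1`, so
doublings and concatenations take the common form `a + b`. -/
theorem mem_expand_run {M : ℕ} {D : Finset Production} {e x k : ℕ} {q : Production} :
    q ∈ expand M D (e, .run x k) ↔ ∃ a b, PowStep k a b ∧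
      q = (powVar M x (a + b), .pair (powVar M x a) (powVar M x b)) := by
  simp only [expand, doublings, concatenations, Finset.mem_union, Finset.mem_image,
    Finset.mem_range, Finset.mem_filter, PowStep]
  constructor
  · rintro (⟨j, hj, rfl⟩ | ⟨i, ⟨hi, ht⟩, rfl⟩)
    · exact ⟨_, _, Or.inl ⟨j, hj, rfl, rfl⟩, by rw [pow_succ, mul_two]⟩
    · refine ⟨_, _, Or.inr ⟨i, hi, ht, rfl, rfl⟩, ?_⟩
      have h := div_pow_mul_pow k i
      rw [if_pos ht] at h
      rw [h, Nat.add_sub_cancel]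
  · rintro ⟨a, b, ⟨j, hj, rfl, rfl⟩ | ⟨i, hi, ht, rfl, rfl⟩, rfl⟩
    · exact Or.inl ⟨j, hj, by rw [pow_succ, mul_two]⟩
    · refine Or.inr ⟨i, ⟨hi, ht⟩, ?_⟩
      have h := div_pow_mul_pow k i
      rw [if_pos ht] at h
      rw [h, Nat.add_sub_cancel]

theorem mem_expand_char {M : ℕ} {D : Finset Production} {e a : ℕ} {q : Production} :
    q ∈ expand M D (e, .char a) ↔ q = (e, .char a) := by
  simp [expand]

theorem mem_expand_pair {M : ℕ} {D : Finset Production} {e l r : ℕ} {q : Production} :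
    q ∈ expand M D (e, .pair l r) ↔ q = (e, .pair (repr M D l) (repr M D r)) := by
  simp [expand]

theorem mem_toSLP {M : ℕ} {G : Grammar} {q : Production} : q ∈ (G.toSLP M).prods ↔
    (∃ e a, (e, Rhs.char a) ∈ G.prods ∧ q = (e, .char a)) ∨
    (∃ e l r, (e, Rhs.pair l r) ∈ G.prods ∧
      q = (e, .pair (repr M G.prods l) (repr M G.prods r))) ∨
    ∃ e x k a b, (e, Rhs.run x k) ∈ G.prods ∧ PowStep k a b ∧
      q = (powVar M x (a + b), .pair (powVar M x a) (powVar M x b)) := by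
  unfold Grammar.toSLP
  rw [Finset.mem_biUnion]
  constructor
  · rintro ⟨⟨e, ρ⟩, hp, hq⟩
    cases ρ with
    | char a => exact Or.inl ⟨e, a, hp, mem_expand_char.1 hq⟩
    | pair l r => exact Or.inr (Or.inl ⟨e, l, r, hp, mem_expand_pair.1 hq⟩)
    | run x k =>
      obtain ⟨a, b, h1, h2⟩ := mem_expand_run.1 hq
      exact Or.inr (Or.inr ⟨e, x, k, a, b, hp, h1, h2⟩)
  · rintro (⟨e, a, hp, h⟩ | ⟨e, l, r, hp, h⟩ | ⟨e, x, k, a, b, hp, h1, h2⟩)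
    · exact ⟨_, hp, mem_expand_char.2 h⟩
    · exact ⟨_, hp, mem_expand_pair.2 h⟩
    · exact ⟨_, hp, mem_expand_run.2 ⟨a, b, h1, h2⟩⟩

section SLP

variable {M : ℕ} {f : List ℕ → Bool} {T : List ℕ} {G : Grammar}

theorem IsSignatureEncoding.not_run_of_base (hG : IsSignatureEncoding M f T G) {e x k : ℕ}
    (h : (e, Rhs.run x k) ∈ G.prods) : ∀ y j, (x, Rhs.run y j) ∉ G.prods := by
  obtain ⟨lev, hl⟩ := hG.exists_isLevel
  exact (hl.run _ _ _ h).2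

theorem IsSignatureEncoding.base_bounds (hG : IsSignatureEncoding M f T G) {e x k : ℕ}
    (h : (e, Rhs.run x k) ∈ G.prods) : 1 ≤ x ∧ x ≤ M :=
  hG.isValid.mem_bounds (hG.isValid.vars_mem h x (by simp [Rhs.vars]))

theorem IsSignatureEncoding.repr_of_pair (hG : IsSignatureEncoding M f T G) {e l r : ℕ}
    (h : (e, Rhs.pair l r) ∈ G.prods) : repr M G.prods e = e :=
  repr_of_forall fun _ _ h' => by cases hG.isValid.deterministic _ _ _ h h'

theorem IsSignatureEncoding.repr_of_char (hG : IsSignatureEncoding M f T G) {e a : ℕ}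
    (h : (e, Rhs.char a) ∈ G.prods) : repr M G.prods e = e :=
  repr_of_forall fun _ _ h' => by cases hG.isValid.deterministic _ _ _ h h'

/-- A left-hand side above `M` belongs to a power, and its name reveals base and exponent, which fix
the production whichever run rule it comes from. Left-hand sides up to `M` inherit determinism from
`G`. -/
theorem toSLP_deterministic (hG : IsSignatureEncoding M f T G) {X : ℕ} {e e' : Rhs}
    (h : (X, e) ∈ (G.toSLP M).prods) (h' : (X, e') ∈ (G.toSLP M).prods) : e = e' := by
  have hv := hG.isValid
  have hpow : ∀ {x a b k : ℕ} {ρ : Rhs}, (powVar M x (a + b), ρ) ∈ G.prods → PowStep k a b →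
      False := fun {x a b k ρ} h1 h2 => by
    have h3 := (hv.bounds _ h1).2
    have h4 := h2.pos
    have h5 := lt_powVar (M := M) (x := x) (m := a + b) (by omega)
    dsimp only at h3
    omega
  rw [mem_toSLP] at h h'
  rcases h with ⟨e, a, h, hq⟩ | ⟨e, l, r, h, hq⟩ | ⟨e, x, k, a, b, h, hs, hq⟩ <;>
  rcases h' with ⟨e', a', h', hq'⟩ | ⟨e', l', r', h', hq'⟩ | ⟨e', x', k', a', b', h', hs', hq'⟩ <;>
  simp only [Prod.mk.injEq] at hq hq' <;> obtain ⟨rfl, rfl⟩ := hq <;> obtain ⟨h1, rfl⟩ := hq'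
  · subst h1
    exact hv.deterministic _ _ _ h h'
  · subst h1
    cases hv.deterministic _ _ _ h h'
  · exact (hpow (h1 ▸ h) hs').elim
  · subst h1
    cases hv.deterministic _ _ _ h h'
  · subst h1
    cases hv.deterministic _ _ _ h h'
    rfl
  · exact (hpow (h1 ▸ h) hs').elim
  · exact (hpow (h1 ▸ h') hs).elim
  · exact (hpow (h1 ▸ h') hs).elim
  · have := hs.pos
    have := hs'.pos
    obtain ⟨rfl, h2⟩ := powVar_inj (hG.base_bounds h).2 (hG.base_bounds h').2 (by omega) (by omega)
      h1
    obtain ⟨rfl, rfl⟩ := hs.unique hs' h2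
    rfl

theorem toSLP_nonredundant (hG : IsSignatureEncoding M f T G) {X Y : ℕ} {e : Rhs}
    (h : (X, e) ∈ (G.toSLP M).prods) (h' : (Y, e) ∈ (G.toSLP M).prods) : X = Y := by
  have hv := hG.isValid
  obtain ⟨lev, hl⟩ := hG.exists_isLevel
  -- A pair of `G` never coincides with a step inside a power, where both components have the same
  -- base `x`: a run on the left has another base, and a pair on the left, read as `l ^ 1`, lies one
  -- level above `x`.
  have pair_pow : ∀ {e l r e' x k a b}, (e, Rhs.pair l r) ∈ G.prods →
      (e', Rhs.run x k) ∈ G.prods → PowStep k a b → repr M G.prods l = powVar M x a →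
      repr M G.prods r = powVar M x b → False := by
    intro e l r e' x k a b h1 h2 h3 h4 h5
    obtain ⟨x', k', h6, h7⟩ := hl.pair _ _ _ h1
    have hx := (hG.base_bounds h2).2
    rw [repr_of_run hv h6] at h5
    obtain ⟨rfl, rfl⟩ := powVar_inj (hG.base_bounds h6).2 hx (hv.run_pos _ _ _ h6) h3.pos.2 h5
    rcases h7 with ⟨y, j, h8, h9, -⟩ | ⟨⟨l', r', h8⟩, h9⟩
    · rw [repr_of_run hv h8] at h4
      exact h9 (powVar_inj (hG.base_bounds h8).2 hx (hv.run_pos _ _ _ h8) h3.pos.1 h4).1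
    · rw [hG.repr_of_pair h8, ← powVar_one M l] at h4
      obtain ⟨rfl, -⟩ := powVar_inj (hv.mem_bounds (mem_lhs.2 ⟨_, h8⟩)).2 hx one_pos h3.pos.1 h4
      have h10 := (hl.run _ _ _ h6).1
      omega
  -- A run and a pair that can precede the same `r` have different representatives: equality would
  -- force exponent `1` and make the pair the base of the run, but their levels differ by one.
  have run_pair : ∀ {l r l' r' x k}, (l, Rhs.run x k) ∈ G.prods → lev l = lev r →
      (l', Rhs.pair r r') ∈ G.prods ∨ (∃ s t, (l', Rhs.pair s t) ∈ G.prods) →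
      lev l' = lev r + 1 → repr M G.prods l = repr M G.prods l' → False := by
    intro l r l' r' x k h1 h2 h3 h4 h5
    obtain ⟨s, t, h3⟩ : ∃ s t, (l', Rhs.pair s t) ∈ G.prods := by
      rcases h3 with h3 | h3
      · exact ⟨_, _, h3⟩
      · exact h3
    rw [repr_of_run hv h1, hG.repr_of_pair h3, ← powVar_one M l'] at h5
    obtain ⟨rfl, -⟩ := powVar_inj (hG.base_bounds h1).2
      (hv.mem_bounds (mem_lhs.2 ⟨_, h3⟩)).2 (hv.run_pos _ _ _ h1) one_pos h5
    have h6 := (hl.run _ _ _ h1).1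
    omega
  rw [mem_toSLP] at h h'
  rcases h with ⟨e, a, h, hq⟩ | ⟨e, l, r, h, hq⟩ | ⟨e, x, k, a, b, h, hs, hq⟩ <;>
  rcases h' with ⟨e', a', h', hq'⟩ | ⟨e', l', r', h', hq'⟩ | ⟨e', x', k', a', b', h', hs', hq'⟩ <;>
  simp only [Prod.mk.injEq] at hq hq' <;> obtain ⟨rfl, rfl⟩ := hq <;> obtain ⟨rfl, h1⟩ := hq' <;>
  simp only [Rhs.char.injEq, Rhs.pair.injEq, reduceCtorEq] at h1
  · subst h1
    exact hv.nonredundant _ _ _ h h'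
  · obtain ⟨h1, h2⟩ := h1
    obtain ⟨x, k, hr, hlr⟩ := hl.pair _ _ _ h
    obtain ⟨x', k', hr', hlr'⟩ := hl.pair _ _ _ h'
    rw [repr_of_run hv hr, repr_of_run hv hr'] at h2
    obtain ⟨rfl, rfl⟩ := powVar_inj (hG.base_bounds hr).2 (hG.base_bounds hr').2
      (hv.run_pos _ _ _ hr) (hv.run_pos _ _ _ hr') h2
    obtain rfl := hv.nonredundant _ _ _ hr hr'
    have : l = l' := by
      rcases hlr with ⟨y, j, h3, -, h4⟩ | ⟨⟨s, t, h3⟩, h4⟩ <;>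
        rcases hlr' with ⟨y', j', h3', -, h4'⟩ | ⟨⟨s', t', h3'⟩, h4'⟩
      · rw [repr_of_run hv h3, repr_of_run hv h3'] at h1
        obtain ⟨rfl, rfl⟩ := powVar_inj (hG.base_bounds h3).2 (hG.base_bounds h3').2
          (hv.run_pos _ _ _ h3) (hv.run_pos _ _ _ h3') h1
        exact hv.nonredundant _ _ _ h3 h3'
      · exact (run_pair (r' := 0) h3 h4 (Or.inr ⟨_, _, h3'⟩) h4' h1).elim
      · exact (run_pair (r' := 0) h3' h4' (Or.inr ⟨_, _, h3⟩) h4 h1.symm).elim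
      · rwa [hG.repr_of_pair h3, hG.repr_of_pair h3'] at h1
    subst this
    exact hv.nonredundant _ _ _ h h'
  · exact (pair_pow h h' hs' h1.1 h1.2).elim
  · exact (pair_pow h' h hs h1.1.symm h1.2.symm).elim
  · have h2 := hs.pos
    have h3 := hs'.pos
    obtain ⟨rfl, rfl⟩ := powVar_inj (hG.base_bounds h).2 (hG.base_bounds h').2 h2.1 h3.1 h1.1
    rw [(powVar_inj (hG.base_bounds h).2 (hG.base_bounds h').2 h2.2 h3.2 h1.2).2]

theorem base_mem_toSLP {e : ℕ} (he : e ∈ lhs G.prods)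
    (hr : ∀ x k, (e, Rhs.run x k) ∉ G.prods) : e ∈ lhs (G.toSLP M).prods := by
  obtain ⟨ρ, h⟩ := mem_lhs.1 he
  cases ρ with
  | char a => exact mem_lhs.2 ⟨_, mem_toSLP.2 (Or.inl ⟨_, _, h, rfl⟩)⟩
  | pair l r => exact mem_lhs.2 ⟨_, mem_toSLP.2 (Or.inr (Or.inl ⟨_, _, _, h, rfl⟩))⟩
  | run x k => exact absurd h (hr x k)

theorem powVar_mem_toSLP (hG : IsSignatureEncoding M f T G) {e x k : ℕ}
    (h : (e, Rhs.run x k) ∈ G.prods) :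
    (∀ a b, PowStep k a b → powVar M x a ∈ lhs (G.toSLP M).prods ∧
      powVar M x b ∈ lhs (G.toSLP M).prods) ∧ powVar M x k ∈ lhs (G.toSLP M).prods := by
  refine PowStep.induction (P := fun m => powVar M x m ∈ lhs (G.toSLP M).prods)
    (hG.isValid.run_pos _ _ _ h).ne' ?_ ?_
  · rw [powVar_one]
    exact base_mem_toSLP (hG.isValid.vars_mem h x (by simp [Rhs.vars])) (hG.not_run_of_base h)
  · intro a b hab _ _
    exact mem_lhs.2 ⟨_, mem_toSLP.2 (Or.inr (Or.inr ⟨e, x, k, a, b, h, hab, rfl⟩))⟩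

theorem repr_mem_toSLP (hG : IsSignatureEncoding M f T G) {e : ℕ} (he : e ∈ lhs G.prods) :
    repr M G.prods e ∈ lhs (G.toSLP M).prods := by
  by_cases h : ∃ x k, (e, Rhs.run x k) ∈ G.prods
  · obtain ⟨x, k, h⟩ := h
    rw [repr_of_run hG.isValid h]
    exact (powVar_mem_toSLP hG h).2
  · push Not at h
    rw [repr_of_forall h]
    exact base_mem_toSLP he h

theorem toSLP_derives_pow (hG : IsSignatureEncoding M f T G) {e x k : ℕ} {u : List ℕ}
    (h : (e, Rhs.run x k) ∈ G.prods) (hx : Derives (G.toSLP M).prods x u) :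
    Derives (G.toSLP M).prods (powVar M x k) (List.replicate k u).flatten := by
  refine (PowStep.induction
    (P := fun m => Derives (G.toSLP M).prods (powVar M x m) (List.replicate m u).flatten)
    (hG.isValid.run_pos _ _ _ h).ne' ?_ ?_).2
  · rw [powVar_one]
    simpa using hx
  · intro a b hab ha hb
    rw [← List.replicate_append_replicate, List.flatten_append]
    exact .pair (mem_toSLP.2 (Or.inr (Or.inr ⟨e, x, k, a, b, h, hab, rfl⟩))) ha hb

theorem toSLP_derives (hG : IsSignatureEncoding M f T G) {str : ℕ → List ℕ}
    (hs : IsYield G.prods str) {X : ℕ} (hX : X ∈ lhs G.prods) :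
    Derives (G.toSLP M).prods (repr M G.prods X) (str X) := by
  have hv := hG.isValid
  refine hv.induction (P := fun X => Derives (G.toSLP M).prods (repr M G.prods X) (str X))
    (fun X ρ hX ih => ?_) hX
  cases ρ with
  | char a =>
    rw [hG.repr_of_char hX, hs.char X a hX]
    exact .char (mem_toSLP.2 (Or.inl ⟨_, _, hX, rfl⟩))
  | pair l r =>
    rw [hG.repr_of_pair hX, hs.pair X l r hX]
    exact .pair (mem_toSLP.2 (Or.inr (Or.inl ⟨_, _, _, hX, rfl⟩)))
      (ih l (by simp [Rhs.vars])) (ih r (by simp [Rhs.vars]))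
  | run x k =>
    rw [repr_of_run hv hX, hs.run X x k hX]
    have := ih x (by simp [Rhs.vars])
    rw [repr_of_forall (hG.not_run_of_base hX)] at this
    exact toSLP_derives_pow hG hX this

theorem toSLP_reach_pow (hG : IsSignatureEncoding M f T G) {e x k s : ℕ}
    (h : (e, Rhs.run x k) ∈ G.prods)
    (hs : Relation.ReflTransGen (Child (G.toSLP M).prods) s (powVar M x k)) :
    (∀ a b, PowStep k a b →
      Relation.ReflTransGen (Child (G.toSLP M).prods) s (powVar M x (a + b))) ∧
      Relation.ReflTransGen (Child (G.toSLP M).prods) s x := by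
  have := PowStep.induction_down
    (P := fun m => Relation.ReflTransGen (Child (G.toSLP M).prods) s (powVar M x m))
    (hG.isValid.run_pos _ _ _ h).ne' hs (fun a b hab hP => by
      have h1 : (powVar M x (a + b), Rhs.pair (powVar M x a) (powVar M x b)) ∈
          (G.toSLP M).prods := mem_toSLP.2 (Or.inr (Or.inr ⟨e, x, k, a, b, h, hab, rfl⟩))
      exact ⟨hP.tail ⟨_, h1, by simp [Rhs.vars]⟩, hP.tail ⟨_, h1, by simp [Rhs.vars]⟩⟩)
  rwa [powVar_one] at this

theorem toSLP_reach (hG : IsSignatureEncoding M f T G) {X : ℕ}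
    (hX : Relation.ReflTransGen (Child G.prods) G.start X) :
    Relation.ReflTransGen (Child (G.toSLP M).prods) (repr M G.prods G.start)
      (repr M G.prods X) := by
  induction hX with
  | refl => exact .refl
  | @tail X Y _ h ih =>
    obtain ⟨ρ, hρ, hY⟩ := h
    cases ρ with
    | char a => simp [Rhs.vars] at hY
    | pair l r =>
      rw [hG.repr_of_pair hρ] at ih
      refine ih.tail ⟨_, mem_toSLP.2 (Or.inr (Or.inl ⟨_, _, _, hρ, rfl⟩)), ?_⟩
      simp only [Rhs.vars, Finset.mem_insert, Finset.mem_singleton] at hY ⊢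
      rcases hY with rfl | rfl
      · exact Or.inl rfl
      · exact Or.inr rfl
    | run x k =>
      simp only [Rhs.vars, Finset.mem_singleton] at hY
      subst hY
      rw [repr_of_run hG.isValid hρ] at ih
      rw [repr_of_forall (hG.not_run_of_base hρ)]
      exact (toSLP_reach_pow hG hρ ih).2

/-- The binary expansion of a signature encoding is a straight-line program for the same
string. -/
theorem IsSignatureEncoding.isSLP_toSLP (hG : IsSignatureEncoding M f T G) :
    IsSLP (G.toSLP M) T := by
  have hv := hG.isValid
  obtain ⟨str, hs⟩ := hv.exists_isYield
  -- The rank used for acyclicity is the length of the derived string, computed from the name by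
  -- decoding base and exponent. It drops strictly in every pair because derived strings are
  -- nonempty.
  have hlen : ∀ {x m}, 1 ≤ x ∧ x ≤ M → 0 < m →
      (powVar M x m / (M + 1) + 1) * (str (powVar M x m % (M + 1))).length =
        m * (str x).length := by
    intro x m hx hm
    obtain ⟨h1, h2⟩ := powVar_mod_div (m := m) hx.2
    rw [h1, h2, Nat.sub_add_cancel hm]
  have hlen' : ∀ {X}, X ∈ lhs G.prods →
      (X / (M + 1) + 1) * (str (X % (M + 1))).length = (str X).length := by
    intro X hX
    have := hlen (hv.mem_bounds hX) one_pos
    rwa [powVar_one, one_mul] at this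
  have hlenr : ∀ {X}, X ∈ lhs G.prods →
      (repr M G.prods X / (M + 1) + 1) * (str (repr M G.prods X % (M + 1))).length =
        (str X).length := by
    intro X hX
    by_cases h : ∃ x k, (X, Rhs.run x k) ∈ G.prods
    · obtain ⟨x, k, h⟩ := h
      rw [repr_of_run hv h, hlen (hG.base_bounds h) (hv.run_pos _ _ _ h), hs.length_run h]
    · push Not at h
      rw [repr_of_forall h, hlen' hX]
  refine ⟨⟨?_, fun _ _ _ => toSLP_deterministic hG, ?_, ?_, fun _ _ _ => toSLP_nonredundant hG,
    repr_mem_toSLP hG hG.rlslp.start_mem, ?_, ?_⟩, ?_⟩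
  · intro X hX
    obtain ⟨ρ, h₀⟩ := mem_lhs.1 hX
    rcases mem_toSLP.1 h₀ with ⟨e, a, h, hq⟩ | ⟨e, l, r, h, hq⟩ | ⟨e, x, k, a, b, h, hs, hq⟩
    · cases hq
      exact (hv.bounds _ h).1
    · cases hq
      exact (hv.bounds _ h).1
    · cases hq
      have := (hG.base_bounds h).1
      unfold powVar
      omega
  · refine ⟨fun X => (X / (M + 1) + 1) * (str (X % (M + 1))).length, ?_⟩
    rintro X Y ⟨ρ, h₀, hY⟩
    dsimp only
    rcases mem_toSLP.1 h₀ with ⟨e, a, h, hq⟩ | ⟨e, l, r, h, hq⟩ | ⟨e, x, k, a, b, h, hab, hq⟩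
    · cases hq
      simp [Rhs.vars] at hY
    · cases hq
      have hl := hv.vars_mem h l (by simp [Rhs.vars])
      have hr := hv.vars_mem h r (by simp [Rhs.vars])
      have h1 := hs.length_pos hv hl
      have h2 := hs.length_pos hv hr
      have h3 := congrArg List.length (hs.pair _ _ _ h)
      rw [List.length_append] at h3
      rw [hlen' (mem_lhs.2 ⟨_, h⟩)]
      simp only [Rhs.vars, Finset.mem_insert, Finset.mem_singleton] at hY
      rcases hY with rfl | rfl
      · rw [hlenr hl]
        exact ⟨repr_mem_toSLP hG hl, by omega⟩
      · rw [hlenr hr]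
        exact ⟨repr_mem_toSLP hG hr, by omega⟩
    · cases hq
      have h1 := hab.pos
      have h2 := hG.base_bounds h
      have h3 := hs.length_pos hv (hv.vars_mem h x (by simp [Rhs.vars]))
      obtain ⟨h4, h5⟩ := (powVar_mem_toSLP hG h).1 a b hab
      rw [hlen h2 (by omega)]
      simp only [Rhs.vars, Finset.mem_insert, Finset.mem_singleton] at hY
      rcases hY with rfl | rfl
      · rw [hlen h2 h1.1]
        exact ⟨h4, Nat.mul_lt_mul_of_pos_right (by omega) h3⟩
      · rw [hlen h2 h1.2]
        exact ⟨h5, Nat.mul_lt_mul_of_pos_right (by omega) h3⟩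
  · intro X x k h
    rcases mem_toSLP.1 h with ⟨_, _, _, hq⟩ | ⟨_, _, _, _, hq⟩ | ⟨_, _, _, _, _, _, _, hq⟩ <;>
      cases hq
  · intro X hX
    change Relation.ReflTransGen _ (repr M G.prods G.start) X
    obtain ⟨ρ, h₀⟩ := mem_lhs.1 hX
    rcases mem_toSLP.1 h₀ with ⟨e, a, h, hq⟩ | ⟨e, l, r, h, hq⟩ | ⟨e, x, k, a, b, h, hab, hq⟩
    · cases hq
      have := toSLP_reach hG (hG.rlslp.useful _ (mem_lhs.2 ⟨_, h⟩))
      rwa [hG.repr_of_char h] at this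
    · cases hq
      have := toSLP_reach hG (hG.rlslp.useful _ (mem_lhs.2 ⟨_, h⟩))
      rwa [hG.repr_of_pair h] at this
    · cases hq
      have := toSLP_reach hG (hG.rlslp.useful _ (mem_lhs.2 ⟨_, h⟩))
      rw [repr_of_run hv h] at this
      exact (toSLP_reach_pow hG h this).1 a b hab
  · have h1 := hG.rlslp.derives.unique hv.deterministic (hs.derives hv hG.rlslp.start_mem)
    rw [h1]
    exact toSLP_derives hG hs hG.rlslp.start_mem
  · intro X x k h
    rcases mem_toSLP.1 h with ⟨_, _, _, hq⟩ | ⟨_, _, _, _, hq⟩ | ⟨_, _, _, _, _, _, _, hq⟩ <;>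
      cases hq

end SLP

/-! ## Sizes -/

/-- A bound for the number of productions that correspond to a production. -/
def expandBound : Rhs → ℕ
  | .run _ k => 2 * Nat.log 2 k
  | _ => 1

theorem card_expand_le (M : ℕ) (D : Finset Production) (p : Production) :
    (expand M D p).card ≤ expandBound p.2 := by
  obtain ⟨e, ρ⟩ := p
  cases ρ with
  | char a => simp [expand, expandBound]
  | pair l r => simp [expand, expandBound]
  | run x k =>
    refine (Finset.card_union_le _ _).trans ?_
    have h1 : (doublings M x k).card ≤ Nat.log 2 k :=
      Finset.card_image_le.trans (by simp)
    have h2 : (concatenations M x k).card ≤ Nat.log 2 k :=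
      Finset.card_image_le.trans ((Finset.card_filter_le _ _).trans (by simp))
    dsimp only [expandBound]
    omega

theorem card_biUnion_expand_le {M N : ℕ} {D S : Finset Production}
    (h : ∀ X x k, (X, Rhs.run x k) ∈ S → k ≤ N) :
    (S.biUnion (expand M D)).card ≤ S.card * (2 * Nat.log 2 N + 1) := by
  refine Finset.card_biUnion_le_card_mul _ _ _ fun p hp => ?_
  refine (card_expand_le M D p).trans ?_
  obtain ⟨X, ρ⟩ := p
  cases ρ with
  | char a => simp [expandBound]
  | pair l r => simp [expandBound]
  | run x k =>
    have := Nat.log_mono_right (b := 2) (h X x k hp)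
    dsimp only [expandBound]
    omega

theorem sum_toFinset_le {α : Type*} [DecidableEq α] (l : List α) (w : α → ℕ) :
    ∑ x ∈ l.toFinset, w x ≤ (l.map w).sum := by
  induction l with
  | nil => simp
  | cons a l ih =>
    rw [List.toFinset_cons, List.map_cons, List.sum_cons]
    by_cases h : a ∈ l.toFinset
    · rw [Finset.insert_eq_of_mem h]; omega
    · rw [Finset.sum_insert h]; omega

theorem log_two_add_one_le {k : ℕ} (hk : 0 < k) : Nat.log 2 k + 1 ≤ k :=
  Nat.log_lt_self 2 hk.ne'

/-- By `Nat.log 2 k + 1 ≤ k`, expanding a run costs at most twice its length, with `2` to spare for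
each run. The spare part pays for the levels above. -/
theorem collect_run_expandBound {qs : List (ℕ × ℕ)} {es : List ℕ} {U : List Production}
    (h : Collect RunRule qs es U) (hq : ∀ q ∈ qs, 0 < q.2) :
    (U.map fun p => expandBound p.2).sum + 2 * qs.length ≤ 2 * (runsFlatten qs).length := by
  induction h with
  | nil => simp
  | @cons q e U qs es V h1 _ ih =>
    cases h1
    have h2 := ih fun q hq' => hq q (by simp [hq'])
    have h3 := log_two_add_one_le (hq q (by simp))
    have h4 : (runsFlatten (q :: qs)).length = q.2 + (runsFlatten qs).length := by
      simp [runsFlatten]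
    rw [h4, List.map_append, List.sum_append]
    have h5 : ([(e, Rhs.run q.1 q.2)].map fun p => expandBound p.2).sum = 2 * Nat.log 2 q.2 :=
      rfl
    rw [h5, List.length_cons]
    omega

theorem collect_block_expandBound {B : List (List ℕ)} {es : List ℕ} {V : List Production}
    (h : Collect BlockRule B es V) : (V.map fun p => expandBound p.2).sum = V.length := by
  have h1 : ∀ p ∈ V, expandBound p.2 = 1 := by
    intro p hp
    obtain ⟨q, e, V', -, -, ⟨x₁, x₂, xs, rfl, hF⟩, hp, -⟩ := h.exists_of_mem_prods hp
    obtain ⟨X, ρ⟩ := p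
    obtain ⟨l, r, rfl⟩ := hF.eq_pair_of_mem hp
    rfl
  rw [List.map_congr_left (g := fun _ => 1) h1]
  simp

theorem two_mul_length_le_of_collect {B : List (List ℕ)} {es : List ℕ} {V : List Production}
    (h : Collect BlockRule B es V) : 2 * B.length ≤ B.flatten.length := by
  refine two_mul_length_le_flatten fun q hq => ?_
  obtain ⟨e, V', -, ⟨x₁, x₂, xs, rfl, -⟩, -⟩ := h.exists_of_mem_left hq
  simp

/-- With `n` runs and `b` blocks, `2 * b ≤ n`, a level and its continuation take at most `n + (n -
b) + 3 * b ≤ 3 * n` productions. Expanded, the total is at most `(2 * s.length - 2 * n) + (n - b) +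
2 * b`, which is at most `2 * s.length`. -/
theorem Parse.size_le {M : ℕ} {f : List ℕ → Bool} {s : List ℕ} {e : ℕ} {U : List Production}
    (h : Parse M f s e U) :
    U.length ≤ 3 * s.length ∧ (U.map fun p => expandBound p.2).sum ≤ 2 * s.length := by
  induction h with
  | @done s e U h =>
    have h1 := collect_run_expandBound h fun q hq => pos_of_mem_epow hq
    have h2 := collect_run_length h
    have h3 := epow_length_le s
    rw [runsFlatten_epow] at h1
    omega
  | @step s p s' e U V W h1 h2 h3 _ ih =>
    have h4 := collect_run_expandBound h1 fun q hq => pos_of_mem_epow hq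
    rw [runsFlatten_epow] at h4
    have h5 := collect_run_length h1
    have h6 := epow_length_le s
    have h7 := collect_block_expandBound h3
    have h8 := collect_block_length h3
    have h9 := two_mul_length_le_of_collect h3
    have h10 := h3.length_eq
    have h11 := h1.length_eq
    rw [eblock_flatten] at h8 h9
    simp only [List.length_append, List.map_append, List.sum_append]
    omega

section Size

variable {M : ℕ} {f : List ℕ → Bool} {T : List ℕ} {G : Grammar}

theorem IsSignatureEncoding.card_le (hG : IsSignatureEncoding M f T G) :
    G.prods.card ≤ 4 * T.length := by
  obtain ⟨s, C, U, hC, hU, hp⟩ := hG.exists_parse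
  have h1 := collect_char_length hC
  have h2 := hC.length_eq
  have h3 := hU.size_le.1
  have h4 := List.toFinset_card_le (C ++ U)
  rw [List.length_append] at h4
  rw [hp]
  omega

/-- A bound without a logarithm: it is needed for updates after which `T'` is much shorter than `T`,
and it limits the output region of the machine. -/
theorem IsSignatureEncoding.card_toSLP_le (hG : IsSignatureEncoding M f T G) :
    (G.toSLP M).prods.card ≤ 3 * T.length := by
  obtain ⟨s, C, U, hC, hU, hp⟩ := hG.exists_parse
  have h1 := collect_char_length hC
  have h2 := hC.length_eq
  have h3 := hU.size_le.2
  have h4 : (C.map fun p => expandBound p.2).sum = C.length := by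
    have h1 : ∀ p ∈ C, expandBound p.2 = 1 := by
      intro p hp
      obtain ⟨q, e, V, -, -, rfl, hp, -⟩ := hC.exists_of_mem_prods hp
      rw [List.mem_singleton.1 hp]
      rfl
    rw [List.map_congr_left (g := fun _ => 1) h1]
    simp
  calc (G.toSLP M).prods.card ≤ ∑ p ∈ G.prods, (expand M G.prods p).card :=
        Finset.card_biUnion_le
    _ ≤ ∑ p ∈ (C ++ U).toFinset, expandBound p.2 := by
        rw [← hp]
        exact Finset.sum_le_sum fun p _ => card_expand_le M _ p
    _ ≤ ((C ++ U).map fun p => expandBound p.2).sum := sum_toFinset_le _ _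
    _ ≤ 3 * T.length := by
        rw [List.map_append, List.sum_append]
        omega

theorem IsSignatureEncoding.size_toSLP_le (hG : IsSignatureEncoding M f T G) :
    (G.toSLP M).size ≤ 2 * (G.size * (Nat.log 2 T.length + 1)) := by
  refine (card_biUnion_expand_le (N := T.length) fun X x k h => hG.exponent_le h).trans ?_
  unfold Grammar.size
  calc G.prods.card * (2 * Nat.log 2 T.length + 1)
      ≤ G.prods.card * (2 * (Nat.log 2 T.length + 1)) := Nat.mul_le_mul_left _ (by omega)
    _ = 2 * (G.prods.card * (Nat.log 2 T.length + 1)) := by ring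

end Size

/-- The set is nonempty because `Nat.clog 2 n ≤ n - 1` drives the iteration down to `1`; on an empty
set `sInf` would be the default value `0`. -/
theorem one_le_logStar {n : ℕ} (hn : 2 ≤ n) : 1 ≤ logStar n := by
  have h : ∀ n, ∃ i, (Nat.clog 2)^[i] n ≤ 1 := by
    intro n
    induction n using Nat.strong_induction_on with
    | _ n ih =>
      by_cases h : n ≤ 1
      · exact ⟨0, h⟩
      · have h1 : n - 1 < 2 ^ (n - 1) := Nat.lt_two_pow_self
        have h2 : Nat.clog 2 n ≤ n - 1 := Nat.clog_le_of_le_pow (by omega)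
        obtain ⟨i, hi⟩ := ih (Nat.clog 2 n) (by omega)
        exact ⟨i + 1, hi⟩
  have h1 : logStar n ∈ {i | (Nat.clog 2)^[i] n ≤ 1} := Nat.sInf_mem (h n)
  by_contra h2
  have h3 : logStar n = 0 := by omega
  rw [h3] at h1
  exact absurd h1 (by simp; omega)

/-! ## Updates -/

/-- The expansion of a pair depends on the whole grammar, through `repr`. By hypothesis the
variables of a common production have common productions, hence the same representatives in both
grammars. -/
theorem toSLP_sdiff_subset {M : ℕ} {G G' : Grammar} {f f' : List ℕ → Bool} {T T' : List ℕ}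
    (hG : IsSignatureEncoding M f T G) (hG' : IsSignatureEncoding M f' T' G')
    (h : ∀ p ∈ G.prods, p ∈ G'.prods → ∀ y ∈ p.2.vars, y ∈ lhs (G.prods ∩ G'.prods)) :
    (G.toSLP M).prods \ (G'.toSLP M).prods ⊆
      (G.prods \ G'.prods).biUnion (expand M G.prods) := by
  have hrepr : ∀ y ∈ lhs (G.prods ∩ G'.prods), repr M G.prods y = repr M G'.prods y := by
    intro y hy
    obtain ⟨ρ, hρ⟩ := mem_lhs.1 hy
    rw [Finset.mem_inter] at hρ
    cases ρ with
    | char a => rw [hG.repr_of_char hρ.1, hG'.repr_of_char hρ.2]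
    | pair l r => rw [hG.repr_of_pair hρ.1, hG'.repr_of_pair hρ.2]
    | run x k => rw [repr_of_run hG.isValid hρ.1, repr_of_run hG'.isValid hρ.2]
  intro q hq
  rw [Finset.mem_sdiff] at hq
  obtain ⟨hq, hq'⟩ := hq
  obtain ⟨p, hp, hpq⟩ := Finset.mem_biUnion.1 hq
  refine Finset.mem_biUnion.2 ⟨p, Finset.mem_sdiff.2 ⟨hp, fun hp' => hq' ?_⟩, hpq⟩
  refine Finset.mem_biUnion.2 ⟨p, hp', ?_⟩
  have h1 := h p hp hp'
  obtain ⟨X, ρ⟩ := p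
  cases ρ with
  | char a => exact hpq
  | pair l r =>
    rw [mem_expand_pair] at hpq ⊢
    rwa [← hrepr l (h1 l (by simp [Rhs.vars])), ← hrepr r (h1 r (by simp [Rhs.vars]))]
  | run x k => exact hpq

/-- The parsing lemmas replace a nonempty part by a nonempty part, so the edit absorbs one
neighbouring character. -/
theorem IsUpdate.exists_split {T T' : List ℕ} {y : ℕ} (h : IsUpdate T T' y) (hT : T ≠ [])
    (hT' : T' ≠ []) : ∃ L o m R : List ℕ, T = L ++ o ++ R ∧ T' = L ++ m ++ R ∧ o ≠ [] ∧ m ≠ [] ∧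
      o.length ≤ y + 2 ∧ m.length ≤ y + 2 := by
  have key : ∀ A Z B : List ℕ, A ++ B ≠ [] → ∃ L o m R : List ℕ, A ++ B = L ++ o ++ R ∧
      A ++ Z ++ B = L ++ m ++ R ∧ o ≠ [] ∧ m ≠ [] ∧ o.length ≤ Z.length + 2 ∧
      m.length ≤ Z.length + 2 := by
    intro A Z B hAB
    rcases List.eq_nil_or_concat A with rfl | ⟨A, a, rfl⟩
    · cases B with
      | nil => simp at hAB
      | cons b B => exact ⟨[], [b], Z ++ [b], B, by simp, by simp, by simp, by simp, by simp, by simp⟩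
    · exact ⟨A, [a], a :: Z, B, by simp, by simp, by simp, by simp, by simp, by simp⟩
  obtain ⟨A, Y, B, rfl, ⟨rfl, rfl⟩ | ⟨rfl, rfl⟩⟩ := h
  · exact key A Y B hT
  · obtain ⟨L, o, m, R, h1, h2, h3, h4, h5, h6⟩ := key A Y B hT'
    exact ⟨L, m, o, R, h2, h1, h4, h3, h6, h5⟩

theorem IsUpdate.length_le {T T' : List ℕ} {y : ℕ} (h : IsUpdate T T' y) :
    T.length ≤ T'.length + y ∧ (y = 0 → T = T') := by
  obtain ⟨A, Y, B, rfl, ⟨rfl, rfl⟩ | ⟨rfl, rfl⟩⟩ := h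
  · refine ⟨by simp; omega, fun h => ?_⟩
    rw [List.length_eq_zero_iff.1 h, List.append_nil]
  · refine ⟨by simp; omega, fun h => ?_⟩
    rw [List.length_eq_zero_iff.1 h, List.append_nil]

theorem exists_update_bounded {M : ℕ} {f : List ℕ → Bool} {T T' : List ℕ} {y : ℕ} {G : Grammar}
    (hf : IsLocallyConsistent M f) (hT : T ≠ []) (hT' : T' ≠ []) (hM : 4 * T'.length ≤ M)
    (hu : IsUpdate T T' y) (hG : IsSignatureEncoding M f T G) :
    ∃ G' : Grammar, IsSignatureEncoding M f T' G' ∧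
      (G.prods \ G'.prods).card + (G'.prods \ G.prods).card
        ≤ 1000 * (y + Nat.log 2 T'.length * logStar M) ∧
      (G.toSLP M).prods \ (G'.toSLP M).prods ⊆
        (G.prods \ G'.prods).biUnion (expand M G.prods) ∧
      (G'.toSLP M).prods \ (G.toSLP M).prods ⊆
        (G'.prods \ G.prods).biUnion (expand M G'.prods) ∧
      ((G.toSLP M).prods \ (G'.toSLP M).prods).card +
          ((G'.toSLP M).prods \ (G.toSLP M).prods).card
        ≤ 3000 * ((y + Nat.log 2 T'.length * logStar M) * (Nat.log 2 T'.length + 1)) := by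
  obtain ⟨hlen, h0⟩ := hu.length_le
  rcases Nat.eq_zero_or_pos y with hy | hy
  · obtain rfl := h0 hy
    exact ⟨G, hG, by simp⟩
  obtain ⟨L, o, m, R, hTs, hTs', ho, hm, hoy, hmy⟩ := hu.exists_split hT hT'
  rw [hTs] at hG
  rw [hTs'] at hM
  obtain ⟨G', hG', h1, h2, h3⟩ := hG.exists_update hf ho hm hM
  rw [← hTs] at hG h1
  rw [← hTs'] at hG' h2 hM
  have hd := toSLP_sdiff_subset hG hG' h3
  have hd' := toSLP_sdiff_subset hG' hG fun p hp hp' => by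
    rw [Finset.inter_comm]
    exact h3 p hp' hp
  have hT1 := List.length_pos_iff.2 hT'
  -- The bound speaks of `T'` alone. If `T'.length = 1` its logarithm vanishes, and if `T` is at
  -- least twice as long, the logarithm for `T` is not controlled. In both cases `T.length ≤ 2 * y`
  -- and `T'.length ≤ y`, so the linear size bounds suffice even if everything changes.
  by_cases hc : T'.length = 1 ∨ 2 * T'.length ≤ T.length
  · refine ⟨G', hG', ?_, hd, hd', ?_⟩
    · have h4 := hG.card_le
      have h5 := hG'.card_le
      have h6 := Finset.card_le_card (Finset.sdiff_subset (s := G.prods) (t := G'.prods))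
      have h7 := Finset.card_le_card (Finset.sdiff_subset (s := G'.prods) (t := G.prods))
      have h8 := Nat.zero_le (Nat.log 2 T'.length * logStar M)
      omega
    · have h4 := hG.card_toSLP_le
      have h5 := hG'.card_toSLP_le
      have h6 := Finset.card_le_card
        (Finset.sdiff_subset (s := (G.toSLP M).prods) (t := (G'.toSLP M).prods))
      have h7 := Finset.card_le_card
        (Finset.sdiff_subset (s := (G'.toSLP M).prods) (t := (G.toSLP M).prods))
      have h8 : y * 1 ≤ (y + Nat.log 2 T'.length * logStar M) * (Nat.log 2 T'.length + 1) :=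
        Nat.mul_le_mul (by omega) (by omega)
      omega
  push Not at hc
  have hℓ : 1 ≤ Nat.log 2 T'.length := Nat.log_pos (by norm_num) (by omega)
  have hN : Nat.log 2 T.length ≤ Nat.log 2 T'.length + 1 := by
    rw [← Nat.log_mul_base (by norm_num) (by omega)]
    exact Nat.log_mono_right (by omega)
  have hΛ : 1 ≤ logStar M := one_le_logStar (by omega)
  -- Both `Nat.log 2 T'.length` and `logStar M` are now at least `1`, so their product absorbs the
  -- additive constants.
  have hcb : ∀ k l, k ≤ y + 2 → Nat.log 2 l ≤ Nat.log 2 T'.length + 1 →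
      k + changeBound M k l ≤ 500 * (y + Nat.log 2 T'.length * logStar M) := by
    intro k l hk hl
    unfold changeBound
    have h4 : (logStar M + 20) * (Nat.log 2 l + 1) ≤
        (21 * logStar M) * (3 * Nat.log 2 T'.length) := Nat.mul_le_mul (by omega) (by omega)
    have h5 : (21 * logStar M) * (3 * Nat.log 2 T'.length) =
      63 * (Nat.log 2 T'.length * logStar M) := by ring
    rw [mul_assoc 4]
    omega
  have hR := h1.trans (hcb _ _ hoy hN)
  have hC := h2.trans (hcb _ _ hmy (by omega))
  refine ⟨G', hG', by omega, hd, hd', ?_⟩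
  have h4 := (Finset.card_le_card hd).trans (card_biUnion_expand_le (N := T.length)
    fun X x k h => hG.exponent_le (Finset.mem_sdiff.1 h).1)
  have h5 := (Finset.card_le_card hd').trans (card_biUnion_expand_le (N := T'.length)
    fun X x k h => hG'.exponent_le (Finset.mem_sdiff.1 h).1)
  have h6 := h4.trans (Nat.mul_le_mul hR
    (show 2 * Nat.log 2 T.length + 1 ≤ 3 * (Nat.log 2 T'.length + 1) by omega))
  have h7 := h5.trans (Nat.mul_le_mul hC
    (show 2 * Nat.log 2 T'.length + 1 ≤ 3 * (Nat.log 2 T'.length + 1) by omega))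
  refine (Nat.add_le_add h6 h7).trans (le_of_eq ?_)
  ring

/-! ## Reasoning about programs -/

/-- The program halts within `t` steps, in a state that satisfies `Q`. -/
def Runs (b : ℕ) (P : Program) (s : State) (t : ℕ) (Q : State → Prop) : Prop :=
  ∃ n s', Exec b P s n s' ∧ n ≤ t ∧ Q s'

section Runs

variable {b : ℕ} {P P' : Program} {s : State} {t t' : ℕ} {Q Q' : State → Prop}

theorem Runs.mono (h : Runs b P s t Q) (ht : t ≤ t') (hQ : ∀ s', Q s' → Q' s') :
    Runs b P s t' Q' := by
  obtain ⟨n, s', h1, h2, h3⟩ := h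
  exact ⟨n, s', h1, h2.trans ht, hQ _ h3⟩

theorem Runs.skip (h : Q s) : Runs b .skip s 0 Q := ⟨0, s, .skip s, le_rfl, h⟩

theorem Runs.seq (h : Runs b P s t fun s' => Runs b P' s' t' Q) :
    Runs b (.seq P P') s (t + t') Q := by
  obtain ⟨n, s', h1, h2, n', s'', h3, h4, h5⟩ := h
  exact ⟨_, s'', .seq h1 h3, by omega, h5⟩

theorem Runs.ifLt {x y : ℕ} (h₁ : s.reg x < s.reg y → Runs b P s t Q)
    (h₂ : ¬ s.reg x < s.reg y → Runs b P' s t Q) : Runs b (.ifLt x y P P') s (t + 1) Q := by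
  by_cases h : s.reg x < s.reg y
  · obtain ⟨n, s', h3, h4, h5⟩ := h₁ h
    exact ⟨_, s', .ifTrue h h3, by omega, h5⟩
  · obtain ⟨n, s', h3, h4, h5⟩ := h₂ h
    exact ⟨_, s', .ifFalse h h3, by omega, h5⟩

theorem Runs.whileTrue {x y : ℕ} (h : s.reg x < s.reg y)
    (h' : Runs b P s t fun s' => Runs b (.whileLt x y P) s' t' Q) :
    Runs b (.whileLt x y P) s (t + t' + 1) Q := by
  obtain ⟨n, s', h1, h2, n', s'', h3, h4, h5⟩ := h'
  exact ⟨_, s'', .whileTrue h h1 h3, by omega, h5⟩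

theorem Runs.whileFalse {x y : ℕ} (h : ¬ s.reg x < s.reg y) (hQ : Q s) :
    Runs b (.whileLt x y P) s 1 Q := ⟨1, s, .whileFalse h, le_rfl, hQ⟩

end Runs

/-- Instructions. -/
inductive Instr where
  | const (d c : ℕ)
  | op (o : BinOp) (d x y : ℕ)
  | load (d x : ℕ)
  | store (x y : ℕ)

/-- An instruction as a program. -/
def Instr.toProgram : Instr → Program
  | .const d c => .const d c
  | .op o d x y => .op o d x y
  | .load d x => .load d x
  | .store x y => .store x y

/-- The effect of an instruction. -/
def Instr.step (b : ℕ) (s : State) : Instr → State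
  | .const d c => s.setReg d (c % 2 ^ b)
  | .op o d x y => s.setReg d (o.eval b (s.reg x) (s.reg y) % 2 ^ b)
  | .load d x => s.setReg d (s.mem (s.reg x))
  | .store x y => s.setMem (s.reg x) (s.reg y)

/-- A sequence of instructions as a program. -/
def block : List Instr → Program
  | [] => .skip
  | i :: l => .seq i.toProgram (block l)

/-- Reduces a segment without branches to the evaluation of a fold, which `simp` can compute. -/
theorem Runs.block {b : ℕ} {Q : State → Prop} (l : List Instr) {s : State}
    (h : Q (l.foldl (Instr.step b) s)) : Runs b (block l) s l.length Q := by
  induction l generalizing s with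
  | nil => exact Runs.skip h
  | cons i l ih =>
    rw [List.length_cons, add_comm]
    refine Runs.seq ⟨1, i.step b s, ?_, le_rfl, ih h⟩
    cases i with
    | const d c => exact .const d c s
    | op o d x y => exact .op o d x y s
    | load d x => exact .load d x s
    | store x y => exact .store x y s

/-- The machine adds `2 ^ b` before subtracting, to avoid truncation at zero; reduction modulo the
word size removes it again. -/
theorem sub_mod_word {w x y : ℕ} (h : y ≤ x) (hx : x < w) : (x + w - y) % w = x - y := by
  rw [show x + w - y = x - y + w by omega, Nat.add_mod_right, Nat.mod_eq_of_lt (by omega)]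

/-! ## Output without repetitions -/

/-- Sizes: the words have `b` bits; `A` separates the regions of the memory; `S` is the set of
productions that may be written. -/
structure Layout (b M A : ℕ) (S : Finset Production) : Prop where
  two_le : 2 ≤ M
  square : M * M + M < A
  input : 4 * M + 3 ≤ A
  word : 5 * A ≤ 2 ^ b
  deterministic : ∀ X e e', (X, e) ∈ S → (X, e') ∈ S → e = e'
  bound : ∀ q ∈ S, q.1 < A
  card : S.card ≤ M

/-- The invariant of the program: the input stands below `A`, the table of the variables `rep e`,
for `e` in `E`, from `A` on, the table that marks the variables whose productions have been
written from `2 * A` on, and the output from `3 * A` on. -/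
structure Inv (M A : ℕ) (S : Finset Production) (inp rep : ℕ → ℕ) (E : Finset ℕ)
    (L : List Production) (s : State) : Prop where
  reg0 : s.reg 0 = 3 * A
  reg1 : s.reg 1 = M + 1
  reg2 : s.reg 2 = 1
  reg3 : s.reg 3 = A
  reg4 : s.reg 4 = 2 * A
  reg5 : s.reg 5 = 3 * A + 2 + 4 * L.length
  reg15 : s.reg 15 = 0
  reg16 : s.reg 16 = 2
  input : ∀ i < A, s.mem i = inp i
  table : ∀ e ∈ E, s.mem (A + e) = rep e
  mark : ∀ v < A, s.mem (2 * A + v) = if v ∈ L.map Prod.fst then 1 else 0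
  output : ∀ i < 4 * L.length, s.mem (3 * A + 2 + i) = (L.flatMap record).getD i 0
  nodup : L.Nodup
  sub : ∀ q ∈ L, q ∈ S

/-- Every register outside `rs` has the same contents in both states. -/
def Keeps (rs : List ℕ) (s s' : State) : Prop := ∀ r, r ∉ rs → s'.reg r = s.reg r

theorem Keeps.trans {rs rs' : List ℕ} {s s' s'' : State} (h : Keeps rs s s')
    (h' : Keeps rs' s' s'') : Keeps (rs ++ rs') s s'' := fun r hr => by
  rw [List.mem_append, not_or] at hr
  rw [h' r hr.2, h r hr.1]

theorem Keeps.mono {rs rs' : List ℕ} {s s' : State} (h : Keeps rs s s') (hr : rs ⊆ rs') :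
    Keeps rs' s s' := fun r h' => h r fun h'' => h' (hr h'')

theorem length_record (p : Production) : (record p).length = 4 := by
  obtain ⟨e, a | ⟨l, r⟩ | ⟨x, k⟩⟩ := p <;> rfl

theorem length_flatMap_record (L : List Production) : (L.flatMap record).length = 4 * L.length := by
  induction L with
  | nil => rfl
  | cons p L ih =>
    rw [List.flatMap_cons, List.length_append, ih, length_record, List.length_cons]
    ring

theorem Inv.of_keeps {M A : ℕ} {S : Finset Production} {inp rep : ℕ → ℕ} {E : Finset ℕ}
    {L : List Production} {s s' : State} {rs : List ℕ} (h : Inv M A S inp rep E L s)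
    (hk : Keeps rs s s') (hm : s'.mem = s.mem)
    (hrs : ∀ r ∈ [0, 1, 2, 3, 4, 5, 15, 16], r ∉ rs) : Inv M A S inp rep E L s' where
  reg0 := by rw [hk 0 (hrs 0 (by simp)), h.reg0]
  reg1 := by rw [hk 1 (hrs 1 (by simp)), h.reg1]
  reg2 := by rw [hk 2 (hrs 2 (by simp)), h.reg2]
  reg3 := by rw [hk 3 (hrs 3 (by simp)), h.reg3]
  reg4 := by rw [hk 4 (hrs 4 (by simp)), h.reg4]
  reg5 := by rw [hk 5 (hrs 5 (by simp)), h.reg5]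
  reg15 := by rw [hk 15 (hrs 15 (by simp)), h.reg15]
  reg16 := by rw [hk 16 (hrs 16 (by simp)), h.reg16]
  input := by rw [hm]; exact h.input
  table := by rw [hm]; exact h.table
  mark := by rw [hm]; exact h.mark
  output := by rw [hm]; exact h.output
  nodup := h.nodup
  sub := h.sub

/-- Write the production in the registers 20, 21, 22, 23 unless this has been done before. -/
def emitNew : Program :=
  .seq (block [.op .add 30 4 20, .load 31 30])
    (.ifLt 31 2
      (block [.store 30 2, .store 5 20, .op .add 5 5 2, .store 5 21, .op .add 5 5 2,
        .store 5 22, .op .add 5 5 2, .store 5 23, .op .add 5 5 2])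
      .skip)

/-- Marking the left-hand side is enough to recognize a repeated production, since `S` is
deterministic. Unmarked cells are zero, so a single load decides. -/
theorem runs_emitNew {b M A : ℕ} {S : Finset Production} (hl : Layout b M A S)
    {inp rep : ℕ → ℕ} {E : Finset ℕ} (hE : ∀ e ∈ E, e < A) {L : List Production} {s : State}
    (h : Inv M A S inp rep E L s) {q : Production} (hq : q ∈ S)
    (hr : record q = [s.reg 20, s.reg 21, s.reg 22, s.reg 23]) :
    Runs b emitNew s 12 fun s' => ∃ L', Inv M A S inp rep E L' s' ∧
      (∀ p, p ∈ L' ↔ p ∈ L ∨ p = q) ∧ Keeps [5, 30, 31] s s' := by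
  have hw := hl.word
  have hv : s.reg 20 = q.1 := by
    obtain ⟨e, a | ⟨l, r⟩ | ⟨x, k⟩⟩ := q <;> simp only [record, List.cons.injEq] at hr <;>
      exact hr.1.symm
  have hqA := hl.bound q hq
  refine (Runs.seq (t' := 10) (Runs.block _ ?_)).mono (by simp) fun _ h => h
  simp only [List.foldl_cons, List.foldl_nil, Instr.step]
  generalize hs₁ : State.setReg _ 31 _ = s₁
  have hk₁ : Keeps [30, 31] s s₁ := by
    intro r hr
    simp only [List.mem_cons, List.not_mem_nil, or_false, not_or] at hr
    simp [← hs₁, State.setReg, hr.1, hr.2]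
  have hm₁ : s₁.mem = s.mem := by simp [← hs₁, State.setReg]
  have h30 : s₁.reg 30 = 2 * A + q.1 := by
    simp (disch := omega) [← hs₁, State.setReg, BinOp.eval, h.reg4, hv,
      Nat.mod_eq_of_lt]
  have h31 : s₁.reg 31 = s.mem (2 * A + q.1) := by
    simp (disch := omega) [← hs₁, State.setReg, BinOp.eval, h.reg4, hv,
      Nat.mod_eq_of_lt]
  clear hs₁
  have h' := h.of_keeps hk₁ hm₁ (by simp)
  rw [h.mark _ hqA] at h31
  refine Runs.ifLt (t := 9) (fun hlt => ?_) (fun hlt => ?_)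
  · rw [h31, h'.reg2] at hlt
    have hnew : q.1 ∉ L.map Prod.fst := fun hmem => by simp [hmem] at hlt
    have hqL : q ∉ L := fun hmem => hnew (List.mem_map_of_mem hmem)
    -- The productions written so far and the new one are distinct elements of `S`; hence there is
    -- room left and no address wraps around.
    have hcard : L.length < M := by
      have h1 : (q :: L).toFinset ⊆ S := by
        intro p hp
        rw [List.mem_toFinset, List.mem_cons] at hp
        rcases hp with rfl | hp
        · exact hq
        · exact h.sub p hp
      have h2 := Finset.card_le_card h1
      rw [List.toFinset_card_of_nodup (List.nodup_cons.2 ⟨hqL, h.nodup⟩), List.length_cons] at h2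
      exact lt_of_lt_of_le (Nat.lt_of_succ_le h2) hl.card
    have hinput := hl.input
    refine Runs.block _ ?_
    simp only [List.foldl_cons, List.foldl_nil, Instr.step]
    generalize hs₂ : State.setReg _ 5 _ = s₂
    have h20 : s₁.reg 20 = q.1 := by rw [hk₁ 20 (by simp), hv]
    have hk₂ : Keeps [5] s₁ s₂ := by
      intro r hr
      simp only [List.mem_cons, List.not_mem_nil, or_false] at hr
      simp [← hs₂, State.setReg, State.setMem, hr]
    have h5 : s₂.reg 5 = 3 * A + 2 + 4 * (L ++ [q]).length := by
      simp (disch := omega) [← hs₂, State.setReg, State.setMem, BinOp.eval, h'.reg5, h'.reg2,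
        Nat.mod_eq_of_lt]
      omega
    have hm₂ : ∀ i, s₂.mem i =
        if i = 3 * A + 2 + 4 * L.length + 3 then s₁.reg 23 else
        if i = 3 * A + 2 + 4 * L.length + 2 then s₁.reg 22 else
        if i = 3 * A + 2 + 4 * L.length + 1 then s₁.reg 21 else
        if i = 3 * A + 2 + 4 * L.length then q.1 else
        if i = 2 * A + q.1 then 1 else s₁.mem i := by
      intro i
      simp (disch := omega) only [← hs₂, State.setReg, State.setMem, Function.update_apply,
        BinOp.eval, h'.reg5, h'.reg2, Nat.mod_eq_of_lt, h30, h20, if_true, if_false,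
        Nat.reduceEqDiff, add_assoc, Nat.reduceAdd]
    clear hs₂
    have hk := hk₁.trans hk₂
    refine ⟨L ++ [q], ?_, by simp, hk.mono (by simp)⟩
    constructor
    · rw [hk₂ 0 (by simp), h'.reg0]
    · rw [hk₂ 1 (by simp), h'.reg1]
    · rw [hk₂ 2 (by simp), h'.reg2]
    · rw [hk₂ 3 (by simp), h'.reg3]
    · rw [hk₂ 4 (by simp), h'.reg4]
    · exact h5
    · rw [hk₂ 15 (by simp), h'.reg15]
    · rw [hk₂ 16 (by simp), h'.reg16]
    · intro i hi
      rw [hm₂, if_neg (by omega), if_neg (by omega), if_neg (by omega), if_neg (by omega),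
        if_neg (by omega), h'.input i hi]
    · intro e he
      have := hE e he
      rw [hm₂, if_neg (by omega), if_neg (by omega), if_neg (by omega), if_neg (by omega),
        if_neg (by omega), h'.table e he]
    · intro v hv
      rw [hm₂, if_neg (by omega), if_neg (by omega), if_neg (by omega), if_neg (by omega),
        h'.mark v hv]
      by_cases hvq : v = q.1
      · simp [hvq]
      · rw [if_neg (by omega)]
        refine if_congr ?_ rfl rfl
        rw [List.map_append, List.mem_append, List.map_singleton, List.mem_singleton]
        exact ⟨Or.inl, fun h => h.resolve_right hvq⟩
    · intro i hi
      rw [List.length_append, List.length_singleton] at hi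
      rw [hm₂, List.flatMap_append, List.flatMap_singleton, hr]
      have hlen := length_flatMap_record L
      by_cases hi' : i < 4 * L.length
      · rw [if_neg (by omega), if_neg (by omega), if_neg (by omega), if_neg (by omega),
          if_neg (by omega), h'.output i hi', List.getD_append _ _ _ _ (by omega)]
      · rw [List.getD_append_right _ _ _ _ (by omega), hlen]
        obtain ⟨j, rfl⟩ := Nat.exists_eq_add_of_le (not_lt.1 hi')
        rw [Nat.add_sub_cancel_left, hk₁ 21 (by simp), hk₁ 22 (by simp), hk₁ 23 (by simp), hv]
        have hj : j < 4 := by omega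
        rcases (by omega : j = 0 ∨ j = 1 ∨ j = 2 ∨ j = 3) with rfl | rfl | rfl | rfl
        · rw [if_neg (by omega), if_neg (by omega), if_neg (by omega), if_pos (by omega)]
          rfl
        · rw [if_neg (by omega), if_neg (by omega), if_pos (by omega)]
          rfl
        · rw [if_neg (by omega), if_pos (by omega)]
          rfl
        · rw [if_pos (by omega)]
          rfl
    · rw [List.nodup_append]
      refine ⟨h.nodup, by simp, ?_⟩
      intro p hp p' hp' e
      rw [List.mem_singleton.1 hp'] at e
      exact hqL (e ▸ hp)
    · intro p hp
      rw [List.mem_append, List.mem_singleton] at hp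
      rcases hp with hp | rfl
      · exact h.sub p hp
      · exact hq
  · rw [h31, h'.reg2] at hlt
    have hold : q.1 ∈ L.map Prod.fst := by
      by_contra hn
      simp [hn] at hlt
    have hqL : q ∈ L := by
      obtain ⟨p, hp, hpq⟩ := List.mem_map.1 hold
      have := hl.deterministic q.1 p.2 q.2 (by rw [← hpq]; exact h.sub p hp) hq
      rwa [show q = p from Prod.ext hpq.symm this.symm]
    refine (Runs.skip ?_).mono (Nat.zero_le _) fun _ h => h
    refine ⟨L, h', fun p => ⟨Or.inl, ?_⟩, hk₁.mono (by simp)⟩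
    rintro (hp | rfl)
    · exact hp
    · exact hqL

/-! ### Powers and binary digits on the machine -/

/-- The production for `x ^ (u + v)`, as the product of `x ^ u` and `x ^ v`. -/
def powProd (M x u v : ℕ) : Production := (powVar M x (u + v), .pair (powVar M x u) (powVar M x v))

/-- The largest name is `(M - 1) * (M + 1) + M = M * M + M - 1`, so every variable of the SLP
indexes a table of size `A`. -/
theorem powVar_lt {M A x m : ℕ} (hA : M * M + M < A) (hx : x ≤ M) (hm : 1 ≤ m) (hmM : m ≤ M) :
    powVar M x m < A := by
  obtain ⟨m, rfl⟩ := Nat.exists_eq_add_of_le' hm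
  rw [powVar, Nat.add_sub_cancel]
  nlinarith

/-- Justifies leaving the digit loop early: once the truncation has reached `k`, all lower digits
are zero. -/
theorem testBit_false_of_le {k i j : ℕ} (h : k ≤ k / 2 ^ i * 2 ^ i) (hj : j < i) :
    k.testBit j = false := by
  rw [← le_antisymm (Nat.div_mul_le_self k (2 ^ i)) h, Nat.testBit_mul_two_pow]
  simp [hj]

/-- Write the production for `x ^ (u + v)`, where `x`, `u`, `v` and `u + v` are in the registers
10, 24, 25 and 27. -/
def emitPow : Program :=
  .seq (block [.op .sub 28 27 2, .op .mul 28 28 1, .op .add 20 28 10, .const 21 1,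
    .op .sub 28 24 2, .op .mul 28 28 1, .op .add 22 28 10,
    .op .sub 28 25 2, .op .mul 28 28 1, .op .add 23 28 10]) emitNew

theorem runs_emitPow {b M A : ℕ} {S : Finset Production} (hl : Layout b M A S)
    {inp rep : ℕ → ℕ} {E : Finset ℕ} (hE : ∀ e ∈ E, e < A) {L : List Production} {s : State}
    (h : Inv M A S inp rep E L s) {x u v : ℕ} (hx : x ≤ M) (hu : 1 ≤ u) (hv : 1 ≤ v)
    (huv : u + v ≤ M) (h10 : s.reg 10 = x) (h24 : s.reg 24 = u) (h25 : s.reg 25 = v)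
    (h27 : s.reg 27 = u + v) (hq : powProd M x u v ∈ S) :
    Runs b emitPow s 22 fun s' => ∃ L', Inv M A S inp rep E L' s' ∧
      (∀ p, p ∈ L' ↔ p ∈ L ∨ p = powProd M x u v) ∧
      Keeps [5, 20, 21, 22, 23, 28, 30, 31] s s' := by
  have hw := hl.word
  have hsq := hl.square
  have key : ∀ m, 1 ≤ m → m ≤ M → (m + 2 ^ b - 1) % 2 ^ b = m - 1 ∧
      (m - 1) * (M + 1) % 2 ^ b = (m - 1) * (M + 1) ∧
      ((m - 1) * (M + 1) + x) % 2 ^ b = powVar M x m := by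
    intro m hm hmM
    have h1 := powVar_lt hsq hx hm hmM
    rw [powVar] at h1 ⊢
    refine ⟨sub_mod_word hm (by nlinarith), Nat.mod_eq_of_lt (by omega), Nat.mod_eq_of_lt (by omega)⟩
  obtain ⟨a1, a2, a3⟩ := key (u + v) (by omega) huv
  obtain ⟨b1, b2, b3⟩ := key u hu (by omega)
  obtain ⟨c1, c2, c3⟩ := key v hv (by omega)
  have h1 : 1 % 2 ^ b = 1 := Nat.mod_eq_of_lt (by nlinarith)
  refine (Runs.seq (t' := 12) (Runs.block _ ?_)).mono (by simp) fun _ h => h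
  simp only [List.foldl_cons, List.foldl_nil, Instr.step]
  generalize hs₁ : State.setReg _ 23 _ = s₁
  have hk₁ : Keeps [20, 21, 22, 23, 28] s s₁ := by
    intro r hr
    simp only [List.mem_cons, List.not_mem_nil, or_false, not_or] at hr
    simp [← hs₁, State.setReg, hr]
  have hm₁ : s₁.mem = s.mem := by simp [← hs₁, State.setReg]
  have hr : s₁.reg 20 = powVar M x (u + v) ∧ s₁.reg 21 = 1 ∧ s₁.reg 22 = powVar M x u ∧
      s₁.reg 23 = powVar M x v := by
    simp [← hs₁, State.setReg, BinOp.eval, h10, h24, h25, h27, h.reg1, h.reg2, a1, a2, a3, b1, b2,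
      b3, c1, c2, c3, h1]
  clear hs₁
  refine (runs_emitNew hl hE (h.of_keeps hk₁ hm₁ (by simp)) hq ?_).mono le_rfl ?_
  · rw [hr.1, hr.2.1, hr.2.2.1, hr.2.2.2]
    rfl
  · rintro s₂ ⟨L', h2, h3, h4⟩
    exact ⟨L', h2, h3, (hk₁.trans h4).mono (by simp)⟩

/-- Write the productions for the powers `x ^ 2`, `x ^ 4`, … -/
def doublingLoop : Program :=
  .whileLt 27 26 (.seq emitPow (block [.op .add 25 25 25, .op .add 24 24 24, .op .add 27 24 25]))

/-- `d` is the number of doublings to come; a round takes one test, `22` steps of output and `3`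
updates. At the end registers 24 and 25 hold the highest power, where the digit loop takes over. -/
theorem runs_doublingLoop {b M A : ℕ} {S : Finset Production} (hl : Layout b M A S)
    {inp rep : ℕ → ℕ} {E : Finset ℕ} (hE : ∀ e ∈ E, e < A) {x k : ℕ} (hx : x ≤ M) (hk : 1 ≤ k)
    (hkM : k ≤ M) (hS : ∀ u v, PowStep k u v → powProd M x u v ∈ S)
    {d j : ℕ} (hj : j + d = Nat.log 2 k) {L : List Production} {s : State}
    (h : Inv M A S inp rep E L s) (h10 : s.reg 10 = x) (h24 : s.reg 24 = 2 ^ j)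
    (h25 : s.reg 25 = 2 ^ j) (h26 : s.reg 26 = k + 1) (h27 : s.reg 27 = 2 ^ (j + 1)) :
    Runs b doublingLoop s (26 * d + 1) fun s' => ∃ L', Inv M A S inp rep E L' s' ∧
      (∀ p, p ∈ L' ↔ p ∈ L ∨ ∃ i < Nat.log 2 k, j ≤ i ∧ p = powProd M x (2 ^ i) (2 ^ i)) ∧
      s'.reg 24 = 2 ^ Nat.log 2 k ∧ s'.reg 25 = 2 ^ Nat.log 2 k ∧
      Keeps [5, 20, 21, 22, 23, 24, 25, 27, 28, 30, 31] s s' := by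
  induction d generalizing j L s with
  | zero =>
    obtain rfl : j = Nat.log 2 k := hj
    refine Runs.whileFalse ?_ ⟨L, h, ?_, h24, h25, fun _ _ => rfl⟩
    · rw [h26, h27]
      have := Nat.lt_pow_succ_log_self (b := 2) (by norm_num) k
      omega
    · intro p
      refine ⟨Or.inl, ?_⟩
      rintro (hp | ⟨i, h1, h2, -⟩)
      · exact hp
      · omega
  | succ d ih =>
    have hjk : 2 ^ (j + 1) ≤ k := by
      refine le_trans (Nat.pow_le_pow_right (by norm_num) ?_) (Nat.pow_log_le_self 2 (by omega))
      omega
    have hpos := Nat.two_pow_pos j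
    have hw := hl.word
    have hsq := hl.square
    have hin := hl.input
    have e1 : 2 ^ (j + 1) = 2 ^ j + 2 ^ j := by ring
    have e2 : 2 ^ (j + 1 + 1) = 2 ^ (j + 1) + 2 ^ (j + 1) := by ring
    refine (Runs.whileTrue (t := 22 + 3) (t' := 26 * d + 1) (by rw [h26, h27]; omega)
      (Runs.seq ((runs_emitPow hl hE h hx hpos hpos (by omega) h10 h24 h25 (by rw [h27, e1])
        (hS _ _ (Or.inl ⟨j, by omega, rfl, rfl⟩))).mono le_rfl ?_))).mono (by omega) fun _ h => h
    rintro s₁ ⟨L₁, hi₁, hL₁, hk₁⟩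
    refine Runs.block _ ?_
    simp only [List.foldl_cons, List.foldl_nil, Instr.step]
    generalize hs₂ : State.setReg _ 27 _ = s₂
    have hk₂ : Keeps [24, 25, 27] s₁ s₂ := by
      intro r hr
      simp only [List.mem_cons, List.not_mem_nil, or_false, not_or] at hr
      simp [← hs₂, State.setReg, hr]
    have hm₂ : s₂.mem = s₁.mem := by simp [← hs₂, State.setReg]
    have f24 : s₁.reg 24 = 2 ^ j := by rw [hk₁ 24 (by simp), h24]
    have f25 : s₁.reg 25 = 2 ^ j := by rw [hk₁ 25 (by simp), h25]
    have m1 : 2 ^ (j + 1) % 2 ^ b = 2 ^ (j + 1) := Nat.mod_eq_of_lt (by omega)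
    have m2 : 2 ^ (j + 1 + 1) % 2 ^ b = 2 ^ (j + 1 + 1) := Nat.mod_eq_of_lt (by omega)
    have hr : s₂.reg 24 = 2 ^ (j + 1) ∧ s₂.reg 25 = 2 ^ (j + 1) ∧
        s₂.reg 27 = 2 ^ (j + 1 + 1) := by
      simp [← hs₂, State.setReg, BinOp.eval, f24, f25, ← e1, ← e2, m1, m2]
    clear hs₂
    have hk := hk₁.trans hk₂
    refine (ih (by omega) (hi₁.of_keeps hk₂ hm₂ (by simp)) (by rw [hk 10 (by simp), h10]) hr.1
      hr.2.1 (by rw [hk 26 (by simp), h26]) hr.2.2).mono le_rfl ?_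
    rintro s₃ ⟨L', g1, g2, g3, g4, g5⟩
    refine ⟨L', g1, fun p => ?_, g3, g4, (hk.trans g5).mono (by simp)⟩
    rw [g2, hL₁]
    constructor
    · rintro ((hp | rfl) | ⟨i, a1, a2, rfl⟩)
      · exact Or.inl hp
      · exact Or.inr ⟨j, by omega, le_rfl, rfl⟩
      · exact Or.inr ⟨i, a1, by omega, rfl⟩
    · rintro (hp | ⟨i, a1, a2, rfl⟩)
      · exact Or.inl (Or.inl hp)
      · obtain rfl | hlt := eq_or_lt_of_le a2
        · exact Or.inl (Or.inr rfl)
        · exact Or.inr ⟨i, a1, hlt, rfl⟩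

/-- Write the productions that concatenate powers according to the binary digits of `k`. -/
def digitLoop : Program :=
  .whileLt 24 11 (.seq (block [.op .shr 25 25 2, .op .add 27 24 25])
    (.ifLt 27 26 (.seq emitPow (block [.op .add 24 27 15])) .skip))

/-- The digit is found by comparison: if `c` is `k` with all digits up to `i` cleared, then `c + 2 ^
i ≤ k` exactly when digit `i` is `1`. The power `2 ^ i` comes from shifting register 25. -/
theorem runs_digitLoop {b M A : ℕ} {S : Finset Production} (hl : Layout b M A S)
    {inp rep : ℕ → ℕ} {E : Finset ℕ} (hE : ∀ e ∈ E, e < A) {x k : ℕ} (hx : x ≤ M) (hk : 1 ≤ k)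
    (hkM : k ≤ M) (hS : ∀ u v, PowStep k u v → powProd M x u v ∈ S)
    {i : ℕ} (hi : i ≤ Nat.log 2 k) {L : List Production} {s : State}
    (h : Inv M A S inp rep E L s) (h10 : s.reg 10 = x) (h11 : s.reg 11 = k)
    (h24 : s.reg 24 = k / 2 ^ i * 2 ^ i) (h25 : s.reg 25 = 2 ^ i) (h26 : s.reg 26 = k + 1) :
    Runs b digitLoop s (27 * i + 1) fun s' => ∃ L', Inv M A S inp rep E L' s' ∧
      (∀ p, p ∈ L' ↔ p ∈ L ∨ ∃ j < i, k.testBit j = true ∧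
        p = powProd M x (k / 2 ^ (j + 1) * 2 ^ (j + 1)) (2 ^ j)) ∧
      Keeps [5, 20, 21, 22, 23, 24, 25, 27, 28, 30, 31] s s' := by
  induction i generalizing L s with
  | zero =>
    refine Runs.whileFalse (by simp [h24, h11]) ⟨L, h, fun p => ?_, fun _ _ => rfl⟩
    simp
  | succ i ih =>
    by_cases hlt : s.reg 24 < s.reg 11
    swap
    · refine (Runs.whileFalse hlt ⟨L, h, fun p => ?_, fun _ _ => rfl⟩).mono (by omega) fun _ h => h
      rw [h24, h11, not_lt] at hlt
      refine ⟨Or.inl, ?_⟩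
      rintro (hp | ⟨j, h1, h2, -⟩)
      · exact hp
      · rw [testBit_false_of_le hlt h1] at h2
        exact absurd h2 (by simp)
    have hpos := Nat.two_pow_pos i
    have hw := hl.word
    have hsq := hl.square
    have hin := hl.input
    have hdm := div_pow_mul_pow k i
    have hle := Nat.div_mul_le_self k (2 ^ i)
    have hlt' := Nat.lt_div_mul_add (a := k) hpos
    have hik : 2 ^ i ≤ k := le_trans (Nat.pow_le_pow_right (by norm_num) (by omega))
      (Nat.pow_log_le_self 2 (by omega))
    refine (Runs.whileTrue (t := 2 + 24) (t' := 27 * i + 1) hlt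
      (Runs.seq (Runs.block _ ?_))).mono (by omega) fun _ h => h
    simp only [List.foldl_cons, List.foldl_nil, Instr.step]
    generalize hs₁ : State.setReg _ 27 _ = s₁
    have hk₁ : Keeps [25, 27] s s₁ := by
      intro r hr
      simp only [List.mem_cons, List.not_mem_nil, or_false, not_or] at hr
      simp [← hs₁, State.setReg, hr]
    have hm₁ : s₁.mem = s.mem := by simp [← hs₁, State.setReg]
    generalize hc : k / 2 ^ (i + 1) * 2 ^ (i + 1) = c at *
    have m1 : 2 ^ (i + 1) >>> 1 % 2 ^ b = 2 ^ i := by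
      rw [Nat.shiftRight_eq_div_pow, pow_succ, pow_one, Nat.mul_div_cancel _ (by norm_num)]
      exact Nat.mod_eq_of_lt (by omega)
    have hck : c ≤ k := hc ▸ Nat.div_mul_le_self k _
    have m2 : (c + 2 ^ i) % 2 ^ b = c + 2 ^ i := Nat.mod_eq_of_lt (by omega)
    have hr : s₁.reg 25 = 2 ^ i ∧ s₁.reg 27 = c + 2 ^ i := by
      simp [← hs₁, State.setReg, BinOp.eval, h24, h25, h.reg2, m1, m2]
    clear hs₁
    have i₁ := h.of_keeps hk₁ hm₁ (by simp)
    have f10 : s₁.reg 10 = x := by rw [hk₁ 10 (by simp), h10]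
    have f24 : s₁.reg 24 = c := by rw [hk₁ 24 (by simp), h24]
    have f26 : s₁.reg 26 = k + 1 := by rw [hk₁ 26 (by simp), h26]
    refine Runs.ifLt (t := 23) (fun hb => ?_) (fun hb => ?_)
    · rw [hr.2, f26] at hb
      have hbit : k.testBit i = true := by
        by_contra hn
        rw [if_neg hn] at hdm
        omega
      rw [if_pos hbit] at hdm
      have hc1 : 1 ≤ c := by
        have := one_le_div_pow (k := k) (i := i + 1) hi (by omega)
        rw [← hc]
        exact Nat.mul_pos this (by positivity)
      have hstep : PowStep k c (2 ^ i) := Or.inr ⟨i, by omega, hbit, hc.symm, rfl⟩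
      refine Runs.seq (t := 22) (t' := 1) ((runs_emitPow hl hE i₁ hx hc1 hpos (by omega) f10 f24 hr.1 hr.2
        (hS _ _ hstep)).mono le_rfl ?_)
      rintro s₂ ⟨L₂, i₂, hL₂, hk₂⟩
      refine Runs.block _ ?_
      simp only [List.foldl_cons, List.foldl_nil, Instr.step]
      generalize hs₃ : State.setReg _ 24 _ = s₃
      have hk₃ : Keeps [24] s₂ s₃ := by
        intro r hr
        simp only [List.mem_cons, List.not_mem_nil, or_false] at hr
        simp [← hs₃, State.setReg, hr]
      have hm₃ : s₃.mem = s₂.mem := by simp [← hs₃, State.setReg]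
      have g24 : s₃.reg 24 = k / 2 ^ i * 2 ^ i := by
        simp [← hs₃, State.setReg, BinOp.eval, i₂.reg15, hk₂ 27 (by simp), hr.2, m2, hdm]
      clear hs₃
      have hk := hk₁.trans (hk₂.trans hk₃)
      refine (ih (by omega) (i₂.of_keeps hk₃ hm₃ (by simp)) (by rw [hk 10 (by simp), h10])
        (by rw [hk 11 (by simp), h11]) g24
        (by rw [hk₃ 25 (by simp), hk₂ 25 (by simp), hr.1])
        (by rw [hk 26 (by simp), h26])).mono le_rfl ?_
      rintro s₄ ⟨L', g1, g2, g3⟩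
      refine ⟨L', g1, fun p => ?_, (hk.trans g3).mono (by simp)⟩
      rw [g2, hL₂]
      constructor
      · rintro ((hp | rfl) | ⟨j, a1, a2, rfl⟩)
        · exact Or.inl hp
        · exact Or.inr ⟨i, by omega, hbit, by rw [hc]⟩
        · exact Or.inr ⟨j, by omega, a2, rfl⟩
      · rintro (hp | ⟨j, a1, a2, rfl⟩)
        · exact Or.inl (Or.inl hp)
        · obtain rfl | hlt := eq_or_lt_of_le (Nat.le_of_lt_succ a1)
          · exact Or.inl (Or.inr (by rw [hc]))
          · exact Or.inr ⟨j, hlt, a2, rfl⟩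
    · rw [hr.2, f26] at hb
      have hbit : ¬ k.testBit i = true := by
        intro hn
        rw [if_pos hn] at hdm
        omega
      rw [if_neg hbit, add_zero] at hdm
      refine (Runs.skip ?_).mono (Nat.zero_le _) fun _ h => h
      refine (ih (by omega) i₁ f10
        (by rw [hk₁ 11 (by simp), h11]) (by rw [f24, hdm]) hr.1 f26).mono le_rfl ?_
      rintro s₄ ⟨L', g1, g2, g3⟩
      refine ⟨L', g1, fun p => ?_, (hk₁.trans g3).mono (by simp)⟩
      rw [g2]
      constructor
      · rintro (hp | ⟨j, a1, a2, rfl⟩)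
        · exact Or.inl hp
        · exact Or.inr ⟨j, by omega, a2, rfl⟩
      · rintro (hp | ⟨j, a1, a2, rfl⟩)
        · exact Or.inl hp
        · obtain rfl | hlt := eq_or_lt_of_le (Nat.le_of_lt_succ a1)
          · exact absurd a2 hbit
          · exact Or.inr ⟨j, hlt, a2, rfl⟩

/-! ## The conversion program -/

/-- Write the productions that correspond to the run rule with base in register 22 and exponent
in register 23. -/
def emitRun : Program :=
  .seq (block [.op .add 10 22 15, .op .add 11 23 15, .op .add 24 2 15, .op .add 25 2 15,
    .op .add 26 23 2, .op .add 27 2 2]) (.seq doublingLoop digitLoop)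

theorem runs_emitRun {b M A : ℕ} {S : Finset Production} (hl : Layout b M A S)
    {inp rep : ℕ → ℕ} {E : Finset ℕ} (hE : ∀ e ∈ E, e < A) {x k : ℕ} (hx : x ≤ M) (hk : 1 ≤ k)
    (hkM : k ≤ M) {D : Finset Production} {X : ℕ} (hS : expand M D (X, .run x k) ⊆ S)
    {L : List Production} {s : State} (h : Inv M A S inp rep E L s) (h22 : s.reg 22 = x)
    (h23 : s.reg 23 = k) :
    Runs b emitRun s (53 * Nat.log 2 k + 8) fun s' => ∃ L', Inv M A S inp rep E L' s' ∧
      (∀ p, p ∈ L' ↔ p ∈ L ∨ p ∈ expand M D (X, .run x k)) ∧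
      Keeps [5, 10, 11, 20, 21, 22, 23, 24, 25, 26, 27, 28, 30, 31] s s' := by
  have hw := hl.word
  have hin := hl.input
  have hM := hl.two_le
  have hS' : ∀ u v, PowStep k u v → powProd M x u v ∈ S := fun u v huv =>
    hS (mem_expand_run.2 ⟨u, v, huv, rfl⟩)
  refine (Runs.seq (t' := 26 * Nat.log 2 k + 1 + (27 * Nat.log 2 k + 1))
    (Runs.block _ ?_)).mono (by simp; omega) fun _ h => h
  simp only [List.foldl_cons, List.foldl_nil, Instr.step]
  generalize hs₁ : State.setReg _ 27 _ = s₁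
  have hk₁ : Keeps [10, 11, 24, 25, 26, 27] s s₁ := by
    intro r hr
    simp only [List.mem_cons, List.not_mem_nil, or_false, not_or] at hr
    simp [← hs₁, State.setReg, hr]
  have hm₁ : s₁.mem = s.mem := by simp [← hs₁, State.setReg]
  have m1 : 1 % 2 ^ b = 1 := Nat.mod_eq_of_lt (by omega)
  have m2 : 2 % 2 ^ b = 2 := Nat.mod_eq_of_lt (by omega)
  have m3 : (k + 1) % 2 ^ b = k + 1 := Nat.mod_eq_of_lt (by omega)
  have m4 : k % 2 ^ b = k := Nat.mod_eq_of_lt (by omega)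
  have m5 : x % 2 ^ b = x := Nat.mod_eq_of_lt (by omega)
  have hr : s₁.reg 10 = x ∧ s₁.reg 11 = k ∧ s₁.reg 24 = 1 ∧ s₁.reg 25 = 1 ∧ s₁.reg 26 = k + 1 ∧
      s₁.reg 27 = 2 := by
    simp [← hs₁, State.setReg, BinOp.eval, h22, h23, h.reg2, h.reg15, m1, m2, m3, m4, m5]
  clear hs₁
  obtain ⟨f10, f11, f24, f25, f26, f27⟩ := hr
  refine Runs.seq ((runs_doublingLoop hl hE hx hk hkM hS' (zero_add _)
    (h.of_keeps hk₁ hm₁ (by simp)) f10 f24 f25 f26 f27).mono le_rfl ?_)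
  rintro s₂ ⟨L₂, i₂, hL₂, g24, g25, hk₂⟩
  refine (runs_digitLoop hl hE hx hk hkM hS' le_rfl i₂ (by rw [hk₂ 10 (by simp), f10])
    (by rw [hk₂ 11 (by simp), f11]) (by rw [g24, div_pow_log (by omega), one_mul]) g25
    (by rw [hk₂ 26 (by simp), f26])).mono le_rfl ?_
  rintro s₃ ⟨L', i₃, hL', hk₃⟩
  refine ⟨L', i₃, fun p => ?_, (hk₁.trans (hk₂.trans hk₃)).mono (by simp)⟩
  rw [hL', hL₂, mem_expand_run, or_assoc]
  refine or_congr_right ⟨?_, ?_⟩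
  · rintro (⟨i, h1, -, rfl⟩ | ⟨j, h1, h2, rfl⟩)
    · exact ⟨_, _, Or.inl ⟨i, h1, rfl, rfl⟩, rfl⟩
    · exact ⟨_, _, Or.inr ⟨j, h1, h2, rfl, rfl⟩, rfl⟩
  · rintro ⟨u, v, ⟨i, h1, rfl, rfl⟩ | ⟨j, h1, h2, rfl, rfl⟩, rfl⟩
    · exact Or.inl ⟨i, h1, Nat.zero_le _, rfl⟩
    · exact Or.inr ⟨j, h1, h2, rfl⟩

/-- Write the productions that correspond to the production in the registers 20, 21, 22, 23. -/
def emitRecord : Program :=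
  .ifLt 21 2 emitNew (.ifLt 21 16
    (.seq (block [.op .add 30 3 22, .load 22 30, .op .add 30 3 23, .load 23 30]) emitNew) emitRun)

theorem runs_emitRecord {b M A N : ℕ} {S D : Finset Production} (hl : Layout b M A S)
    (hv : IsValid M D) (hN : ∀ X x k, (X, Rhs.run x k) ∈ D → k ≤ N) (hNM : N ≤ M)
    {inp : ℕ → ℕ} {L : List Production} {s : State} (h : Inv M A S inp (repr M D) (lhs D) L s)
    {p : Production} (hp : p ∈ D) (hS : expand M D p ⊆ S)
    (hr : record p = [s.reg 20, s.reg 21, s.reg 22, s.reg 23]) :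
    Runs b emitRecord s (53 * Nat.log 2 N + 18) fun s' => ∃ L',
      Inv M A S inp (repr M D) (lhs D) L' s' ∧
      (∀ q, q ∈ L' ↔ q ∈ L ∨ q ∈ expand M D p) ∧
      Keeps [5, 10, 11, 20, 21, 22, 23, 24, 25, 26, 27, 28, 30, 31] s s' := by
  have hw := hl.word
  have hin := hl.input
  have hMA : ∀ e ∈ lhs D, e < A := fun e he => by
    have := (hv.mem_bounds he).2
    omega
  obtain ⟨e, a | ⟨l, r⟩ | ⟨x, k⟩⟩ := p
  · simp only [record, List.cons.injEq, and_true] at hr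
    obtain ⟨f20, f21, f22, f23⟩ := hr
    refine (Runs.ifLt (t := 12) (fun _ => ?_) (fun hn => ?_)).mono (by omega) fun _ h => h
    swap
    · rw [← f21, h.reg2] at hn
      omega
    refine (runs_emitNew hl hMA h (q := (e, .char a)) (hS (mem_expand_char.2 rfl)) ?_).mono le_rfl ?_
    · rw [← f20, ← f21, ← f22, ← f23]
      rfl
    · rintro s' ⟨L', h1, h2, h3⟩
      exact ⟨L', h1, fun q => by rw [h2, mem_expand_char], h3.mono (by simp)⟩
  · simp only [record, List.cons.injEq, and_true] at hr
    obtain ⟨f20, f21, f22, f23⟩ := hr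
    refine (Runs.ifLt (t := 17) (fun hn => ?_) (fun _ => ?_)).mono (by omega) fun _ h => h
    · rw [← f21, h.reg2] at hn
      omega
    refine Runs.ifLt (t := 16) (fun _ => ?_) (fun hn => ?_)
    swap
    · rw [← f21, h.reg16] at hn
      omega
    refine (Runs.seq (t' := 12) (Runs.block _ ?_)).mono (by simp) fun _ h => h
    simp only [List.foldl_cons, List.foldl_nil, Instr.step]
    generalize hs₁ : State.setReg _ 23 _ = s₁
    have hk₁ : Keeps [22, 23, 30] s s₁ := by
      intro r hr
      simp only [List.mem_cons, List.not_mem_nil, or_false, not_or] at hr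
      simp [← hs₁, State.setReg, hr]
    have hm₁ : s₁.mem = s.mem := by simp [← hs₁, State.setReg]
    have hl' := hv.vars_mem hp l (by simp [Rhs.vars])
    have hr' := hv.vars_mem hp r (by simp [Rhs.vars])
    have hlA := hMA l hl'
    have hrA := hMA r hr'
    have m1 : (A + l) % 2 ^ b = A + l := Nat.mod_eq_of_lt (by omega)
    have m2 : (A + r) % 2 ^ b = A + r := Nat.mod_eq_of_lt (by omega)
    have hr : s₁.reg 22 = repr M D l ∧ s₁.reg 23 = repr M D r := by
      simp [← hs₁, State.setReg, BinOp.eval, ← f22, ← f23, h.reg3, m1, m2, h.table l hl',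
        h.table r hr']
    clear hs₁
    refine (runs_emitNew hl hMA (h.of_keeps hk₁ hm₁ (by simp))
      (q := (e, .pair (repr M D l) (repr M D r))) (hS (mem_expand_pair.2 rfl)) ?_).mono le_rfl ?_
    · rw [hr.1, hr.2, hk₁ 20 (by simp), hk₁ 21 (by simp), ← f20, ← f21]
      rfl
    · rintro s' ⟨L', h1, h2, h3⟩
      exact ⟨L', h1, fun q => by rw [h2, mem_expand_pair], (hk₁.trans h3).mono (by simp)⟩
  · simp only [record, List.cons.injEq, and_true] at hr
    obtain ⟨f20, f21, f22, f23⟩ := hr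
    have hkN := hN e x k hp
    have hlog := Nat.log_mono_right (b := 2) hkN
    refine (Runs.ifLt (t := 53 * Nat.log 2 k + 9) (fun hn => ?_) (fun _ => ?_)).mono (by omega)
      fun _ h => h
    · rw [← f21, h.reg2] at hn
      omega
    refine Runs.ifLt (t := 53 * Nat.log 2 k + 8) (fun hn => ?_) (fun _ => ?_)
    · rw [← f21, h.reg16] at hn
      omega
    exact runs_emitRun hl hMA (hv.mem_bounds (hv.vars_mem hp x (by simp [Rhs.vars]))).2
      (hv.run_pos _ _ _ hp) (hkN.trans hNM) hS h f22.symm f23.symm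

/-- Enter the variable that takes the place of the signature with the production in the registers
20, 21, 22, 23 into the table. -/
def enterRecord : Program :=
  .ifLt 21 16 (block [.op .add 30 3 20, .store 30 20])
    (block [.op .sub 28 23 2, .op .mul 28 28 1, .op .add 28 28 22, .op .add 30 3 20, .store 30 28])

theorem Inv.insert_table {M A : ℕ} {S : Finset Production} {inp rep : ℕ → ℕ} {E : Finset ℕ}
    {L : List Production} {s s' : State} {rs : List ℕ} (h : Inv M A S inp rep E L s)
    (hk : Keeps rs s s') (hrs : ∀ r ∈ [0, 1, 2, 3, 4, 5, 15, 16], r ∉ rs)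
    {e : ℕ} (heA : e < A) (hm : s'.mem = Function.update s.mem (A + e) (rep e)) :
    Inv M A S inp rep (insert e E) L s' := by
  have hm' : ∀ i, i ≠ A + e → s'.mem i = s.mem i := fun i hi => by
    rw [hm, Function.update_of_ne hi]
  constructor
  · rw [hk 0 (hrs 0 (by simp)), h.reg0]
  · rw [hk 1 (hrs 1 (by simp)), h.reg1]
  · rw [hk 2 (hrs 2 (by simp)), h.reg2]
  · rw [hk 3 (hrs 3 (by simp)), h.reg3]
  · rw [hk 4 (hrs 4 (by simp)), h.reg4]
  · rw [hk 5 (hrs 5 (by simp)), h.reg5]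
  · rw [hk 15 (hrs 15 (by simp)), h.reg15]
  · rw [hk 16 (hrs 16 (by simp)), h.reg16]
  · intro i hi
    rw [hm' i (by omega), h.input i hi]
  · intro e' he'
    by_cases hee : e' = e
    · rw [hee, hm, Function.update_self]
    · rw [hm' _ (by omega), h.table e' (Finset.mem_of_mem_insert_of_ne he' hee)]
  · intro v hv
    rw [hm' _ (by omega), h.mark v hv]
  · intro i hi
    rw [hm' _ (by omega), h.output i hi]
  · exact h.nodup
  · exact h.sub

/-- Filling the table takes a pass of its own, since productions come in any order and a pair may
refer to a run rule that is listed later. -/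
theorem runs_enterRecord {b M A N : ℕ} {S D : Finset Production} (hl : Layout b M A S)
    (hv : IsValid M D) (hN : ∀ X x k, (X, Rhs.run x k) ∈ D → k ≤ N) (hNM : N ≤ M)
    {inp : ℕ → ℕ} {E : Finset ℕ} {L : List Production} {s : State}
    (h : Inv M A S inp (repr M D) E L s) {p : Production} (hp : p ∈ D)
    (hr : record p = [s.reg 20, s.reg 21, s.reg 22, s.reg 23]) :
    Runs b enterRecord s 6 fun s' => Inv M A S inp (repr M D) (insert p.1 E) L s' ∧
      Keeps [28, 30] s s' := by
  have hw := hl.word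
  have hin := hl.input
  have hsq := hl.square
  have hpM := (hv.bounds p hp).2
  have m1 : (A + p.1) % 2 ^ b = A + p.1 := Nat.mod_eq_of_lt (by omega)
  have hbase : s.reg 20 = p.1 → s.reg 21 < 2 → repr M D p.1 = p.1 →
      Runs b enterRecord s 6 fun s' => Inv M A S inp (repr M D) (insert p.1 E) L s' ∧
        Keeps [28, 30] s s' := by
    intro f20 f21 hrep
    refine (Runs.ifLt (t := 5) (fun _ => ?_) (fun hn => ?_))
    swap
    · rw [h.reg16] at hn
      omega
    refine (Runs.block _ ?_).mono (by simp) fun _ h => h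
    simp only [List.foldl_cons, List.foldl_nil, Instr.step]
    generalize hs₁ : State.setMem _ _ _ = s₁
    have hk₁ : Keeps [28, 30] s s₁ := by
      intro r hr
      simp only [List.mem_cons, List.not_mem_nil, or_false, not_or] at hr
      simp [← hs₁, State.setReg, State.setMem, hr]
    refine ⟨h.insert_table hk₁ (by simp) (by omega) ?_, hk₁⟩
    simp [← hs₁, State.setReg, State.setMem, BinOp.eval, h.reg3, f20, m1, hrep]
  obtain ⟨e, a | ⟨l, r⟩ | ⟨x, k⟩⟩ := p <;>
    simp only [record, List.cons.injEq, and_true] at hr <;> obtain ⟨f20, f21, f22, f23⟩ := hr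
  · refine hbase f20.symm (by omega) (repr_of_forall fun _ _ h' => ?_)
    cases hv.deterministic _ _ _ hp h'
  · refine hbase f20.symm (by omega) (repr_of_forall fun _ _ h' => ?_)
    cases hv.deterministic _ _ _ hp h'
  · clear hbase
    have hx := (hv.mem_bounds (hv.vars_mem hp x (by simp [Rhs.vars]))).2
    have hk := hv.run_pos _ _ _ hp
    have hkM := (hN _ _ _ hp).trans hNM
    have h1 := powVar_lt hsq hx hk hkM
    rw [powVar] at h1
    have a1 : (k + 2 ^ b - 1) % 2 ^ b = k - 1 := sub_mod_word hk (by omega)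
    have a2 : (k - 1) * (M + 1) % 2 ^ b = (k - 1) * (M + 1) := Nat.mod_eq_of_lt (by omega)
    have a3 : ((k - 1) * (M + 1) + x) % 2 ^ b = (k - 1) * (M + 1) + x :=
      Nat.mod_eq_of_lt (by omega)
    refine (Runs.ifLt (t := 5) (fun hn => ?_) (fun _ => ?_))
    · rw [h.reg16, ← f21] at hn
      omega
    refine (Runs.block _ ?_).mono (by simp) fun _ h => h
    simp only [List.foldl_cons, List.foldl_nil, Instr.step]
    generalize hs₁ : State.setMem _ _ _ = s₁
    have hk₁ : Keeps [28, 30] s s₁ := by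
      intro r hr
      simp only [List.mem_cons, List.not_mem_nil, or_false, not_or] at hr
      simp [← hs₁, State.setReg, State.setMem, hr]
    refine ⟨h.insert_table hk₁ (by simp) (show e < A by dsimp only at hpM; omega) ?_, hk₁⟩
    dsimp only at m1
    simp [← hs₁, State.setReg, State.setMem, BinOp.eval, h.reg1, h.reg2, h.reg3, ← f20, ← f22,
      ← f23, m1, a1, a2, a3, repr_of_run hv hp, powVar]

/-- Load the next production of the input into the registers 20, 21, 22, 23. -/
def loadRecord : Program :=
  block [.load 20 6, .op .add 6 6 2, .load 21 6, .op .add 6 6 2, .load 22 6, .op .add 6 6 2,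
    .load 23 6, .op .add 6 6 2]

theorem runs_loadRecord {b M A : ℕ} {S : Finset Production} (hl : Layout b M A S)
    {inp rep : ℕ → ℕ} {E : Finset ℕ} {L : List Production} {s : State}
    (h : Inv M A S inp rep E L s) {i : ℕ} (h6 : s.reg 6 = i) (hi : i + 4 ≤ A) :
    Runs b loadRecord s 8 fun s' => Inv M A S inp rep E L s' ∧ s'.reg 6 = i + 4 ∧
      s'.reg 20 = inp i ∧ s'.reg 21 = inp (i + 1) ∧ s'.reg 22 = inp (i + 2) ∧
      s'.reg 23 = inp (i + 3) ∧ Keeps [6, 20, 21, 22, 23] s s' := by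
  have hw := hl.word
  refine Runs.block _ ?_
  simp only [List.foldl_cons, List.foldl_nil, Instr.step]
  generalize hs₁ : State.setReg _ 6 _ = s₁
  have hk₁ : Keeps [6, 20, 21, 22, 23] s s₁ := by
    intro r hr
    simp only [List.mem_cons, List.not_mem_nil, or_false, not_or] at hr
    simp [← hs₁, State.setReg, hr]
  have hm₁ : s₁.mem = s.mem := by simp [← hs₁, State.setReg]
  have m1 : (i + 1) % 2 ^ b = i + 1 := Nat.mod_eq_of_lt (by omega)
  have m2 : (i + 2) % 2 ^ b = i + 2 := Nat.mod_eq_of_lt (by omega)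
  have m3 : (i + 3) % 2 ^ b = i + 3 := Nat.mod_eq_of_lt (by omega)
  have m4 : (i + 4) % 2 ^ b = i + 4 := Nat.mod_eq_of_lt (by omega)
  refine ⟨h.of_keeps hk₁ hm₁ (by simp), ?_, ?_, ?_, ?_, ?_, hk₁⟩
  · simp [← hs₁, State.setReg, BinOp.eval, h.reg2, h6, m4, add_assoc]
  · simp [← hs₁, State.setReg, h6, h.input i (by omega)]
  · simp [← hs₁, State.setReg, BinOp.eval, h.reg2, h6, m1, h.input (i + 1) (by omega)]
  · simp [← hs₁, State.setReg, BinOp.eval, h.reg2, h6, m2, h.input (i + 2) (by omega), add_assoc]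
  · simp [← hs₁, State.setReg, BinOp.eval, h.reg2, h6, m3, h.input (i + 3) (by omega), add_assoc]

/-- The words of the input. -/
def inputWord (M start : ℕ) (L : List Production) (i : ℕ) : ℕ := (M :: words start L).getD i 0

theorem record_eq_inputWord (M start : ℕ) (l₁ l₂ : List Production) (p : Production) :
    record p = [inputWord M start (l₁ ++ p :: l₂) (3 + 4 * l₁.length),
      inputWord M start (l₁ ++ p :: l₂) (3 + 4 * l₁.length + 1),
      inputWord M start (l₁ ++ p :: l₂) (3 + 4 * l₁.length + 2),
      inputWord M start (l₁ ++ p :: l₂) (3 + 4 * l₁.length + 3)] := by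
  have key : ∀ j < 4, inputWord M start (l₁ ++ p :: l₂) (3 + 4 * l₁.length + j) =
      (record p).getD j 0 := by
    intro j hj
    have hlen := length_flatMap_record l₁
    have hp := length_record p
    rw [inputWord, words, show 3 + 4 * l₁.length + j = 4 * l₁.length + j + 1 + 1 + 1 by omega,
      List.getD_cons_succ, List.getD_cons_succ, List.getD_cons_succ, List.flatMap_append,
      List.flatMap_cons, List.getD_append_right _ _ _ _ (by omega),
      List.getD_append _ _ _ _ (by omega), hlen, Nat.add_sub_cancel_left]
  rw [key 1 (by norm_num), key 2 (by norm_num), key 3 (by norm_num)]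
  rw [show 3 + 4 * l₁.length = 3 + 4 * l₁.length + 0 from rfl, key 0 (by norm_num)]
  obtain ⟨e, a | ⟨l, r⟩ | ⟨x, k⟩⟩ := p <;> rfl

/-- Process all productions of the input. -/
def forRecords (P : Program) : Program := .whileLt 6 7 (.seq loadRecord P)

/-- `J` describes what the processed prefix has achieved, so the same loop rule serves both the
table and the output. -/
theorem runs_forRecords {b M A start t : ℕ} {S : Finset Production} (hl : Layout b M A S)
    {rep : ℕ → ℕ} {L₀ : List Production} (hA : 3 + 4 * L₀.length ≤ A) {P : Program}
    (J : List Production → Finset ℕ → List Production → Prop)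
    (hP : ∀ l₁ p l₂ E L s, L₀ = l₁ ++ p :: l₂ → J l₁ E L →
      Inv M A S (inputWord M start L₀) rep E L s →
      record p = [s.reg 20, s.reg 21, s.reg 22, s.reg 23] →
      Runs b P s t fun s' => ∃ E' L', J (l₁ ++ [p]) E' L' ∧
        Inv M A S (inputWord M start L₀) rep E' L' s' ∧ s'.reg 6 = s.reg 6 ∧ s'.reg 7 = s.reg 7)
    {l₁ l₂ : List Production} (hL₀ : L₀ = l₁ ++ l₂) {E : Finset ℕ} {L : List Production} {s : State}
    (hJ : J l₁ E L) (h : Inv M A S (inputWord M start L₀) rep E L s)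
    (h6 : s.reg 6 = 3 + 4 * l₁.length) (h7 : s.reg 7 = 3 + 4 * L₀.length) :
    Runs b (forRecords P) s ((t + 9) * l₂.length + 1) fun s' => ∃ E' L', J L₀ E' L' ∧
      Inv M A S (inputWord M start L₀) rep E' L' s' ∧ s'.reg 7 = 3 + 4 * L₀.length := by
  induction l₂ generalizing l₁ E L s with
  | nil =>
    rw [List.append_nil] at hL₀
    subst hL₀
    exact Runs.whileFalse (by omega) ⟨E, L, hJ, h, h7⟩
  | cons p l₂ ih =>
    have hlen : L₀.length = l₁.length + (l₂.length + 1) := by simp [hL₀]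
    refine (Runs.whileTrue (t := 8 + t) (t' := (t + 9) * l₂.length + 1) (by omega)
      (Runs.seq ((runs_loadRecord hl h h6 (by omega)).mono le_rfl ?_))).mono
      (by rw [List.length_cons, mul_add]; omega) fun _ h => h
    rintro s₁ ⟨i₁, g6, g20, g21, g22, g23, hk⟩
    refine (hP l₁ p l₂ E L s₁ hL₀ hJ i₁ ?_).mono le_rfl ?_
    · rw [g20, g21, g22, g23, hL₀]
      exact record_eq_inputWord M start l₁ l₂ p
    · rintro s₂ ⟨E', L', hJ', i₂, e6, e7⟩
      refine ih (by simp [hL₀]) hJ' i₂ ?_ (by rw [e7, hk 7 (by simp), h7])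
      rw [e6, g6, List.length_append, List.length_singleton]
      omega

/-- Set up the registers. -/
def prologue : Program :=
  block [.load 1 15, .const 2 1, .const 16 2, .op .mul 3 1 1, .op .mul 3 3 1, .op .add 4 3 3,
    .op .add 0 4 3, .op .add 5 0 16, .load 7 2, .op .add 7 7 7, .op .add 7 7 7, .const 6 3,
    .op .add 7 7 6, .op .add 1 1 2]

/-- Register 15 is never assigned and serves as the constant zero, here as the address of `M`. Two
multiplications give `A = M * M * M`; the end of the input comes from the stored number of
productions. -/
theorem runs_prologue {b M start : ℕ} {S : Finset Production} (hl : Layout b M (M * M * M) S)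
    {L₀ : List Production} (hA : 3 + 4 * L₀.length ≤ M * M * M) (rep : ℕ → ℕ) :
    Runs b prologue (inputState M start L₀) 14 fun s' =>
      Inv M (M * M * M) S (inputWord M start L₀) rep ∅ [] s' ∧ s'.reg 6 = 3 ∧
      s'.reg 7 = 3 + 4 * L₀.length := by
  have hw := hl.word
  have hsq := hl.square
  have h2 := hl.two_le
  generalize hAM : M * M * M = A at *
  refine Runs.block _ ?_
  simp only [List.foldl_cons, List.foldl_nil, Instr.step]
  generalize hs₁ : State.setReg _ 1 _ = s₁
  have m1 : 1 % 2 ^ b = 1 := Nat.mod_eq_of_lt (by omega)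
  have m2 : 2 % 2 ^ b = 2 := Nat.mod_eq_of_lt (by omega)
  have m3 : 3 % 2 ^ b = 3 := Nat.mod_eq_of_lt (by omega)
  have m4 : M * M % 2 ^ b = M * M := Nat.mod_eq_of_lt (by omega)
  have m5 : A % 2 ^ b = A := Nat.mod_eq_of_lt (by omega)
  have m6 : (A + A) % 2 ^ b = A + A := Nat.mod_eq_of_lt (by omega)
  have m7 : (A + A + A) % 2 ^ b = A + A + A := Nat.mod_eq_of_lt (by omega)
  have m8 : (A + A + A + 2) % 2 ^ b = A + A + A + 2 := Nat.mod_eq_of_lt (by omega)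
  have m9 : (L₀.length + L₀.length) % 2 ^ b = L₀.length + L₀.length :=
    Nat.mod_eq_of_lt (by omega)
  have m10 : (L₀.length + L₀.length + (L₀.length + L₀.length)) % 2 ^ b =
    L₀.length + L₀.length + (L₀.length + L₀.length) := Nat.mod_eq_of_lt (by omega)
  have m11 : (L₀.length + L₀.length + (L₀.length + L₀.length) + 3) % 2 ^ b =
    L₀.length + L₀.length + (L₀.length + L₀.length) + 3 := Nat.mod_eq_of_lt (by omega)
  have m12 : (M + 1) % 2 ^ b = M + 1 := Nat.mod_eq_of_lt (by omega)
  have i0 : (inputState M start L₀).mem 0 = M := rfl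
  have i1 : (inputState M start L₀).mem 1 = L₀.length := rfl
  have ir : ∀ r, (inputState M start L₀).reg r = 0 := fun _ => rfl
  have hmem : ∀ i, s₁.mem i = inputWord M start L₀ i := by
    intro i
    simp only [← hs₁, State.setReg]
    rfl
  have hzero : ∀ i, 3 + 4 * L₀.length ≤ i → s₁.mem i = 0 := by
    intro i hi
    rw [hmem, inputWord, words]
    refine List.getD_eq_default _ _ ?_
    rw [List.length_cons, List.length_cons, List.length_cons, length_flatMap_record]
    omega
  refine ⟨⟨?_, ?_, ?_, ?_, ?_, ?_, ?_, ?_, fun i _ => hmem i, by simp, ?_, by simp, List.nodup_nil,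
    by simp⟩, ?_, ?_⟩
  · simp [← hs₁, State.setReg, BinOp.eval, ir, i0, m4, hAM, m5, m6, m7]
    omega
  · simp [← hs₁, State.setReg, BinOp.eval, ir, i0, m1, m12]
  · simp [← hs₁, State.setReg, m1]
  · simp [← hs₁, State.setReg, BinOp.eval, ir, i0, m4, hAM, m5]
  · simp [← hs₁, State.setReg, BinOp.eval, ir, i0, m4, hAM, m5, m6]
    omega
  · simp [← hs₁, State.setReg, BinOp.eval, ir, i0, m2, m4, hAM, m5, m6, m7, m8]
    omega
  · simp [← hs₁, State.setReg, ir]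
  · simp [← hs₁, State.setReg, m2]
  · intro v _
    rw [hzero _ (by omega)]
    simp
  · simp [← hs₁, State.setReg, m3]
  · simp [← hs₁, State.setReg, BinOp.eval, m1, m3, i1, m9, m10, m11]
    omega

/-- Write the number of productions and the start symbol. -/
def epilogue : Program :=
  block [.op .sub 30 5 0, .op .sub 30 30 16, .op .shr 30 30 16, .store 0 30, .load 31 16,
    .op .add 31 3 31, .load 31 31, .op .add 30 0 2, .store 30 31]

/-- The two cells in front of the output were left free for the header. The number of productions is
a quarter of the distance covered by the write pointer, and the new start symbol is looked up in the
table. -/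
theorem runs_epilogue {b M A : ℕ} {S : Finset Production} (hl : Layout b M A S)
    {rep inp : ℕ → ℕ} {E : Finset ℕ} {L : List Production} {s : State}
    (h : Inv M A S inp rep E L s) (hE : inp 2 ∈ E) (hA : inp 2 < A) :
    Runs b epilogue s 9 fun s' => ∀ i < (words (rep (inp 2)) L).length,
      s'.mem (s'.reg 0 + i) = (words (rep (inp 2)) L).getD i 0 := by
  have hw := hl.word
  have hin := hl.input
  have hcard : L.length ≤ M := by
    rw [← List.toFinset_card_of_nodup h.nodup]
    exact (Finset.card_le_card fun p hp => h.sub p (List.mem_toFinset.1 hp)).trans hl.card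
  refine Runs.block _ ?_
  simp only [List.foldl_cons, List.foldl_nil, Instr.step]
  generalize hs₁ : State.setMem _ _ _ = s₁
  have m1 : (3 * A + 2 + 4 * L.length + 2 ^ b - 3 * A) % 2 ^ b = 2 + 4 * L.length := by
    rw [sub_mod_word (by omega) (by omega)]
    omega
  have m2 : (2 + 4 * L.length + 2 ^ b - 2) % 2 ^ b = 4 * L.length := by
    rw [sub_mod_word (by omega) (by omega)]
    omega
  have m3 : (4 * L.length) >>> 2 % 2 ^ b = L.length := by
    rw [Nat.shiftRight_eq_div_pow, Nat.mul_div_cancel_left _ (by norm_num)]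
    exact Nat.mod_eq_of_lt (by omega)
  have m4 : (A + inp 2) % 2 ^ b = A + inp 2 := Nat.mod_eq_of_lt (by omega)
  have m5 : (3 * A + 1) % 2 ^ b = 3 * A + 1 := Nat.mod_eq_of_lt (by omega)
  have h0 : s₁.reg 0 = 3 * A := by simp [← hs₁, State.setReg, State.setMem, h.reg0]
  have n1 : 2 ≠ 3 * A := by omega
  have n2 : A + inp 2 ≠ 3 * A := by omega
  have hm : s₁.mem = Function.update (Function.update s.mem (3 * A) L.length) (3 * A + 1)
      (rep (inp 2)) := by
    simp [← hs₁, State.setReg, State.setMem, BinOp.eval, h.reg0, h.reg2, h.reg3, h.reg5, h.reg16,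
      m1, m2, m3, m5, n1, h.input 2 (by omega), m4, n2, h.table _ hE]
  intro i hi
  rw [h0, hm]
  rw [words, List.length_cons, List.length_cons, length_flatMap_record] at hi
  obtain rfl | rfl | ⟨j, rfl⟩ : i = 0 ∨ i = 1 ∨ ∃ j, i = j + 1 + 1 := by
    rcases i with _ | _ | j
    · exact Or.inl rfl
    · exact Or.inr (Or.inl rfl)
    · exact Or.inr (Or.inr ⟨j, rfl⟩)
  · simp [words]
  · simp [words]
  · rw [Function.update_of_ne (by omega), Function.update_of_ne (by omega), words,
      List.getD_cons_succ, List.getD_cons_succ, ← h.output j (by omega)]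
    congr 1
    omega

/-- The program that expands the run rules of a signature encoding. -/
def toSLPProgram : Program :=
  .seq prologue (.seq (forRecords enterRecord)
    (.seq (.const 6 3) (.seq (forRecords emitRecord) epilogue)))

variable {M : ℕ} {f : List ℕ → Bool} {T : List ℕ} {G : Grammar}

/-- Since `M ≥ 4`, the cube of `M` exceeds `M * M + M`, and `5 ≤ M * M` turns `M ^ 5 ≤ 2 ^ b` into
room for five regions of size `M ^ 3`. -/
theorem IsSignatureEncoding.layout (hG : IsSignatureEncoding M f T G) (hT : T ≠ [])
    (hTM : 4 * T.length ≤ M) {b : ℕ} (hb : M ^ 5 ≤ 2 ^ b) :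
    Layout b M (M * M * M) (G.toSLP M).prods := by
  have hlen : 1 ≤ T.length := List.length_pos_of_ne_nil hT
  have hM : 4 ≤ M := by omega
  have h1 : 4 * M ≤ M * M := Nat.mul_le_mul_right _ hM
  have h2 : 4 * (M * M) ≤ M * M * M := by nlinarith
  have hsq : M * M + M < M * M * M := by omega
  refine ⟨by omega, hsq, by omega, ?_, fun X e e' h h' => toSLP_deterministic hG h h', ?_, ?_⟩
  · refine le_trans ?_ hb
    rw [show M ^ 5 = M * M * (M * M * M) by ring]
    exact Nat.mul_le_mul_right _ (by omega)
  · intro q hq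
    rcases mem_toSLP.1 hq with ⟨e, a, h, rfl⟩ | ⟨e, l, r, h, rfl⟩ | ⟨e, x, k, u, v, h, huv, rfl⟩
    · have := (hG.isValid.bounds _ h).2
      dsimp only at this ⊢
      omega
    · have := (hG.isValid.bounds _ h).2
      dsimp only at this ⊢
      omega
    · have h3 := huv.pos
      have h4 := huv.le
      have h5 := hG.exponent_le h
      exact powVar_lt hsq (hG.base_bounds h).2 (by omega) (by omega)
  · have := hG.card_toSLP_le
    omega

theorem IsSignatureEncoding.runs_toSLPProgram (hG : IsSignatureEncoding M f T G) (hT : T ≠ [])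
    (hTM : 4 * T.length ≤ M) {b : ℕ} (hb : M ^ 5 ≤ 2 ^ b) {L₀ : List Production}
    (hL₀ : Lists L₀ G) :
    Runs b toSLPProgram (inputState M G.start L₀) (100 * (G.size * (Nat.log 2 T.length + 1)))
      fun s => Holds s (G.toSLP M) := by
  have hl := hG.layout hT hTM hb
  have hv := hG.isValid
  have hin := hl.input
  have hw := hl.word
  have hsize : L₀.length = G.size := by
    rw [← List.toFinset_card_of_nodup hL₀.1, hL₀.2, Grammar.size]
  have hcard := hG.card_le
  have hmem : ∀ p, p ∈ L₀ ↔ p ∈ G.prods := fun p => by rw [← hL₀.2, List.mem_toFinset]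
  have hstart : G.start ∈ lhs G.prods := hG.rlslp.start_mem
  have hsM := (hv.mem_bounds hstart).2
  have hsize1 : 1 ≤ G.size := by
    obtain ⟨e, he⟩ := mem_lhs.1 hstart
    exact Finset.card_pos.2 ⟨_, he⟩
  have hA : 3 + 4 * L₀.length ≤ M * M * M := by
    rw [hsize]
    unfold Grammar.size
    omega
  have h2A : inputWord M G.start L₀ 2 = G.start := rfl
  refine Runs.mono (t := 14 + ((6 + 9) * L₀.length + 1 + (1 +
    ((53 * Nat.log 2 T.length + 18 + 9) * L₀.length + 1 + 9)))) (Q := fun s => Holds s (G.toSLP M))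
    ?_ ?_ fun _ h => h
  swap
  -- The total is `53 * w * l + 42 * w + 26`, and `1 ≤ w` absorbs the constant.
  · rw [hsize]
    generalize G.size = w at hsize1
    generalize Nat.log 2 T.length = l
    nlinarith [Nat.zero_le (w * l)]
  refine Runs.seq ((runs_prologue hl hA (repr M G.prods)).mono le_rfl ?_)
  rintro s₁ ⟨i₁, a6, a7⟩
  refine Runs.seq ((runs_forRecords hl hA (l₁ := []) (l₂ := L₀)
    (fun l E L => E = (l.map Prod.fst).toFinset ∧ L = []) ?_ rfl
    ⟨rfl, rfl⟩ i₁ a6 a7).mono le_rfl ?_)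
  · rintro l₁ p l₂ E L s hL ⟨rfl, rfl⟩ hi hr
    refine (runs_enterRecord hl hv (fun X x k h => hG.exponent_le h) (by omega) hi
      ((hmem p).1 (by simp [hL])) hr).mono le_rfl ?_
    rintro s' ⟨hi', hk⟩
    refine ⟨_, _, ⟨?_, rfl⟩, hi', hk 6 (by simp), hk 7 (by simp)⟩
    ext e
    simp
  rintro s₂ ⟨E, L, ⟨hE, rfl⟩, i₂, b7⟩
  have hE' : E = lhs G.prods := by
    rw [hE, lhs, ← hL₀.2]
    ext e
    simp
  subst hE'
  refine Runs.seq ⟨1, _, .const 6 3 s₂, le_rfl, ?_⟩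
  have hk₃ : Keeps [6] s₂ (s₂.setReg 6 (3 % 2 ^ b)) := by
    intro r hr
    simp only [List.mem_cons, List.not_mem_nil, or_false] at hr
    simp [State.setReg, hr]
  have i₃ := i₂.of_keeps hk₃ rfl (by simp)
  have c6 : (s₂.setReg 6 (3 % 2 ^ b)).reg 6 = 3 := by
    simp only [State.setReg, Function.update_self]
    exact Nat.mod_eq_of_lt (by omega)
  refine Runs.seq ((runs_forRecords hl hA (l₁ := []) (l₂ := L₀)
    (fun l E L => E = lhs G.prods ∧ ∀ q, q ∈ L ↔ ∃ p ∈ l, q ∈ expand M G.prods p) ?_ rfl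
    ⟨rfl, by simp⟩ i₃ c6 (by rw [hk₃ 7 (by simp), b7])).mono le_rfl ?_)
  · rintro l₁ p l₂ E L s hL ⟨rfl, hmemL⟩ hi hr
    have hp : p ∈ G.prods := (hmem p).1 (by simp [hL])
    refine (runs_emitRecord hl hv (fun X x k h => hG.exponent_le h) (by omega) hi hp
      (Finset.subset_biUnion_of_mem (expand M G.prods) hp) hr).mono le_rfl ?_
    rintro s' ⟨L', hi', hL', hk⟩
    refine ⟨_, L', ⟨rfl, fun q => ?_⟩, hi', hk 6 (by simp), hk 7 (by simp)⟩
    rw [hL', hmemL]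
    simp only [List.mem_append, List.mem_singleton]
    constructor
    · rintro (⟨p', h1, h2⟩ | h)
      · exact ⟨p', Or.inl h1, h2⟩
      · exact ⟨p, Or.inr rfl, h⟩
    · rintro ⟨p', h1 | rfl, h2⟩
      · exact Or.inl ⟨p', h1, h2⟩
      · exact Or.inr h2
  rintro s₄ ⟨E, L, ⟨rfl, hL⟩, i₄, -⟩
  refine (runs_epilogue hl i₄ (by rw [h2A]; exact hstart) (by rw [h2A]; omega)).mono le_rfl ?_
  intro s₅ h₅
  refine ⟨L, ⟨i₄.nodup, ?_⟩, h₅⟩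
  ext q
  rw [List.mem_toFinset, hL, Grammar.toSLP, Finset.mem_biUnion]
  simp only [hmem]

end SigEnc

/-! ### The theorem -/

theorem mainTheorem8 :
    -- conversion: correctness, size and running time on a word RAM
    (∃ (P : SigEnc.Program) (c C : ℕ),
      ∀ (M : ℕ) (f : List ℕ → Bool) (T : List ℕ) (G : SigEnc.Grammar),
        SigEnc.IsLocallyConsistent M f → T ≠ [] → 4 * T.length ≤ M →
        SigEnc.IsSignatureEncoding M f T G →
        SigEnc.IsSLP (G.toSLP M) T ∧
        (G.toSLP M).size ≤ C * (G.size * (Nat.log 2 T.length + 1)) ∧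
        ∀ b : ℕ, M ^ c ≤ 2 ^ b → (∀ a ∈ T, a < 2 ^ b) →
          ∀ L : List SigEnc.Production, SigEnc.Lists L G →
            ∃ (n : ℕ) (s : SigEnc.State),
              SigEnc.Exec b P (SigEnc.inputState M G.start L) n s ∧
              n ≤ C * (G.size * (Nat.log 2 T.length + 1)) ∧
              SigEnc.Holds s (G.toSLP M)) ∧
    -- maintenance under an insertion or a deletion of a string of length `y`
    (∃ C : ℕ,
      ∀ (M : ℕ) (f : List ℕ → Bool) (T T' : List ℕ) (y : ℕ) (G : SigEnc.Grammar),
        SigEnc.IsLocallyConsistent M f → T ≠ [] → T' ≠ [] →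
        4 * T.length ≤ M → 4 * T'.length ≤ M →
        SigEnc.IsUpdate T T' y → SigEnc.IsSignatureEncoding M f T G →
        ∃ G' : SigEnc.Grammar,
          SigEnc.IsSignatureEncoding M f T' G' ∧
          -- number of removed and of created signatures
          (G.prods \ G'.prods).card + (G'.prods \ G.prods).card
            ≤ C * (y + Nat.log 2 T'.length * SigEnc.logStar M) ∧
          -- the SLP changes only in the productions that correspond to them
          (G.toSLP M).prods \ (G'.toSLP M).prods ⊆
            (G.prods \ G'.prods).biUnion (SigEnc.expand M G.prods) ∧
          (G'.toSLP M).prods \ (G.toSLP M).prods ⊆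
            (G'.prods \ G.prods).biUnion (SigEnc.expand M G'.prods) ∧
          -- total number of removed and of added productions of the SLP
          ((G.toSLP M).prods \ (G'.toSLP M).prods).card +
              ((G'.toSLP M).prods \ (G.toSLP M).prods).card
            ≤ C * ((y + Nat.log 2 T'.length * SigEnc.logStar M) *
                (Nat.log 2 T'.length + 1))) := by
  refine ⟨?_, 3000, ?_⟩
  · refine ⟨SigEnc.toSLPProgram, 5, 100, fun M f T G _ hT hM hG => ⟨hG.isSLP_toSLP,
      hG.size_toSLP_le.trans (Nat.mul_le_mul_right _ (by norm_num)), fun b hb _ L hL => ?_⟩⟩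
    obtain ⟨n, s, h1, h2, h3⟩ := hG.runs_toSLPProgram hT hM hb hL
    exact ⟨n, s, h1, h2, h3⟩
  · intro M f T T' y G hf hT hT' _ hM' hu hG
    obtain ⟨G', h1, h2, h3, h4, h5⟩ := SigEnc.exists_update_bounded hf hT hT' hM' hu hG
    exact ⟨G', h1, h2.trans (Nat.mul_le_mul_right _ (by norm_num)), h3, h4, h5⟩
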